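/- **Notation.** For a $2\times 2$ matrix put $\|A\|=2\max_{i,j}|a_{ij}|$. For $k\in\mathbb Z^d$ put $|k|=\sum_i|k_i|$, and for $z\in\mathbb C$ put $|z|_{\mathbb T}=\inf_{j\in\mathbb Z}|z-j|$. Let $\mathrm{DC}_d(\gamma,\tau)$ be the set of $\alpha\in\mathbb R^d$ with $|\langle n,\alpha\rangle|_{\mathbb T}\ge\gamma|n|^{-\tau}$ for all $0\ne n\in\mathbb Z^d$. For $p\in\{1,2\}$, a function $F(\theta)=\sum_{k\in\mathbb Z^d}\widehat F(k)e^{2\pi \mathrm i\langle k,\theta\rangle/p}$ on $p\mathbb T^d=\mathbb R^d/(p\mathbb Z)^d$ belongs to $G^\nu_r(p\mathbb T^d,*)$ if it is $*$-valued and $|F|_r:=\sum_k\|\widehat F(k)\|e^{r|2\pi k/p|^\nu}<\infty$. Put $J=\begin{pmatrix}0&1\\-1&0\end{pmatrix}$, $R_\phi=e^{2\pi\phi J}$ and $M=\frac1{1+\mathrm i}\begin{pmatrix}1&-\mathrm i\\1&\mathrm i\end{pmatrix}$. For $B:2\mathbb T^d\to\mathrm{SL}(2,\mathbb R)$ write $\deg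 B=n$ if $B$ is homotopic to $\theta\mapsto R_{\langle n,\theta\rangle/2}$. **Proposition 4.1 (inductive KAM step).** Let $\sigma=\frac1{20}$. There is a numerical constant $D>0$ such that for all $d\ge1$, $0<\gamma<1$, $\tau>d$, $0<\nu<1$ there is $c=c(\gamma,\tau,d,\nu)>0$ with the following property. Let $\alpha\in\mathrm{DC}_d(\gamma,\tau)$, $0<r_+<r$, $A\in\mathrm{SL}(2,\mathbb R)$ with eigenvalues $e^{\pm\mathrm i2\pi\xi}$ ($\xi\in\mathbb C$), and $f\in G^\nu_r(\mathbb T^d,\mathrm{sl}(2,\mathbb R))$. If $$|f|_r<\epsilon\le c\|A\|^{-D}\big(\min\{1,\tfrac1r\}(r-r_+)\big)^{D\tau/\nu},$$ then there exist $B\in G^\nu_{r_+}(2\mathbb T^d,\mathrm{SL}(2,\mathbb R))$, $A_+\in\mathrm{SL}(2,\mathbb R)$ and $f_+\in G^\nu_{r_+}(\mathbb T^d,\mathrm{sl}(2,\mathbb R))$ such that for all $\theta$ $$B(\theta+\alpha)^{-1}Ae^{f(\theta)}B(\theta)=A_+e^{f_+(\theta)}.$$ Moreover, with $N=\frac1{2\pi}\big(\frac{2|\ln\epsilon|}{r-r_+}\big)^{1/\nu}$: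 1. (Non-resonant case) If $|2\xi-\langle n,\alpha\rangle|_{\mathbb T}\ge\epsilon^\sigma$ for all $n\in\mathbb Z^d$ with $0<|n|\le N$, then $$\|A_+-A\|\le4\|A\|\epsilon,\qquad |f_+|_{r_+}\le\epsilon^2,\qquad |B-\mathrm{Id}|_{r_+}\le2\epsilon^{1/2}.$$ 2. (Resonant case) If $n_*\in\mathbb Z^d$ satisfies $0<|n_*|\le N$ and $|2\xi-\langle n_*,\alpha\rangle|_{\mathbb T}<\epsilon^\sigma$, then: - $A_+=(-1)^je^{a_+}$, where $j$ is the integer with $|2\xi-\langle n_*,\alpha\rangle-j|<\epsilon^\sigma$, where $a_+=M^{-1}\begin{pmatrix}\mathrm it_+&\mu_+\\\overline{\mu_+}&-\mathrm it_+\end{pmatrix}M\in\mathrm{sl}(2,\mathbb R)$ with $t_+\in\mathbb R$, $\mu_+\in\mathbb C$, and $$\|a_+\|\le8\epsilon^\sigma,\qquad |t_+|\le4\epsilon^\sigma,\qquad|\mu_+|\le\epsilon^{3/4}e^{-r|2\pi n_*|^\nu};$$ - $|f_+|_{r_+}\le b(\epsilon):=\epsilon^{\frac34-\frac{2r_+}{r-r_+}}e^{-(r-r_+)\epsilon^{-\frac{10\nu}{11}\frac\sigma\tau}}$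 and $b(\epsilon)\le\epsilon^2$; - $|B|_{r''}\le32\gamma^{-1/2}\|A\|^{1/2}|n_*|^{\tau/2}e^{r''(\pi|n_*|)^\nu}$ for all $r''\in(0,r_+]$; - $\xi$ is real, and $A$ is conjugate in $\mathrm{SL}(2,\mathbb R)$ to $R_\xi$ or to $R_{-\xi}$. In the first case (always attained after replacing $(\xi,n_*)$ by $(-\xi,-n_*)$ if necessary) $\deg B=n_*$; in the second case $\deg B=-n_*$. Finally, $b(\epsilon)\ll\epsilon^2$: for each $\delta>0$ there is $\epsilon_0=\epsilon_0(\delta,\gamma,\tau,d,\nu)>0$ such that $b(\epsilon)\le\delta\epsilon^2$ whenever $0<r_+<r$, $0<\epsilon\le\epsilon_0$ and $\epsilon\le c\big(\min\{1,\frac1r\}(r-r_+)\big)^{D\tau/\nu}$. -/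

import Mathlib

noncomputable section

/-- Real `2 × 2` matrices. -/
abbrev RMat : Type := Matrix (Fin 2) (Fin 2) ℝ

/-- The canonical norm `n · max |a_ij|` of an `n × n` matrix, for `n = 2`. -/
def canonNorm {𝕜 : Type*} [Norm 𝕜] (A : Matrix (Fin 2) (Fin 2) 𝕜) : ℝ :=
  2 * max (max ‖A 0 0‖ ‖A 0 1‖) (max ‖A 1 0‖ ‖A 1 1‖)

/-- The entries of a real matrix regarded as complex numbers. -/
def toC (A : RMat) : Matrix (Fin 2) (Fin 2) ℂ := A.map (fun x : ℝ => (x : ℂ))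

/-- `|k| = ∑ |k_i|` for `k ∈ ℤ^d`. -/
def l1 {d : ℕ} (k : Fin d → ℤ) : ℝ := ∑ i, |(k i : ℝ)|

/-- `⟨k, x⟩ = ∑ k_i x_i`. -/
def pairing {d : ℕ} (k : Fin d → ℤ) (x : Fin d → ℝ) : ℝ := ∑ i, (k i : ℝ) * x i

/-- `|z|_𝕋 = inf_{j ∈ ℤ} |z - j|`, for a (possibly non-real) number `z`. -/
def torusDist (z : ℂ) : ℝ := ⨅ j : ℤ, ‖z - (j : ℂ)‖

/-- The Diophantine set `DC_d(γ, τ)`. -/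
def DC (d : ℕ) (γ τ : ℝ) : Set (Fin d → ℝ) :=
  {x | ∀ n : Fin d → ℤ, n ≠ 0 → γ / l1 n ^ τ ≤ torusDist ((pairing n x : ℝ) : ℂ)}

/-- The `k`-th Fourier coefficient of a matrix-valued function on `p𝕋^d = ℝ^d / (pℤ)^d`,
that is the mean over `p𝕋^d` of `F(θ) e^{-2πi⟨k,θ⟩/p}` (substitute `θ = p x`). -/
def fCoeff (p : ℝ) {d : ℕ} (F : (Fin d → ℝ) → RMat) (k : Fin d → ℤ) :
    Matrix (Fin 2) (Fin 2) ℂ :=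
  Matrix.of fun i j => ∫ x in Set.Icc (0 : Fin d → ℝ) 1,
    ((F (p • x) i j : ℝ) : ℂ) * Complex.exp (-(2 * Real.pi * pairing k x * Complex.I))

/-- The `k`-th term of the series defining the Gevrey norm of width `r` on `p𝕋^d`:
`‖F̂(k)‖ e^{r|2πk|^ν}` for `p = 1`, `‖F̂(k)‖ e^{r|πk|^ν}` for `p = 2`. -/
def gevreyTerm (p ν r : ℝ) {d : ℕ} (F : (Fin d → ℝ) → RMat) (k : Fin d → ℤ) : ℝ :=
  canonNorm (fCoeff p F k) * Real.exp (r * (2 * Real.pi / p * l1 k) ^ ν)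

/-- The Gevrey norm `|F|_r` of a function on `p𝕋^d`. -/
def gevreyNorm (p ν r : ℝ) {d : ℕ} (F : (Fin d → ℝ) → RMat) : ℝ :=
  ∑' k, gevreyTerm p ν r F k

/-- Membership in `G^ν_r(p𝕋^d)`: the Gevrey norm is a convergent sum and the function is
the sum of its Fourier series (so it is continuous and `(pℤ)^d`-periodic). -/
structure MemGevrey (p ν r : ℝ) {d : ℕ} (F : (Fin d → ℝ) → RMat) : Prop where
  summable : Summable (gevreyTerm p ν r F)
  hasSum : ∀ θ, HasSum
    (fun k => Complex.exp (2 * Real.pi * pairing k θ / p * Complex.I) • fCoeff p F k)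
    (toC (F θ))

/-- Membership in `G^ν_r(p𝕋^d, SL(2,ℝ))`. -/
def MemGevreySL (p ν r : ℝ) {d : ℕ} (F : (Fin d → ℝ) → RMat) : Prop :=
  MemGevrey p ν r F ∧ ∀ θ, (F θ).det = 1

/-- Membership in `G^ν_r(p𝕋^d, sl(2,ℝ))`. -/
def MemGevreysl (p ν r : ℝ) {d : ℕ} (F : (Fin d → ℝ) → RMat) : Prop :=
  MemGevrey p ν r F ∧ ∀ θ, (F θ).trace = 0

/-- The rotation `R_φ = e^{2πφJ}`, `J = (0 1; -1 0)`. -/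
def rot (φ : ℝ) : RMat :=
  !![Real.cos (2 * Real.pi * φ), Real.sin (2 * Real.pi * φ);
    -Real.sin (2 * Real.pi * φ), Real.cos (2 * Real.pi * φ)]

/-- Conjugacy of two matrices by an element of `SL(2,ℝ)`. -/
def ConjSL (A A' : RMat) : Prop := ∃ P : RMat, P.det = 1 ∧ A = P⁻¹ * A' * P

/-- `deg B = n`: the map `B : 2𝕋^d → SL(2,ℝ)` is homotopic, through continuous maps
`2𝕋^d → SL(2,ℝ)`, to `θ ↦ R_{⟨n,θ⟩/2}`. -/
def HasDegree {d : ℕ} (B : (Fin d → ℝ) → RMat) (n : Fin d → ℤ) : Prop :=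
  ∃ H : unitInterval × (Fin d → ℝ) → RMat, Continuous H ∧
    (∀ s θ, (H (s, θ)).det = 1) ∧
    (∀ s θ (m : Fin d → ℤ), H (s, fun i => θ i + 2 * (m i : ℝ)) = H (s, θ)) ∧
    (∀ θ, H (0, θ) = B θ) ∧
    (∀ θ, H (1, θ) = rot (pairing n θ / 2))

/-- The matrix `M` that conjugates `sl(2,ℝ)` to `su(1,1)`. -/
def Mmat : Matrix (Fin 2) (Fin 2) ℂ :=
  (1 / (1 + Complex.I)) • !![1, -Complex.I; 1, Complex.I]

/-- The element `(it μ; μ̄ -it)` of `su(1,1)`. -/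
def su11 (t : ℝ) (μ : ℂ) : Matrix (Fin 2) (Fin 2) ℂ :=
  !![Complex.I * t, μ; (starRingEnd ℂ) μ, -(Complex.I * t)]

/-- The two eigenvalues of `A`, with multiplicity, are `e^{±2πiξ}`. -/
def HasEigenvaluesExp (A : RMat) (ξ : ℂ) : Prop :=
  (toC A).charpoly =
    (Polynomial.X - Polynomial.C (Complex.exp (2 * Real.pi * ξ * Complex.I))) *
    (Polynomial.X - Polynomial.C (Complex.exp (-(2 * Real.pi * ξ * Complex.I))))

/-- `N = (1/2π) (2|ln ε| / (r - r₊))^{1/ν}`. -/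
def truncN (ν r r' ε : ℝ) : ℝ :=
  1 / (2 * Real.pi) * (2 * |Real.log ε| / (r - r')) ^ (1 / ν)

/-- The divisor `|2ξ - ⟨n, α⟩|_𝕋`. -/
def resDist {d : ℕ} (ξ : ℂ) (α : Fin d → ℝ) (n : Fin d → ℤ) : ℝ :=
  torusDist (2 * ξ - ((pairing n α : ℝ) : ℂ))

/-- `ε^{3/4 - 2r₊/(r-r₊)} exp(-(r-r₊) ε^{-(10ν/11)(σ/τ)})` with `σ = 1/20`. -/
def resBound (ν τ r r' ε : ℝ) : ℝ :=
  ε ^ (3 / 4 - 2 * r' / (r - r') : ℝ) *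
    Real.exp (-((r - r') * ε ^ (-(10 * ν / 11 * ((1 / 20) / τ)))))

/-- The estimates of the non-resonant case. -/
def NonresEstimates {d : ℕ} (ν r' ε : ℝ) (A A' : RMat)
    (B f' : (Fin d → ℝ) → RMat) : Prop :=
  canonNorm (A' - A) ≤ 4 * canonNorm A * ε ∧
  gevreyNorm 1 ν r' f' ≤ ε ^ 2 ∧
  gevreyNorm 2 ν r' (fun θ => B θ - 1) ≤ 2 * ε ^ (1 / 2 : ℝ)

/-- The conclusions of the resonant case, with resonant site `n`. The sign `(-1)^j` records the
integer `j` nearest to `2ξ - ⟨n,α⟩`. The degree is `n` or `-n` according to whether `A`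
is the rotation by `ξ` or the one by `-ξ`, up to conjugacy in `SL(2,ℝ)`. -/
def ResEstimates {d : ℕ} (γ τ ν r r' ε : ℝ) (α : Fin d → ℝ) (ξ : ℂ) (n : Fin d → ℤ)
    (A A' : RMat) (B f' : (Fin d → ℝ) → RMat) : Prop :=
  (∃ (a : RMat) (t : ℝ) (μ : ℂ),
    (∀ j : ℤ, ‖2 * ξ - ((pairing n α : ℝ) : ℂ) - (j : ℂ)‖ < ε ^ (1 / 20 : ℝ) →
      A' = ((-1 : ℝ) ^ j) • NormedSpace.exp a) ∧
    canonNorm a ≤ 8 * ε ^ (1 / 20 : ℝ) ∧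
    toC a = Mmat⁻¹ * su11 t μ * Mmat ∧
    |t| ≤ 4 * ε ^ (1 / 20 : ℝ) ∧
    ‖μ‖ ≤ ε ^ (3 / 4 : ℝ) * Real.exp (-(r * (2 * Real.pi * l1 n) ^ ν))) ∧
  gevreyNorm 1 ν r' f' ≤ resBound ν τ r r' ε ∧
  resBound ν τ r r' ε ≤ ε ^ 2 ∧
  (∀ r'' : ℝ, 0 < r'' → r'' ≤ r' →
    gevreyNorm 2 ν r'' B ≤ 32 * γ ^ (-(1 / 2) : ℝ) * canonNorm A ^ (1 / 2 : ℝ) *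
      l1 n ^ (τ / 2) * Real.exp (r'' * (Real.pi * l1 n) ^ ν)) ∧
  (∀ x : ℝ, ξ = (x : ℂ) →
    (ConjSL A (rot x) → HasDegree B n) ∧ (ConjSL A (rot (-x)) → HasDegree B (-n))) ∧
  (∃ x : ℝ, ξ = (x : ℂ) ∧ (ConjSL A (rot x) ∨ ConjSL A (rot (-x))))

end

noncomputable section

set_option linter.unusedSectionVars false

lemma two_pow_le_factorial_succ (n : ℕ) : (2 : ℝ) ^ n ≤ (n + 1).factorial := by
  induction n with
  | zero => simp
  | succ n ih =>
    rw [pow_succ, Nat.factorial_succ]; push_cast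
    have : (0 : ℝ) ≤ n := n.cast_nonneg
    nlinarith [pow_pos (two_pos : (0 : ℝ) < 2) n]

section BanachAlgebra

variable {X : Type*} [NormedRing X] [NormOneClass X] [NormedAlgebra ℝ X] [CompleteSpace X]

open NormedSpace

lemma norm_pow_sub_pow_le {a b : X} {ρ : ℝ} (ha : ‖a‖ ≤ ρ) (hb : ‖b‖ ≤ ρ) (n : ℕ) :
    ‖a ^ (n + 1) - b ^ (n + 1)‖ ≤ (n + 1) * ρ ^ n * ‖a - b‖ := by
  have hρ : 0 ≤ ρ := (norm_nonneg _).trans ha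
  induction n with
  | zero => simp
  | succ n ih =>
    have e : a ^ (n + 1 + 1) - b ^ (n + 1 + 1) =
        a ^ (n + 1) * (a - b) + (a ^ (n + 1) - b ^ (n + 1)) * b := by
      simp only [pow_succ, mul_sub, sub_mul]; abel
    have h1 : ‖a ^ (n + 1)‖ ≤ ρ ^ (n + 1) :=
      (norm_pow_le _ _).trans (pow_le_pow_left₀ (norm_nonneg _) ha _)
    calc ‖a ^ (n + 1 + 1) - b ^ (n + 1 + 1)‖
        ≤ ‖a ^ (n + 1)‖ * ‖a - b‖ + ‖a ^ (n + 1) - b ^ (n + 1)‖ * ‖b‖ := by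
          rw [e]; exact (norm_add_le _ _).trans (add_le_add (norm_mul_le _ _) (norm_mul_le _ _))
      _ ≤ ρ ^ (n + 1) * ‖a - b‖ + ((n + 1) * ρ ^ n * ‖a - b‖) * ρ := by gcongr
      _ = _ := by push_cast; ring

/-- The remainder `e^x - 1 - x`. -/
def expRem (x : X) : X := exp x - 1 - x

lemma expRem_hasSum (x : X) :
    HasSum (fun n : ℕ => (((n + 2).factorial : ℝ)⁻¹) • x ^ (n + 2)) (expRem x) := by
  have h := exp_series_hasSum_exp' (𝕂 := ℝ) x
  have := (hasSum_nat_add_iff' 2).2 h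
  simpa [Finset.sum_range_succ, expRem, sub_sub] using this

lemma expRem_zero : expRem (0 : X) = 0 := by simp [expRem]

lemma norm_expRem_sub_le {x y : X} {ρ : ℝ} (hρ : ρ ≤ 1) (hx : ‖x‖ ≤ ρ) (hy : ‖y‖ ≤ ρ) :
    ‖expRem x - expRem y‖ ≤ 2 * ρ * ‖x - y‖ := by
  have h0 : 0 ≤ ρ := (norm_nonneg _).trans hx
  have h := (expRem_hasSum x).sub (expRem_hasSum y)
  have hb : ∀ n : ℕ, ‖(((n + 2).factorial : ℝ)⁻¹) • x ^ (n + 2) -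
      (((n + 2).factorial : ℝ)⁻¹) • y ^ (n + 2)‖ ≤ ρ * ‖x - y‖ * (1 / 2) ^ n := by
    intro n
    rw [← smul_sub, norm_smul, Real.norm_of_nonneg (by positivity)]
    have h1 := norm_pow_sub_pow_le hx hy (n + 1)
    have h2 : ρ ^ (n + 1) ≤ ρ := by
      rw [pow_succ]; exact mul_le_of_le_one_left h0 (pow_le_one₀ h0 hρ)
    have h3 : (((n + 2).factorial : ℝ)⁻¹) * (n + 2) ≤ (1 / 2) ^ n := by
      have : ((n + 2).factorial : ℝ) = (n + 2) * (n + 1).factorial := by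
        rw [Nat.factorial_succ (n + 1)]; push_cast; ring
      rw [this, mul_inv, mul_comm (_⁻¹), mul_assoc, inv_mul_cancel₀ (by positivity), mul_one,
        one_div, inv_pow]
      apply inv_anti₀ (by positivity)
      exact two_pow_le_factorial_succ n
    calc (((n + 2).factorial : ℝ)⁻¹) * ‖x ^ (n + 2) - y ^ (n + 2)‖
        ≤ (((n + 2).factorial : ℝ)⁻¹) * ((((n + 1 : ℕ) : ℝ) + 1) * ρ ^ (n + 1) * ‖x - y‖) := by
          gcongr
      _ = ((((n + 2).factorial : ℝ)⁻¹) * (n + 2)) * ρ ^ (n + 1) * ‖x - y‖ := by push_cast; ring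
      _ ≤ (1 / 2) ^ n * ρ * ‖x - y‖ := by gcongr
      _ = _ := by ring
  have hg : HasSum (fun n : ℕ => ρ * ‖x - y‖ * (1 / 2 : ℝ) ^ n) (ρ * ‖x - y‖ * 2) := by
    simpa using hasSum_geometric_two.mul_left (ρ * ‖x - y‖)
  calc _ ≤ ρ * ‖x - y‖ * 2 := by
        rw [← h.tsum_eq]; exact tsum_of_norm_bounded hg hb
    _ = _ := by ring

lemma norm_expRem_le {x : X} (hx : ‖x‖ ≤ 1) : ‖expRem x‖ ≤ 2 * ‖x‖ ^ 2 := by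
  have := norm_expRem_sub_le (x := x) (y := 0) (ρ := ‖x‖) hx le_rfl (by simp)
  rw [expRem_zero, sub_zero, sub_zero] at this
  linarith [sq ‖x‖]

lemma exp_eq_expRem (x : X) : exp x = 1 + x + expRem x := by simp [expRem]

lemma norm_exp_sub_exp_le {x y : X} {ρ : ℝ} (hρ : ρ ≤ 1) (hx : ‖x‖ ≤ ρ) (hy : ‖y‖ ≤ ρ) :
    ‖exp x - exp y‖ ≤ (1 + 2 * ρ) * ‖x - y‖ := by
  have : exp x - exp y = (x - y) + (expRem x - expRem y) := by
    simp only [expRem]; abel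
  rw [this]
  linarith [norm_add_le (x - y) (expRem x - expRem y), norm_expRem_sub_le hρ hx hy]

lemma norm_exp_sub_one_le {x : X} {ρ : ℝ} (hρ : ρ ≤ 1) (hx : ‖x‖ ≤ ρ) :
    ‖exp x - 1‖ ≤ (1 + 2 * ρ) * ‖x‖ := by
  have h0 : 0 ≤ ρ := (norm_nonneg _).trans hx
  simpa using norm_exp_sub_exp_le (y := (0 : X)) hρ hx (by simpa)

/-- The second order part of `(x, y) ↦ e^x e^y`. -/
def expMulRem (x y : X) : X := exp x * exp y - 1 - x - y

lemma expMulRem_eq (x y : X) :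
    expMulRem x y = (exp x - 1) * (exp y - 1) + expRem x + expRem y := by
  simp only [expMulRem, expRem, mul_sub, sub_mul, mul_one, one_mul]; abel

lemma norm_expMulRem_sub_le {x y x' y' : X} {ρ : ℝ} (hρ : ρ ≤ 1) (hx : ‖x‖ ≤ ρ) (hy : ‖y‖ ≤ ρ)
    (hx' : ‖x'‖ ≤ ρ) (hy' : ‖y'‖ ≤ ρ) :
    ‖expMulRem x y - expMulRem x' y'‖ ≤ 11 * ρ * (‖x - x'‖ + ‖y - y'‖) := by
  have h0 : 0 ≤ ρ := (norm_nonneg _).trans hx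
  have e : expMulRem x y - expMulRem x' y' =
      (exp x - exp x') * (exp y - 1) + (exp x' - 1) * (exp y - exp y') +
        (expRem x - expRem x') + (expRem y - expRem y') := by
    simp only [expMulRem_eq, mul_sub, sub_mul, mul_one, one_mul]; abel
  have h1 : ‖exp x - exp x'‖ ≤ 3 * ‖x - x'‖ :=
    (norm_exp_sub_exp_le hρ hx hx').trans (by gcongr; linarith)
  have h2 : ‖exp y - exp y'‖ ≤ 3 * ‖y - y'‖ :=
    (norm_exp_sub_exp_le hρ hy hy').trans (by gcongr; linarith)
  have h3 : ‖exp y - 1‖ ≤ 3 * ρ :=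
    (norm_exp_sub_one_le hρ hy).trans (by gcongr; linarith)
  have h4 : ‖exp x' - 1‖ ≤ 3 * ρ :=
    (norm_exp_sub_one_le hρ hx').trans (by gcongr; linarith)
  calc _ ≤ ‖exp x - exp x'‖ * ‖exp y - 1‖ + ‖exp x' - 1‖ * ‖exp y - exp y'‖ +
        ‖expRem x - expRem x'‖ + ‖expRem y - expRem y'‖ := by
        rw [e]
        refine (norm_add_le _ _).trans (add_le_add_left ((norm_add_le _ _).trans
          (add_le_add_left ((norm_add_le _ _).trans
          (add_le_add (norm_mul_le _ _) (norm_mul_le _ _))) _)) _)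
    _ ≤ 3 * ‖x - x'‖ * (3 * ρ) + 3 * ρ * (3 * ‖y - y'‖) + 2 * ρ * ‖x - x'‖ + 2 * ρ * ‖y - y'‖ := by
        gcongr
        · exact norm_expRem_sub_le hρ hx hx'
        · exact norm_expRem_sub_le hρ hy hy'
    _ = _ := by ring

lemma expMulRem_zero : expMulRem (0 : X) 0 = 0 := by simp [expMulRem]

/-- A quantitative fixed point theorem for a `1/2`-contraction of a ball in a closed set. -/
lemma exists_fixedPoint_of_half_contraction {V : Type*} [NormedAddCommGroup V] [CompleteSpace V]
    (Φ : V → V) (G : Set V) (hG : IsClosed G) (h0 : (0 : V) ∈ G) {ρ : ℝ} (hρ : 0 ≤ ρ)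
    (hmem : ∀ u ∈ G, ‖u‖ ≤ ρ → Φ u ∈ G) (hΦ0 : ‖Φ 0‖ ≤ ρ / 2)
    (hlip : ∀ u v, ‖u‖ ≤ ρ → ‖v‖ ≤ ρ → ‖Φ u - Φ v‖ ≤ 1 / 2 * ‖u - v‖) :
    ∃ u ∈ G, ‖u‖ ≤ ρ ∧ Φ u = u := by
  set S : Set V := G ∩ Metric.closedBall 0 ρ
  have hS : IsComplete S := (hG.inter Metric.isClosed_closedBall).isComplete
  have hball : ∀ u, ‖u‖ ≤ ρ → ‖Φ u‖ ≤ ρ := by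
    intro u hu
    have h1 := hlip u 0 hu (by simpa)
    have h2 : ‖Φ u‖ ≤ ‖Φ u - Φ 0‖ + ‖Φ 0‖ := by simpa using norm_add_le (Φ u - Φ 0) (Φ 0)
    rw [sub_zero] at h1; linarith
  have hmaps : Set.MapsTo Φ S S := by
    rintro u ⟨hu, hu'⟩
    rw [mem_closedBall_zero_iff] at hu'
    exact ⟨hmem u hu hu', by rw [mem_closedBall_zero_iff]; exact hball u hu'⟩
  have hc : ContractingWith (1 / 2) (hmaps.restrict Φ S S) := by
    refine ⟨by rw [← NNReal.coe_lt_coe]; norm_num, LipschitzWith.of_dist_le_mul ?_⟩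
    rintro ⟨u, _, hu⟩ ⟨v, _, hv⟩
    rw [mem_closedBall_zero_iff] at hu hv
    rw [Subtype.dist_eq, Subtype.dist_eq, dist_eq_norm, dist_eq_norm]
    simpa using hlip u v hu hv
  obtain ⟨u, hu, hfix, -⟩ := hc.exists_fixedPoint' hS hmaps (x := 0)
    ⟨h0, by simpa⟩ (edist_ne_top _ _)
  exact ⟨u, hu.1, by simpa using hu.2, hfix⟩

lemma exp_mem_of_isClosed (G : Subalgebra ℝ X) (hG : IsClosed (G : Set X)) {x : X} (hx : x ∈ G) :
    exp x ∈ G := by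
  have h := exp_series_hasSum_exp' (𝕂 := ℝ) x
  exact hG.mem_of_tendsto h (Filter.Eventually.of_forall fun s =>
    G.sum_mem fun n _ => G.smul_mem (G.pow_mem hx n) _)

lemma map_exp_of_hasSum {E : Type*} [NormedRing E] [NormedAlgebra ℝ E] [CompleteSpace E]
    (L : X →L[ℝ] E) (h1 : L 1 = 1) (hmul : ∀ x y, L (x * y) = L x * L y) (x : X) :
    L (exp x) = exp (L x) := by
  have hpow : ∀ n : ℕ, L (x ^ n) = L x ^ n := by
    intro n
    induction n with
    | zero => simp [h1]
    | succ n ih => rw [pow_succ, pow_succ, hmul, ih]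
  have h := L.hasSum (exp_series_hasSum_exp' (𝕂 := ℝ) x)
  simp only [map_smul, hpow] at h
  exact h.unique (exp_series_hasSum_exp' (𝕂 := ℝ) (L x))

lemma exists_log (G : Subalgebra ℝ X) (hG : IsClosed (G : Set X)) {u : X} (hu : u ∈ G)
    (hn : ‖u‖ ≤ 1 / 16) : ∃ z ∈ G, exp z = 1 + u ∧ ‖z‖ ≤ 2 * ‖u‖ ∧ ‖z - u‖ ≤ 8 * ‖u‖ ^ 2 := by
  obtain ⟨z, hz, hzn, hfix⟩ := exists_fixedPoint_of_half_contraction (fun z => u - expRem z)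
    (G : Set X) hG G.zero_mem (ρ := 2 * ‖u‖) (by positivity)
    (by
      intro z hz _
      exact G.sub_mem hu (G.sub_mem (G.sub_mem (exp_mem_of_isClosed G hG hz) G.one_mem) hz))
    (by simp [expRem_zero])
    (by
      intro z w hz hw
      have := norm_expRem_sub_le (ρ := 2 * ‖u‖) (by linarith) hw hz
      rw [sub_sub_sub_cancel_left]
      refine this.trans ?_
      rw [norm_sub_rev]; gcongr; linarith)
  refine ⟨z, hz, ?_, hzn, ?_⟩
  · rw [exp_eq_expRem]; nth_rw 1 [← hfix]; simp [add_assoc]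
  · have h1 : z - u = - expRem z := by nth_rw 1 [← hfix]; simp
    rw [h1, norm_neg]
    refine (norm_expRem_le (by linarith)).trans ?_
    have := pow_le_pow_left₀ (norm_nonneg _) hzn 2
    linarith [mul_pow 2 ‖u‖ 2]

/-- Solution of the conjugacy equation `e^f e^Y = e^{TY} e^h` in a Banach algebra, where
`Y = K u`, `h = u - Π u`, and `K` inverts the linearised operator `T - 1` on the range of `Π`. -/
theorem exists_conjugacy_reduction (G : Subalgebra ℝ X) (hG : IsClosed (G : Set X))
    (T K P : X →L[ℝ] X) {C ε : ℝ} (hC : 1 ≤ C)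
    (hK : ∀ x, ‖K x‖ ≤ C * ‖x‖) (hTK : ∀ x, ‖T (K x)‖ ≤ C * ‖x‖) (hP : ∀ x, ‖x - P x‖ ≤ ‖x‖)
    (hTKP : ∀ x, T (K x) - K x = P x)
    (hTG : ∀ x ∈ G, T x ∈ G) (hKG : ∀ x ∈ G, K x ∈ G) (hPG : ∀ x ∈ G, P x ∈ G)
    {f : X} (hf : f ∈ G) (hfε : ‖f‖ ≤ ε) (hε : 300 * C ^ 2 * ε ≤ 1) :
    ∃ u ∈ G, ‖u‖ ≤ 4 * ε ∧ ‖u - f‖ ≤ 600 * C ^ 2 * ε ^ 2 ∧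
      exp f * exp (K u) = exp (T (K u)) * exp (u - P u) := by
  have hε0 : 0 ≤ ε := (norm_nonneg _).trans hfε
  have hCε : 300 * (C * ε) ≤ 1 := by nlinarith [mul_nonneg (sub_nonneg.2 hC) hε0]
  have hεC : ε ≤ C * ε := le_mul_of_one_le_left hε0 hC
  set ρ := 4 * (C * ε) with hρ
  have hρ1 : ρ ≤ 1 := by rw [hρ]; linarith [mul_nonneg (zero_le_one.trans hC) hε0]
  have hρ0 : 0 ≤ ρ := by positivity
  have b1 : ∀ u : X, ‖u‖ ≤ 4 * ε → ‖K u‖ ≤ ρ := fun u hu => (hK u).trans (by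
    rw [hρ]; nlinarith [mul_le_mul_of_nonneg_left hu (zero_le_one.trans hC)])
  have b2 : ∀ u : X, ‖u‖ ≤ 4 * ε → ‖T (K u)‖ ≤ ρ := fun u hu => (hTK u).trans (by
    rw [hρ]; nlinarith [mul_le_mul_of_nonneg_left hu (zero_le_one.trans hC)])
  have b3 : ∀ u : X, ‖u‖ ≤ 4 * ε → ‖u - P u‖ ≤ ρ := fun u hu => (hP u).trans (by
    rw [hρ]; linarith)
  have b4 : ‖f‖ ≤ ρ := by rw [hρ]; linarith
  obtain ⟨u, hu, hun, hfix⟩ := exists_fixedPoint_of_half_contraction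
    (fun u => f + expMulRem f (K u) - expMulRem (T (K u)) (u - P u))
    (G : Set X) hG G.zero_mem (ρ := 4 * ε) (by positivity)
    (by
      intro u hu _
      have hrem : ∀ x ∈ G, ∀ y ∈ G, expMulRem x y ∈ G := fun x hx y hy =>
        G.sub_mem (G.sub_mem (G.sub_mem (G.mul_mem (exp_mem_of_isClosed G hG hx)
          (exp_mem_of_isClosed G hG hy)) G.one_mem) hx) hy
      exact G.sub_mem (G.add_mem hf (hrem _ hf _ (hKG u hu)))
        (hrem _ (hTG _ (hKG u hu)) _ (G.sub_mem hu (hPG u hu))))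
    (by
      simp only [map_zero, sub_zero, expMulRem_zero]
      have h := norm_expMulRem_sub_le (x := f) (y := 0) (x' := 0) (y' := 0) (ρ := ε) (by linarith)
        hfε (by simpa) (by simpa) (by simpa)
      simp only [expMulRem_zero, sub_zero, norm_zero, add_zero] at h
      refine (norm_add_le _ _).trans ?_
      nlinarith [norm_nonneg f])
    (by
      intro u v hu hv
      have h1 := norm_expMulRem_sub_le hρ1 b4 (b1 u hu) b4 (b1 v hv)
      have h2 := norm_expMulRem_sub_le hρ1 (b2 u hu) (b3 u hu) (b2 v hv) (b3 v hv)
      rw [sub_self, norm_zero, zero_add, ← map_sub] at h1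
      rw [← map_sub, ← map_sub, sub_sub_sub_comm, ← map_sub] at h2
      have e : (f + expMulRem f (K u) - expMulRem (T (K u)) (u - P u)) -
          (f + expMulRem f (K v) - expMulRem (T (K v)) (v - P v)) =
          (expMulRem f (K u) - expMulRem f (K v)) -
          (expMulRem (T (K u)) (u - P u) - expMulRem (T (K v)) (v - P v)) := by abel
      simp only [e]
      have h3 := hK (u - v)
      have h4 := hTK (u - v)
      have h5 := hP (u - v)
      have h6 : ‖u - v‖ ≤ C * ‖u - v‖ := le_mul_of_one_le_left (norm_nonneg _) hC
      calc _ ≤ 11 * ρ * ‖K (u - v)‖ + 11 * ρ * (‖T (K (u - v))‖ + ‖u - v - P (u - v)‖) :=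
            (norm_sub_le _ _).trans (add_le_add h1 h2)
        _ ≤ 11 * ρ * (C * ‖u - v‖) + 11 * ρ * (C * ‖u - v‖ + C * ‖u - v‖) := by
            gcongr; linarith
        _ = (132 * C ^ 2 * ε) * ‖u - v‖ := by rw [hρ]; ring
        _ ≤ _ := by
            gcongr
            nlinarith [mul_nonneg (sq_nonneg C) hε0])
  refine ⟨u, hu, hun, ?_, ?_⟩
  · have h1 := norm_expMulRem_sub_le hρ1 b4 (b1 u hun) (x' := 0) (y' := 0) (by simpa) (by simpa)
    have h2 := norm_expMulRem_sub_le hρ1 (b2 u hun) (b3 u hun) (x' := 0) (y' := 0)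
      (by simpa) (by simpa)
    simp only [expMulRem_zero, sub_zero] at h1 h2
    have e : u - f = expMulRem f (K u) - expMulRem (T (K u)) (u - P u) := by
      nth_rw 1 [← hfix]; abel
    rw [e]
    have h3 : ‖K u‖ ≤ 4 * (C * ε) := b1 u hun
    have h4 : ‖T (K u)‖ ≤ 4 * (C * ε) := b2 u hun
    have h5 : ‖u - P u‖ ≤ 4 * (C * ε) := b3 u hun
    calc _ ≤ 11 * ρ * (‖f‖ + ‖K u‖) + 11 * ρ * (‖T (K u)‖ + ‖u - P u‖) :=
          (norm_sub_le _ _).trans (add_le_add h1 h2)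
      _ ≤ 11 * ρ * (C * ε + 4 * (C * ε)) + 11 * ρ * (4 * (C * ε) + 4 * (C * ε)) := by
          gcongr; linarith
      _ = 572 * C ^ 2 * ε ^ 2 := by rw [hρ]; ring
      _ ≤ _ := by gcongr; norm_num
  · have e := hfix
    have h7 := hTKP u
    simp only [expMulRem] at e
    have h8 : exp f * exp (K u) - exp (T (K u)) * exp (u - P u) =
      (f + (exp f * exp (K u) - 1 - f - K u) - (exp (T (K u)) * exp (u - P u) - 1 - T (K u)
        - (u - P u))) - u - ((T (K u) - K u) - P u) := by abel
    rw [e, h7, sub_self, sub_self, sub_self] at h8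
    exact sub_eq_zero.1 h8

end BanachAlgebra

/-- A symmetric submultiplicative weight on an additive group. -/
structure Weight (ι : Type*) [AddCommGroup ι] where
  w : ι → ℝ
  one_le : ∀ k, 1 ≤ w k
  zero : w 0 = 1
  add_le : ∀ k l, w (k + l) ≤ w k * w l
  neg_eq : ∀ k, w (-k) = w k

lemma Weight.pos {ι : Type*} [AddCommGroup ι] (ω : Weight ι) (k : ι) : 0 < ω.w k :=
  zero_lt_one.trans_le (ω.one_le k)

/-- The Wiener algebra of the families `(a_k)` in `E` with `∑ ω(k) ‖a_k‖ < ∞`, under convolution.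
The family `a` is stored as the summable family `ω(k) a_k`. -/
def Wiener {ι : Type*} [AddCommGroup ι] (_ω : Weight ι) (E : Type*) [NormedRing E] : Type _ :=
  lp (fun _ : ι => E) 1

namespace Wiener

section Space

variable {ι : Type*} [AddCommGroup ι] {ω : Weight ι} {E : Type*} [NormedRing E]
  [NormedAlgebra ℝ E] [CompleteSpace E] {F : Type*} [NormedAddCommGroup F] [NormedSpace ℝ F]
  [CompleteSpace F]

instance : NormedAddCommGroup (Wiener ω E) :=
  inferInstanceAs (NormedAddCommGroup (lp (fun _ : ι => E) 1))

instance : NormedSpace ℝ (Wiener ω E) :=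
  inferInstanceAs (NormedSpace ℝ (lp (fun _ : ι => E) 1))

instance : CompleteSpace (Wiener ω E) :=
  inferInstanceAs (CompleteSpace (lp (fun _ : ι => E) 1))

/-- The identity map to the sequence space. -/
def toLp (x : Wiener ω E) : lp (fun _ : ι => E) 1 := x

/-- The entry at `k`. -/
def coef (k : ι) (x : Wiener ω E) : E := (ω.w k)⁻¹ • (toLp x) k

lemma smul_coef (k : ι) (x : Wiener ω E) : ω.w k • coef k x = toLp x k := by
  rw [coef, smul_smul, mul_inv_cancel₀ (ω.pos k).ne', one_smul]

lemma norm_toLp (k : ι) (x : Wiener ω E) : ‖toLp x k‖ = ω.w k * ‖coef k x‖ := by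
  rw [← smul_coef, norm_smul, Real.norm_of_nonneg (ω.pos k).le]

lemma hasSum_norm (x : Wiener ω E) : HasSum (fun k => ω.w k * ‖coef k x‖) ‖x‖ := by
  have h := lp.hasSum_norm (E := fun _ : ι => E) (p := 1) (by simp) (toLp x)
  simp only [ENNReal.toReal_one, Real.rpow_one] at h
  convert! h using 2
  exact (norm_toLp _ _).symm

lemma norm_coef_le (k : ι) (x : Wiener ω E) : ω.w k * ‖coef k x‖ ≤ ‖x‖ :=
  le_hasSum (hasSum_norm x) k fun _ _ => mul_nonneg (ω.pos _).le (norm_nonneg _)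

lemma coef_add (k : ι) (x y : Wiener ω E) : coef k (x + y) = coef k x + coef k y :=
  smul_add _ _ _

lemma coef_smul (k : ι) (c : ℝ) (x : Wiener ω E) : coef k (c • x) = c • coef k x :=
  smul_comm _ _ _

lemma ext_coef {x y : Wiener ω E} (h : ∀ k, coef k x = coef k y) : x = y := by
  refine lp.ext (funext fun k => ?_)
  have := congrArg (fun a => ω.w k • a) (h k)
  rw [smul_coef, smul_coef] at this
  exact this

/-- The entry at `k` as a continuous linear map. -/
def coefL (k : ι) : Wiener ω E →L[ℝ] E :=
  LinearMap.mkContinuous ⟨⟨coef k, coef_add k⟩, coef_smul k⟩ 1 fun x => by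
    have h1 := norm_coef_le k x
    have h2 := mul_le_mul_of_nonneg_right (ω.one_le k) (norm_nonneg (coef k x))
    simp only [LinearMap.coe_mk, AddHom.coe_mk]; linarith

lemma coefL_apply (k : ι) (x : Wiener ω E) : coefL k x = coef k x := rfl

/-- The element with prescribed entries. -/
def ofCoef (a : ι → E) (ha : Summable fun k => ω.w k * ‖a k‖) : Wiener ω E :=
  (⟨fun k => ω.w k • a k, memℓp_gen (by
    simpa [norm_smul, Real.norm_of_nonneg (ω.pos _).le] using ha)⟩ : lp (fun _ : ι => E) 1)

lemma coef_ofCoef (a : ι → E) (ha : Summable fun k => ω.w k * ‖a k‖) (k : ι) :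
    coef k (ofCoef a ha) = a k := by
  change (ω.w k)⁻¹ • (ω.w k • a k) = a k
  rw [smul_smul, inv_mul_cancel₀ (ω.pos k).ne', one_smul]

lemma norm_ofCoef (a : ι → E) (ha : Summable fun k => ω.w k * ‖a k‖) :
    ‖ofCoef a ha‖ = ∑' k, ω.w k * ‖a k‖ := by
  rw [← (hasSum_norm _).tsum_eq]; simp only [coef_ofCoef]

lemma lift_aux (g : ι → E →L[ℝ] F) {C : ℝ} (h : ∀ k a, ‖g k a‖ ≤ C * ω.w k * ‖a‖)
    (x : Wiener ω E) : Summable (fun k => g k (coef k x)) ∧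
      ‖∑' k, g k (coef k x)‖ ≤ C * ‖x‖ := by
  have hs := (hasSum_norm x).mul_left C
  have hb : ∀ k, ‖g k (coef k x)‖ ≤ C * (ω.w k * ‖coef k x‖) := fun k => by
    rw [← mul_assoc]; exact h k _
  exact ⟨Summable.of_norm_bounded hs.summable hb, tsum_of_norm_bounded hs hb⟩

/-- The continuous linear map with prescribed values on the families with a single entry. -/
def lift (g : ι → E →L[ℝ] F) (C : ℝ) (h : ∀ k a, ‖g k a‖ ≤ C * ω.w k * ‖a‖) :
    Wiener ω E →L[ℝ] F :=
  LinearMap.mkContinuous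
    ⟨⟨fun x => ∑' k, g k (coef k x), fun x y => by
      simp only [coef_add, map_add]
      exact (lift_aux g h x).1.tsum_add (lift_aux g h y).1⟩, fun c x => by
      simp only [coef_smul, map_smul, RingHom.id_apply]
      exact (lift_aux g h x).1.tsum_const_smul c⟩ C fun x => (lift_aux g h x).2

lemma lift_hasSum (g : ι → E →L[ℝ] F) {C : ℝ} (h : ∀ k a, ‖g k a‖ ≤ C * ω.w k * ‖a‖)
    (x : Wiener ω E) : HasSum (fun k => g k (coef k x)) (lift g C h x) :=
  (lift_aux g h x).1.hasSum

lemma norm_lift_le (g : ι → E →L[ℝ] F) {C : ℝ} (h : ∀ k a, ‖g k a‖ ≤ C * ω.w k * ‖a‖)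
    (x : Wiener ω E) : ‖lift g C h x‖ ≤ C * ‖x‖ := (lift_aux g h x).2

variable [DecidableEq ι]

/-- The family with the single entry `a` at `k`. -/
def mono (k : ι) (a : E) : Wiener ω E :=
  (lp.single (E := fun _ : ι => E) 1 k (ω.w k • a) : lp (fun _ : ι => E) 1)

lemma norm_mono (k : ι) (a : E) : ‖(mono k a : Wiener ω E)‖ = ω.w k * ‖a‖ := by
  have := lp.norm_single (E := fun _ : ι => E) (p := 1) zero_lt_one k (ω.w k • a)
  rw [norm_smul, Real.norm_of_nonneg (ω.pos k).le] at this
  exact this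

lemma coef_mono (k l : ι) (a : E) : coef k (mono l a : Wiener ω E) = if k = l then a else 0 := by
  change (ω.w k)⁻¹ • (Pi.single l (ω.w l • a) : ι → E) k = _
  split_ifs with h
  · subst h; rw [Pi.single_eq_same, smul_smul, inv_mul_cancel₀ (ω.pos k).ne', one_smul]
  · rw [Pi.single_eq_of_ne h, smul_zero]

lemma mono_add (k : ι) (a b : E) : (mono k (a + b) : Wiener ω E) = mono k a + mono k b :=
  ext_coef fun l => by rw [coef_add]; simp only [coef_mono]; split_ifs <;> simp

lemma mono_smul (k : ι) (c : ℝ) (a : E) : (mono k (c • a) : Wiener ω E) = c • mono k a :=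
  ext_coef fun l => by rw [coef_smul]; simp only [coef_mono]; split_ifs <;> simp

/-- `mono` as a continuous linear map. -/
def monoL (k : ι) : E →L[ℝ] Wiener ω E :=
  LinearMap.mkContinuous ⟨⟨mono k, mono_add k⟩, mono_smul k⟩ (ω.w k) fun a => (norm_mono k a).le

@[simp] lemma monoL_apply (k : ι) (a : E) : (monoL k a : Wiener ω E) = mono k a := rfl

lemma hasSum_mono (x : Wiener ω E) : HasSum (fun k => (mono k (coef k x) : Wiener ω E)) x := by
  have h := lp.hasSum_single (E := fun _ : ι => E) (p := 1) (by simp) (toLp x)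
  simp only [← smul_coef] at h
  exact h

@[simp] lemma lift_mono (g : ι → E →L[ℝ] F) {C : ℝ} (h : ∀ k a, ‖g k a‖ ≤ C * ω.w k * ‖a‖)
    (k : ι) (a : E) : lift g C h (mono k a) = g k a := by
  refine (lift_hasSum g h _).unique ?_
  convert! hasSum_ite_eq k (g k a) using 2 with l
  rw [coef_mono]; split_ifs with hl
  · rw [hl]
  · simp

lemma ext_mono {f g : Wiener ω E →L[ℝ] F} (h : ∀ k a, f (mono k a) = g (mono k a)) (x) :
    f x = g x := by
  have h1 := f.hasSum (hasSum_mono x)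
  simp only [h] at h1
  exact h1.unique (g.hasSum (hasSum_mono x))

end Space

section Ring

variable {ι : Type*} [AddCommGroup ι] [DecidableEq ι] {ω : Weight ι} {E : Type*} [NormedRing E]
  [NormedAlgebra ℝ E] [CompleteSpace E]

/-- Multiplication by a single term from the left. -/
def monoMul (k : ι) (a : E) : Wiener ω E →L[ℝ] Wiener ω E :=
  lift (fun l => (monoL (k + l)).comp (ContinuousLinearMap.mul ℝ E a)) (ω.w k * ‖a‖) fun l b => by
    simp only [ContinuousLinearMap.comp_apply, ContinuousLinearMap.mul_apply', monoL_apply,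
      norm_mono]
    calc ω.w (k + l) * ‖a * b‖ ≤ (ω.w k * ω.w l) * (‖a‖ * ‖b‖) :=
          mul_le_mul (ω.add_le k l) (norm_mul_le a b) (norm_nonneg _)
            (mul_nonneg (ω.pos k).le (ω.pos l).le)
      _ = _ := by ring

lemma monoMul_mono (k l : ι) (a b : E) :
    monoMul (ω := ω) k a (mono l b) = mono (k + l) (a * b) := by
  simp [monoMul]

lemma norm_monoMul_le (k : ι) (a : E) : ‖monoMul (ω := ω) k a‖ ≤ ω.w k * ‖a‖ :=
  ContinuousLinearMap.opNorm_le_bound _ (mul_nonneg (ω.pos k).le (norm_nonneg _))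
    fun x => norm_lift_le _ _ x

/-- `monoMul`, as a function of the coefficient. -/
def monoMulL (k : ι) : E →L[ℝ] (Wiener ω E →L[ℝ] Wiener ω E) :=
  LinearMap.mkContinuous
    ⟨⟨monoMul k, fun a b => ContinuousLinearMap.ext (ext_mono fun l c => by
        simp only [add_apply, monoMul_mono, add_mul, mono_add])⟩,
      fun r a => ContinuousLinearMap.ext (ext_mono fun l c => by
        simp only [smul_apply, monoMul_mono, smul_mul_assoc, mono_smul,
          RingHom.id_apply])⟩ (ω.w k) fun a => norm_monoMul_le k a

/-- Convolution. -/
def mulL : Wiener ω E →L[ℝ] (Wiener ω E →L[ℝ] Wiener ω E) :=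
  lift monoMulL 1 fun k a => by
    rw [one_mul]; exact norm_monoMul_le k a

instance : Mul (Wiener ω E) := ⟨fun x y => mulL x y⟩
instance : One (Wiener ω E) := ⟨mono 0 1⟩

lemma mul_def (x y : Wiener ω E) : x * y = mulL x y := rfl
lemma one_def : (1 : Wiener ω E) = mono 0 1 := rfl

lemma mono_mul_mono (k l : ι) (a b : E) :
    (mono k a * mono l b : Wiener ω E) = mono (k + l) (a * b) := by
  rw [mul_def, mulL, lift_mono]; exact monoMul_mono k l a b

lemma norm_mul_le' (x y : Wiener ω E) : ‖x * y‖ ≤ ‖x‖ * ‖y‖ := by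
  have h1 : ‖mulL x‖ ≤ 1 * ‖x‖ := norm_lift_le _ _ x
  rw [one_mul] at h1
  exact (ContinuousLinearMap.le_opNorm _ _).trans
    (mul_le_mul_of_nonneg_right h1 (norm_nonneg _))

lemma mul_assoc' (x y z : Wiener ω E) : x * y * z = x * (y * z) := by
  have h1 : ∀ k a l b (z : Wiener ω E), (mono k a * mono l b) * z = mono k a * (mono l b * z) := by
    intro k a l b z
    have := ext_mono (f := mulL (ω := ω) (mono k a * mono l b))
      (g := (mulL (mono k a)).comp (mulL (mono l b)))
      (fun m c => by
        simp only [ContinuousLinearMap.comp_apply, ← mul_def, mono_mul_mono, add_assoc,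
          mul_assoc]) z
    simpa only [ContinuousLinearMap.comp_apply, ← mul_def] using this
  have h2 : ∀ k a (z y : Wiener ω E), (mono k a * y) * z = mono k a * (y * z) := by
    intro k a z y
    have := ext_mono (f := (mulL.flip z).comp (mulL (mono k a)))
      (g := (mulL (mono k a)).comp (mulL.flip z)) (fun m c => by
        simp only [ContinuousLinearMap.comp_apply, ContinuousLinearMap.flip_apply, ← mul_def, h1]) y
    simpa only [ContinuousLinearMap.comp_apply, ContinuousLinearMap.flip_apply, ← mul_def] using this
  have := ext_mono (f := (mulL.flip z).comp (mulL.flip y)) (g := mulL.flip (y * z))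
    (fun m c => by
      simp only [ContinuousLinearMap.comp_apply, ContinuousLinearMap.flip_apply, ← mul_def, h2]) x
  simpa only [ContinuousLinearMap.comp_apply, ContinuousLinearMap.flip_apply, ← mul_def] using this

lemma mul_add' (x y z : Wiener ω E) : x * (y + z) = x * y + x * z := by
  simp only [mul_def, map_add]

lemma add_mul' (x y z : Wiener ω E) : (x + y) * z = x * z + y * z := by
  simp only [mul_def, map_add, add_apply]

lemma zero_mul' (x : Wiener ω E) : 0 * x = 0 := by
  simp only [mul_def, map_zero, zero_apply]

lemma mul_zero' (x : Wiener ω E) : x * 0 = 0 := by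
  simp only [mul_def, map_zero]

lemma one_mul' (x : Wiener ω E) : 1 * x = x := by
  have := ext_mono (f := mulL (ω := ω) (E := E) 1) (g := ContinuousLinearMap.id ℝ _) (fun k a => by
    rw [← mul_def, one_def, mono_mul_mono, zero_add, one_mul, ContinuousLinearMap.id_apply]) x
  simpa only [ContinuousLinearMap.id_apply, ← mul_def] using this

lemma mul_one' (x : Wiener ω E) : x * 1 = x := by
  have := ext_mono (f := (mulL (ω := ω) (E := E)).flip 1) (g := ContinuousLinearMap.id ℝ _)
    (fun k a => by
      rw [ContinuousLinearMap.flip_apply, ← mul_def, one_def, mono_mul_mono, add_zero, mul_one,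
        ContinuousLinearMap.id_apply]) x
  simpa only [ContinuousLinearMap.id_apply, ContinuousLinearMap.flip_apply, ← mul_def] using this

lemma smul_mul' (r : ℝ) (x y : Wiener ω E) : r • x * y = r • (x * y) := by
  simp only [mul_def, map_smul, smul_apply]

lemma mul_smul' (r : ℝ) (x y : Wiener ω E) : x * r • y = r • (x * y) := by
  simp only [mul_def, map_smul]

instance : Ring (Wiener ω E) :=
  { (inferInstance : AddCommGroup (Wiener ω E)) with
    mul := fun x y => x * y
    one := 1
    left_distrib := mul_add'
    right_distrib := add_mul'
    zero_mul := zero_mul'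
    mul_zero := mul_zero'
    mul_assoc := mul_assoc'
    one_mul := one_mul'
    mul_one := mul_one' }

instance : NormedRing (Wiener ω E) where
  dist_eq := NormedAddCommGroup.dist_eq
  norm_mul_le := norm_mul_le'

instance : Algebra ℝ (Wiener ω E) := Algebra.ofModule smul_mul' mul_smul'

instance : NormedAlgebra ℝ (Wiener ω E) where
  norm_smul_le := norm_smul_le

instance [NormOneClass E] : NormOneClass (Wiener ω E) :=
  ⟨by rw [one_def, norm_mono, ω.zero, norm_one, one_mul]⟩

/-- A continuous linear map which is multiplicative on single terms is multiplicative. -/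
lemma map_mul_of_mono {B : Type*} [NormedRing B] [NormedAlgebra ℝ B] [CompleteSpace B]
    (L : Wiener ω E →L[ℝ] B)
    (h : ∀ k l a b, L (mono (k + l) (a * b)) = L (mono k a) * L (mono l b)) (x y : Wiener ω E) :
    L (x * y) = L x * L y := by
  have h1 : ∀ k a (y : Wiener ω E), L (mono k a * y) = L (mono k a) * L y := by
    intro k a y
    have := ext_mono (f := L.comp (mulL (mono k a)))
      (g := (ContinuousLinearMap.mul ℝ B (L (mono k a))).comp L) (fun l b => by
        simp only [ContinuousLinearMap.comp_apply, ContinuousLinearMap.mul_apply', ← mul_def,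
          mono_mul_mono, h]) y
    simpa only [ContinuousLinearMap.comp_apply, ContinuousLinearMap.mul_apply', ← mul_def] using this
  have := ext_mono (f := L.comp (mulL.flip y))
      (g := ((ContinuousLinearMap.mul ℝ B).flip (L y)).comp L) (fun l b => by
        simp only [ContinuousLinearMap.comp_apply, ContinuousLinearMap.mul_apply',
          ContinuousLinearMap.flip_apply, ← mul_def, h1]) x
  simpa only [ContinuousLinearMap.comp_apply, ContinuousLinearMap.mul_apply',
    ContinuousLinearMap.flip_apply, ← mul_def] using this

end Ring

end Wiener

/-- Complex `2 × 2` matrices, with the operator norm of the sup norm. -/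
def M2 : Type := Matrix (Fin 2) (Fin 2) ℂ

namespace M2

section Instances

attribute [local instance] Matrix.linftyOpNormedRing Matrix.linftyOpNormedAlgebra

instance : NormedRing M2 := inferInstanceAs (NormedRing (Matrix (Fin 2) (Fin 2) ℂ))
instance : NormedAlgebra ℂ M2 := inferInstanceAs (NormedAlgebra ℂ (Matrix (Fin 2) (Fin 2) ℂ))
instance : NormedAlgebra ℝ M2 := inferInstanceAs (NormedAlgebra ℝ (Matrix (Fin 2) (Fin 2) ℂ))
instance : NormedSpace ℂ M2 := NormedAlgebra.toNormedSpace M2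
instance : NormedSpace ℝ M2 := NormedAlgebra.toNormedSpace M2
instance : NormOneClass M2 := Matrix.linfty_opNormOneClass
instance : CompleteSpace M2 := Matrix.instCompleteSpace (Fin 2) (Fin 2) ℂ

end Instances

/-- The underlying matrix. -/
def toMat (x : M2) : Matrix (Fin 2) (Fin 2) ℂ := x

/-- The element with a given underlying matrix. -/
def ofMat (x : Matrix (Fin 2) (Fin 2) ℂ) : M2 := x

@[simp] lemma toMat_ofMat (x : Matrix (Fin 2) (Fin 2) ℂ) : (ofMat x).toMat = x := rfl

lemma toMat_injective {x y : M2} (h : x.toMat = y.toMat) : x = y := h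

lemma ext {x y : M2} (h : ∀ i j, x.toMat i j = y.toMat i j) : x = y :=
  toMat_injective (Matrix.ext h)

lemma toMat_mul' (x y : M2) : (x * y).toMat = x.toMat * y.toMat := rfl
lemma ofMat_mul' (x y : Matrix (Fin 2) (Fin 2) ℂ) : ofMat (x * y) = ofMat x * ofMat y := rfl

@[simp] lemma toMat_add (x y : M2) (i j) : (x + y).toMat i j = x.toMat i j + y.toMat i j := rfl
@[simp] lemma toMat_sub (x y : M2) (i j) : (x - y).toMat i j = x.toMat i j - y.toMat i j := rfl
@[simp] lemma toMat_neg (x : M2) (i j) : (-x).toMat i j = -x.toMat i j := rfl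
@[simp] lemma toMat_zero (i j) : (0 : M2).toMat i j = 0 := rfl
@[simp] lemma toMat_smul (z : ℂ) (x : M2) (i j) : (z • x).toMat i j = z * x.toMat i j := rfl
@[simp] lemma toMat_real_smul (r : ℝ) (x : M2) (i j) : (r • x).toMat i j = r * x.toMat i j :=
  Complex.real_smul
@[simp] lemma toMat_one (i j) : (1 : M2).toMat i j = if i = j then 1 else 0 := Matrix.one_apply
lemma toMat_mul (x y : M2) (i j) :
    (x * y).toMat i j = x.toMat i 0 * y.toMat 0 j + x.toMat i 1 * y.toMat 1 j := by
  rw [toMat_mul', Matrix.mul_apply, Fin.sum_univ_two]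

lemma norm_def (x : M2) : ‖x‖ = max (‖x.toMat 0 0‖ + ‖x.toMat 0 1‖)
    (‖x.toMat 1 0‖ + ‖x.toMat 1 1‖) := by
  have h := @Matrix.linfty_opNorm_def (Fin 2) (Fin 2) ℂ _ _ _ x.toMat
  refine h.trans ?_
  simp [Fin.univ_succ]

lemma norm_le {x : M2} {c : ℝ} (h0 : ‖x.toMat 0 0‖ + ‖x.toMat 0 1‖ ≤ c)
    (h1 : ‖x.toMat 1 0‖ + ‖x.toMat 1 1‖ ≤ c) : ‖x‖ ≤ c := by
  rw [norm_def]; exact max_le h0 h1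

lemma row_le (x : M2) (i : Fin 2) : ‖x.toMat i 0‖ + ‖x.toMat i 1‖ ≤ ‖x‖ := by
  rw [norm_def]; fin_cases i
  · exact le_max_left _ _
  · exact le_max_right _ _

lemma entry_le (x : M2) (i j : Fin 2) : ‖x.toMat i j‖ ≤ ‖x‖ := by
  have := row_le x i
  fin_cases j
  · simpa using (le_add_of_nonneg_right (norm_nonneg _)).trans this
  · simpa using (le_add_of_nonneg_left (norm_nonneg _)).trans this

lemma canonNorm_le (x : M2) : canonNorm x.toMat ≤ 2 * ‖x‖ := by
  rw [canonNorm]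
  gcongr
  exact max_le (max_le (entry_le _ _ _) (entry_le _ _ _)) (max_le (entry_le _ _ _) (entry_le _ _ _))

lemma norm_le_canonNorm (x : M2) : ‖x‖ ≤ canonNorm x.toMat := by
  rw [canonNorm]
  refine norm_le ?_ ?_
  · linarith [le_max_left (max ‖x.toMat 0 0‖ ‖x.toMat 0 1‖) (max ‖x.toMat 1 0‖ ‖x.toMat 1 1‖),
      le_max_left ‖x.toMat 0 0‖ ‖x.toMat 0 1‖, le_max_right ‖x.toMat 0 0‖ ‖x.toMat 0 1‖]
  · linarith [le_max_right (max ‖x.toMat 0 0‖ ‖x.toMat 0 1‖) (max ‖x.toMat 1 0‖ ‖x.toMat 1 1‖),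
      le_max_left ‖x.toMat 1 0‖ ‖x.toMat 1 1‖, le_max_right ‖x.toMat 1 0‖ ‖x.toMat 1 1‖]

lemma toMat_exp (x : M2) : (NormedSpace.exp x).toMat = NormedSpace.exp x.toMat := rfl

/-- An entry, as a continuous linear map. -/
def entryL (i j : Fin 2) : M2 →L[ℝ] ℂ :=
  LinearMap.mkContinuous ⟨⟨fun x => x.toMat i j, fun _ _ => rfl⟩, fun _ _ => rfl⟩ 1 fun x => by
    rw [one_mul]; exact entry_le x i j

end M2

namespace Wiener

section Eval

variable {ι : Type*} [AddCommGroup ι] [DecidableEq ι] {ω ω' : Weight ι}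

/-- Multiplication by a complex number, as a real linear map. -/
def cmulL (z : ℂ) : M2 →L[ℝ] M2 :=
  LinearMap.mkContinuous ⟨⟨fun a => z • a, fun a b => smul_add z a b⟩, fun r a => M2.ext fun i j => by
      simp only [M2.toMat_smul, M2.toMat_real_smul, RingHom.id_apply]; ring⟩
    ‖z‖ fun a => norm_smul_le z a

@[simp] lemma cmulL_apply (z : ℂ) (a : M2) : cmulL z a = z • a := rfl

/-- Evaluation at a unitary character: `x ↦ ∑ χ(k) x_k`. -/
def eval (χ : AddChar ι Circle) : Wiener ω M2 →L[ℝ] M2 :=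
  lift (fun k => cmulL (χ k : ℂ)) 1 fun k a => by
    rw [cmulL_apply, norm_smul, Circle.norm_coe]
    exact mul_le_mul_of_nonneg_right (by simpa using ω.one_le k) (norm_nonneg a)

lemma eval_hasSum (χ : AddChar ι Circle) (x : Wiener ω M2) :
    HasSum (fun k => (χ k : ℂ) • coef k x) (eval χ x) :=
  lift_hasSum _ _ x

@[simp] lemma eval_mono (χ : AddChar ι Circle) (k : ι) (a : M2) :
    eval χ (mono k a : Wiener ω M2) = (χ k : ℂ) • a := by simp [eval]

@[simp] lemma eval_mul (χ : AddChar ι Circle) (x y : Wiener ω M2) :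
    eval χ (x * y) = eval χ x * eval χ y := by
  refine map_mul_of_mono _ (fun k l a b => ?_) x y
  simp only [eval_mono, AddChar.map_add_eq_mul, Circle.coe_mul, smul_mul_smul_comm]

@[simp] lemma eval_one (χ : AddChar ι Circle) : eval χ (1 : Wiener ω M2) = 1 := by
  rw [one_def, eval_mono]; simp

lemma eval_exp (χ : AddChar ι Circle) (x : Wiener ω M2) :
    eval χ (NormedSpace.exp x) = NormedSpace.exp (eval χ x) :=
  map_exp_of_hasSum (eval χ) (eval_one χ) (eval_mul χ) x

/-- The constant families. -/
def const (a : M2) : Wiener ω M2 := mono 0 a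

lemma eval_const (χ : AddChar ι Circle) (a : M2) : eval χ (const a : Wiener ω M2) = a := by
  simp [const]

lemma norm_const (a : M2) : ‖(const a : Wiener ω M2)‖ = ‖a‖ := by
  rw [const, norm_mono, ω.zero, one_mul]

/-- The operator moving the entry at `k`, transformed by `L k`, to the index `φ k`. -/
def push (φ : ι → ι) (L : ι → M2 →L[ℝ] M2) (C : ℝ)
    (h : ∀ k a, ω'.w (φ k) * ‖L k a‖ ≤ C * ω.w k * ‖a‖) : Wiener ω M2 →L[ℝ] Wiener ω' M2 :=
  lift (fun k => (monoL (φ k)).comp (L k)) C fun k a => by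
    simpa only [ContinuousLinearMap.comp_apply, monoL_apply, norm_mono] using h k a

@[simp] lemma push_mono (φ : ι → ι) (L : ι → M2 →L[ℝ] M2) {C : ℝ}
    (h : ∀ k a, ω'.w (φ k) * ‖L k a‖ ≤ C * ω.w k * ‖a‖) (k : ι) (a : M2) :
    push φ L C h (mono k a) = mono (φ k) (L k a) := by
  simp [push]

lemma norm_push_le (φ : ι → ι) (L : ι → M2 →L[ℝ] M2) {C : ℝ}
    (h : ∀ k a, ω'.w (φ k) * ‖L k a‖ ≤ C * ω.w k * ‖a‖) (x : Wiener ω M2) :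
    ‖push φ L C h x‖ ≤ C * ‖x‖ := norm_lift_le _ _ x

lemma coef_push (φ : ι → ι) (hφ : Function.Injective φ) (L : ι → M2 →L[ℝ] M2) {C : ℝ}
    (h : ∀ k a, ω'.w (φ k) * ‖L k a‖ ≤ C * ω.w k * ‖a‖) (k : ι) (x : Wiener ω M2) :
    coef (φ k) (push φ L C h x) = L k (coef k x) := by
  refine ext_mono (f := (coefL (φ k)).comp (push φ L C h)) (g := (L k).comp (coefL k))
    (fun l a => ?_) x
  simp only [ContinuousLinearMap.comp_apply, coefL_apply, push_mono, coef_mono, hφ.eq_iff]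
  split_ifs with hkl
  · rw [hkl]
  · simp

end Eval

end Wiener

section Lattice

variable {d : ℕ}

lemma pairing_add (k l : Fin d → ℤ) (x : Fin d → ℝ) :
    pairing (k + l) x = pairing k x + pairing l x := by
  simp [pairing, add_mul, Finset.sum_add_distrib]

lemma pairing_add_right (k : Fin d → ℤ) (x y : Fin d → ℝ) :
    pairing k (x + y) = pairing k x + pairing k y := by
  simp [pairing, mul_add, Finset.sum_add_distrib]

lemma pairing_neg (k : Fin d → ℤ) (x : Fin d → ℝ) : pairing (-k) x = -pairing k x := by
  simp [pairing]

lemma pairing_sub (k l : Fin d → ℤ) (x : Fin d → ℝ) :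
    pairing (k - l) x = pairing k x - pairing l x := by
  rw [sub_eq_add_neg, pairing_add, pairing_neg, sub_eq_add_neg]

lemma pairing_zero (x : Fin d → ℝ) : pairing 0 x = 0 := by simp [pairing]

lemma pairing_smul (c : ℝ) (k : Fin d → ℤ) (x : Fin d → ℝ) :
    pairing k (c • x) = c * pairing k x := by
  simp only [pairing, Pi.smul_apply, smul_eq_mul, Finset.mul_sum]
  exact Finset.sum_congr rfl fun i _ => by ring

lemma pairing_two_smul (k : Fin d → ℤ) (x : Fin d → ℝ) :
    pairing ((2 : ℤ) • k) x = 2 * pairing k x := by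
  simp only [pairing, Pi.smul_apply, smul_eq_mul, Finset.mul_sum]
  exact Finset.sum_congr rfl fun i _ => by push_cast; ring

@[fun_prop] lemma continuous_pairing (k : Fin d → ℤ) : Continuous (pairing k) := by
  unfold pairing; fun_prop

lemma l1_nonneg (k : Fin d → ℤ) : 0 ≤ l1 k := Finset.sum_nonneg fun _ _ => abs_nonneg _

lemma l1_zero : l1 (0 : Fin d → ℤ) = 0 := by simp [l1]

lemma l1_neg (k : Fin d → ℤ) : l1 (-k) = l1 k := by simp [l1]

lemma l1_add_le (k l : Fin d → ℤ) : l1 (k + l) ≤ l1 k + l1 l := by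
  rw [l1, l1, l1, ← Finset.sum_add_distrib]
  exact Finset.sum_le_sum fun i _ => by
    rw [Pi.add_apply, Int.cast_add]; exact abs_add_le _ _

lemma l1_sub_le (k l : Fin d → ℤ) : l1 (k - l) ≤ l1 k + l1 l := by
  rw [sub_eq_add_neg, ← l1_neg l]; exact l1_add_le _ _

lemma l1_two_smul (k : Fin d → ℤ) : l1 ((2 : ℤ) • k) = 2 * l1 k := by
  simp [l1, Finset.mul_sum, abs_mul]

lemma one_le_l1 {k : Fin d → ℤ} (hk : k ≠ 0) : 1 ≤ l1 k := by
  obtain ⟨i, hi⟩ := Function.ne_iff.1 hk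
  have h1 : (1 : ℝ) ≤ |(k i : ℝ)| := by
    rw [← Int.cast_abs]; exact_mod_cast Int.one_le_abs hi
  exact h1.trans (Finset.single_le_sum (f := fun i => |(k i : ℝ)|) (fun _ _ => abs_nonneg _)
    (Finset.mem_univ i))

lemma l1_pos_iff {k : Fin d → ℤ} : 0 < l1 k ↔ k ≠ 0 :=
  ⟨fun h h0 => by rw [h0, l1_zero] at h; exact lt_irrefl _ h,
    fun h => zero_lt_one.trans_le (one_le_l1 h)⟩

/-- The character `k ↦ e^{2πi⟨k,θ⟩/p}`. -/
def chi (p : ℝ) (θ : Fin d → ℝ) : AddChar (Fin d → ℤ) Circle where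
  toFun k := Circle.exp (2 * Real.pi * pairing k θ / p)
  map_zero_eq_one' := by simp [pairing_zero]
  map_add_eq_mul' k l := by rw [pairing_add, ← Circle.exp_add]; congr 1; ring

lemma chi_coe (p : ℝ) (θ : Fin d → ℝ) (k : Fin d → ℤ) :
    (chi p θ k : ℂ) = Complex.exp (2 * Real.pi * pairing k θ / p * Complex.I) := by
  change ((Circle.exp _ : Circle) : ℂ) = _
  rw [Circle.coe_exp]; push_cast; rfl

/-- The weight `e^{r|2πk/p|^ν}`. -/
def gevreyWeight (d : ℕ) {p ν r : ℝ} (hp : 0 < p) (hν : 0 < ν) (hν1 : ν < 1) (hr : 0 ≤ r) :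
    Weight (Fin d → ℤ) where
  w k := Real.exp (r * (2 * Real.pi / p * l1 k) ^ ν)
  one_le k := Real.one_le_exp (mul_nonneg hr (Real.rpow_nonneg
    (mul_nonneg (by positivity) (l1_nonneg k)) _))
  zero := by rw [l1_zero, mul_zero, Real.zero_rpow hν.ne', mul_zero, Real.exp_zero]
  add_le k l := by
    rw [← Real.exp_add, ← mul_add]
    have hc : 0 ≤ 2 * Real.pi / p := by positivity
    refine Real.exp_le_exp.2 (mul_le_mul_of_nonneg_left ?_ hr)
    calc (2 * Real.pi / p * l1 (k + l)) ^ ν ≤ (2 * Real.pi / p * l1 k + 2 * Real.pi / p * l1 l) ^ ν := by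
          refine Real.rpow_le_rpow (mul_nonneg hc (l1_nonneg _)) ?_ hν.le
          rw [← mul_add]; exact mul_le_mul_of_nonneg_left (l1_add_le k l) hc
      _ ≤ _ := Real.rpow_add_le_add_rpow (mul_nonneg hc (l1_nonneg _))
          (mul_nonneg hc (l1_nonneg _)) hν.le hν1.le
  neg_eq k := by rw [l1_neg]

end Lattice

section Fourier

variable {d : ℕ}

open MeasureTheory Wiener

lemma integral_exp_two_pi_int (m : ℤ) :
    ∫ t in Set.Icc (0 : ℝ) 1, Complex.exp (2 * Real.pi * (m * t) * Complex.I) =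
      if m = 0 then 1 else 0 := by
  rw [integral_Icc_eq_integral_Ioc, ← intervalIntegral.integral_of_le zero_le_one]
  split_ifs with h
  · simp [h]
  · have hc : (2 * Real.pi * m * Complex.I : ℂ) ≠ 0 := by
      simp [h, Real.pi_ne_zero]
    have e : ∀ t : ℝ, Complex.exp (2 * Real.pi * (m * t) * Complex.I) =
        Complex.exp ((2 * Real.pi * m * Complex.I) * t) := fun t => by congr 1; ring
    simp only [e]
    rw [integral_exp_mul_complex hc]
    have h1 : Complex.exp (2 * Real.pi * m * Complex.I * (1 : ℝ)) = 1 := by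
      rw [Complex.exp_eq_one_iff]; exact ⟨m, by push_cast; ring⟩
    rw [h1]; simp

lemma integral_exp_pairing (m : Fin d → ℤ) :
    ∫ x in Set.Icc (0 : Fin d → ℝ) 1, Complex.exp (2 * Real.pi * pairing m x * Complex.I) =
      if m = 0 then 1 else 0 := by
  have e : ∀ x : Fin d → ℝ, Complex.exp (2 * Real.pi * pairing m x * Complex.I) =
      ∏ i, Complex.exp (2 * Real.pi * (m i * x i) * Complex.I) := by
    intro x
    rw [← Complex.exp_sum, pairing]
    congr 1
    push_cast
    rw [Finset.mul_sum, Finset.sum_mul]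
  simp only [e]
  rw [← Set.pi_univ_Icc, volume_pi, Measure.restrict_pi_pi]
  simp only [Pi.zero_apply, Pi.one_apply]
  rw [integral_fintype_prod_eq_prod (μ := fun _ => volume.restrict (Set.Icc (0 : ℝ) 1))
    (f := fun i (t : ℝ) => Complex.exp (2 * Real.pi * (m i * t) * Complex.I))]
  simp only [integral_exp_two_pi_int]
  split_ifs with h
  · simp [h]
  · obtain ⟨i, hi⟩ := Function.ne_iff.1 h
    exact Finset.prod_eq_zero (Finset.mem_univ i) (by simpa using hi)

variable {ω : Weight (Fin d → ℤ)}

lemma summable_norm_coef (x : Wiener ω M2) : Summable fun k => ‖coef k x‖ :=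
  Summable.of_nonneg_of_le (fun _ => norm_nonneg _)
    (fun k => le_mul_of_one_le_left (norm_nonneg _) (ω.one_le k)) (hasSum_norm x).summable

lemma eval_entry_hasSum (χ : AddChar (Fin d → ℤ) Circle) (x : Wiener ω M2) (i j : Fin 2) :
    HasSum (fun k => (χ k : ℂ) * (coef k x).toMat i j) ((eval χ x).toMat i j) :=
  (M2.entryL i j).hasSum (eval_hasSum χ x)

/-- Fourier coefficients of the function defined by an element of the Wiener algebra. -/
lemma integral_eval {p : ℝ} (hp : p ≠ 0) (x : Wiener ω M2) (k : Fin d → ℤ) (i j : Fin 2) :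
    ∫ t in Set.Icc (0 : Fin d → ℝ) 1, (eval (chi p (p • t)) x).toMat i j *
      Complex.exp (-(2 * Real.pi * pairing k t * Complex.I)) = (coef k x).toMat i j := by
  set F : (Fin d → ℤ) → (Fin d → ℝ) → ℂ := fun l t =>
    (coef l x).toMat i j * Complex.exp (2 * Real.pi * pairing (l - k) t * Complex.I) with hF
  have hFs : ∀ t, HasSum (fun l => F l t) ((eval (chi p (p • t)) x).toMat i j *
      Complex.exp (-(2 * Real.pi * pairing k t * Complex.I))) := by
    intro t
    convert! (eval_entry_hasSum (chi p (p • t)) x i j).mul_right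
      (Complex.exp (-(2 * Real.pi * pairing k t * Complex.I))) using 2 with l
    simp only [hF]
    rw [chi_coe, pairing_smul, mul_comm _ ((coef l x).toMat i j),
      mul_assoc ((coef l x).toMat i j), ← Complex.exp_add]
    congr 2
    have : (p : ℂ) ≠ 0 := by exact_mod_cast hp
    rw [pairing_sub]; push_cast; field_simp; ring
  have hcont : ∀ l, Continuous (F l) := fun l => by
    simp only [hF]
    have := continuous_pairing (l - k)
    fun_prop
  have hnorm : ∀ l t, ‖F l t‖ = ‖(coef l x).toMat i j‖ := by
    intro l t
    rw [hF, norm_mul]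
    have : (2 * Real.pi * pairing (l - k) t * Complex.I : ℂ) =
      ((2 * Real.pi * pairing (l - k) t : ℝ) : ℂ) * Complex.I := by push_cast; rfl
    rw [this, Complex.norm_exp_ofReal_mul_I, mul_one]
  have h1 := hasSum_integral_of_summable_integral_norm (μ := volume.restrict (Set.Icc (0 : Fin d → ℝ) 1))
    (F := F) (fun l => (hcont l).continuousOn.integrableOn_compact isCompact_Icc) (by
      simp only [hnorm]
      simp only [integral_const]
      refine Summable.const_smul _ ?_
      exact Summable.of_nonneg_of_le (fun _ => norm_nonneg _) (fun l => M2.entry_le _ i j)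
        (summable_norm_coef x))
  simp only [fun t => (hFs t).tsum_eq] at h1
  refine h1.unique ?_
  have h2 : ∀ l, ∫ t in Set.Icc (0 : Fin d → ℝ) 1, F l t =
      if l = k then (coef k x).toMat i j else 0 := by
    intro l
    simp only [hF]
    rw [integral_const_mul, integral_exp_pairing]
    simp only [sub_eq_zero]
    split_ifs with h
    · rw [h, mul_one]
    · rw [mul_zero]
  simp only [h2]
  exact hasSum_ite_eq k _

lemma coef_eq_zero_of_eval {p : ℝ} (hp : p ≠ 0) {x : Wiener ω M2}
    (h : ∀ θ, eval (chi p θ) x = 0) (k : Fin d → ℤ) : coef k x = 0 := by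
  refine M2.ext fun i j => ?_
  rw [← integral_eval hp x k i j]
  simp [h]

lemma eq_of_eval_eq {p : ℝ} (hp : p ≠ 0) {x y : Wiener ω M2}
    (h : ∀ θ, eval (chi p θ) x = eval (chi p θ) y) : x = y := by
  have := coef_eq_zero_of_eval hp (x := x - y) fun θ => by rw [map_sub, h, sub_self]
  rw [← sub_eq_zero]
  exact ext_coef fun k => by rw [this, ← coefL_apply, map_zero]

lemma fCoeff_eq {p : ℝ} (hp : p ≠ 0) {x : Wiener ω M2} {F : (Fin d → ℝ) → RMat}
    (h : ∀ θ, toC (F θ) = (eval (chi p θ) x).toMat) (k : Fin d → ℤ) :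
    fCoeff p F k = (coef k x).toMat := by
  ext i j
  rw [← integral_eval hp x k i j, fCoeff, Matrix.of_apply]
  simp only [← h]; rfl

variable {p ν r : ℝ} (hp : 0 < p) (hν : 0 < ν) (hν1 : ν < 1) (hr : 0 ≤ r)

lemma gevreyTerm_nonneg (F : (Fin d → ℝ) → RMat) (k : Fin d → ℤ) : 0 ≤ gevreyTerm p ν r F k :=
  mul_nonneg (mul_nonneg two_pos.le (le_max_of_le_left (le_max_of_le_left (norm_nonneg _))))
    (Real.exp_pos _).le

lemma gevrey_of_wiener {x : Wiener (gevreyWeight d hp hν hν1 hr) M2} {F : (Fin d → ℝ) → RMat}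
    (h : ∀ θ, toC (F θ) = (eval (chi p θ) x).toMat) :
    MemGevrey p ν r F ∧ gevreyNorm p ν r F ≤ 2 * ‖x‖ := by
  have hs := (hasSum_norm x).mul_left 2
  have hle : ∀ k, gevreyTerm p ν r F k ≤ 2 * ((gevreyWeight d hp hν hν1 hr).w k * ‖coef k x‖) := by
    intro k
    rw [gevreyTerm, fCoeff_eq hp.ne' h]
    calc _ ≤ (2 * ‖coef k x‖) * (gevreyWeight d hp hν hν1 hr).w k :=
          mul_le_mul_of_nonneg_right (M2.canonNorm_le _) (Real.exp_pos _).le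
      _ = _ := by ring
  have hsum : Summable (gevreyTerm p ν r F) :=
    Summable.of_nonneg_of_le (gevreyTerm_nonneg F) hle hs.summable
  refine ⟨⟨hsum, fun θ => ?_⟩, ?_⟩
  · rw [h θ]
    refine Pi.hasSum.2 fun i => Pi.hasSum.2 fun j => ?_
    convert! eval_entry_hasSum (chi p θ) x i j using 2 with k
    rw [fCoeff_eq hp.ne' h, ← chi_coe]; rfl
  · rw [gevreyNorm, ← hs.tsum_eq]
    exact hsum.tsum_le_tsum hle hs.summable

lemma wiener_of_gevrey {F : (Fin d → ℝ) → RMat} (hF : MemGevrey p ν r F) :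
    ∃ x : Wiener (gevreyWeight d hp hν hν1 hr) M2,
      (∀ θ, toC (F θ) = (eval (chi p θ) x).toMat) ∧ ‖x‖ ≤ gevreyNorm p ν r F := by
  have hle : ∀ k, (gevreyWeight d hp hν hν1 hr).w k * ‖M2.ofMat (fCoeff p F k)‖ ≤
      gevreyTerm p ν r F k := by
    intro k
    rw [gevreyTerm, mul_comm]
    exact mul_le_mul_of_nonneg_right (M2.norm_le_canonNorm _) (Real.exp_pos _).le
  have hs : Summable fun k => (gevreyWeight d hp hν hν1 hr).w k * ‖M2.ofMat (fCoeff p F k)‖ :=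
    Summable.of_nonneg_of_le (fun k => mul_nonneg (Real.exp_pos _).le (norm_nonneg _)) hle
      hF.summable
  refine ⟨ofCoef _ hs, fun θ => ?_, ?_⟩
  · ext i j
    refine ((Pi.hasSum.1 (Pi.hasSum.1 (hF.hasSum θ) i) j)).unique ?_
    convert! eval_entry_hasSum (chi p θ) (ofCoef _ hs) i j using 2 with k
    rw [coef_ofCoef, ← chi_coe]; rfl
  · rw [norm_ofCoef]
    exact hs.tsum_le_tsum hle hF.summable

end Fourier

section TorusDist

lemma bddBelow_torusDist (z : ℂ) : BddBelow (Set.range fun j : ℤ => ‖z - (j : ℂ)‖) :=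
  ⟨0, by rintro _ ⟨j, rfl⟩; exact norm_nonneg _⟩

lemma torusDist_le (z : ℂ) (j : ℤ) : torusDist z ≤ ‖z - (j : ℂ)‖ :=
  ciInf_le (bddBelow_torusDist z) j

lemma le_torusDist {z : ℂ} {c : ℝ} (h : ∀ j : ℤ, c ≤ ‖z - (j : ℂ)‖) : c ≤ torusDist z :=
  le_ciInf h

lemma exists_of_torusDist_lt {z : ℂ} {c : ℝ} (h : torusDist z < c) :
    ∃ j : ℤ, ‖z - (j : ℂ)‖ < c := exists_lt_of_ciInf_lt h

lemma torusDist_neg (z : ℂ) : torusDist (-z) = torusDist z := by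
  have h : ∀ z : ℂ, torusDist z ≤ torusDist (-z) := fun z => le_torusDist fun j => by
    have e : -z - (j : ℂ) = -(z - ((-j : ℤ) : ℂ)) := by push_cast; ring
    rw [e, norm_neg]; exact torusDist_le z (-j)
  exact le_antisymm (by simpa using h (-z)) (h z)

lemma torusDist_add_le (z w : ℂ) : torusDist (z + w) ≤ torusDist z + torusDist w := by
  refine le_of_forall_pos_le_add fun e he => ?_
  obtain ⟨j, hj⟩ := exists_of_torusDist_lt (show torusDist z < torusDist z + e / 2 by linarith)
  obtain ⟨l, hl⟩ := exists_of_torusDist_lt (show torusDist w < torusDist w + e / 2 by linarith)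
  have h := torusDist_le (z + w) (j + l)
  have e1 : z + w - ((j + l : ℤ) : ℂ) = (z - j) + (w - l) := by push_cast; ring
  rw [e1] at h
  linarith [norm_add_le (z - j) (w - l)]

/-- A small divisor is bounded below by the distance to the integers. -/
lemma min_le_norm_exp_sub_one (z : ℂ) :
    min (1 / 2) (torusDist z) ≤ ‖Complex.exp (2 * Real.pi * z * Complex.I) - 1‖ := by
  by_contra! h
  obtain ⟨h1, h2⟩ := lt_min_iff.1 h
  set v := Complex.exp (2 * Real.pi * z * Complex.I) - 1 with hv
  have hlog := Complex.norm_log_one_add_half_le_self h1.le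
  have hexp : Complex.exp (2 * Real.pi * z * Complex.I) = Complex.exp (Complex.log (1 + v)) := by
    rw [Complex.exp_log, hv]
    · ring
    · rw [hv]; simp [Complex.exp_ne_zero]
  obtain ⟨j, hj⟩ := Complex.exp_eq_exp_iff_exists_int.1 hexp
  have hz : Complex.log (1 + v) = (2 * Real.pi * Complex.I) * (z - j) := by linear_combination -hj
  rw [hz, norm_mul] at hlog
  have hn : ‖(2 * Real.pi * Complex.I : ℂ)‖ = 2 * Real.pi := by
    simp [Real.pi_pos.le]
  rw [hn] at hlog
  have := torusDist_le z j
  nlinarith [Real.pi_gt_three, norm_nonneg v, norm_nonneg (z - j)]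

end TorusDist

section Smallness

open Filter Topology

/-- The powers of `ε` below dominate constants and powers of logarithms. -/
lemma eventually_small (κ δ : ℝ) {s : ℝ} (p : ℝ) {u : ℝ} (hs : 0 < s) (hu : 0 < u) :
    ∃ c : ℝ, 0 < c ∧ c < 1 ∧ ∀ ε : ℝ, 0 < ε → ε ≤ c →
      κ ≤ ε ^ (-s) ∧ (2 * |Real.log ε|) ^ p ≤ ε ^ (-s) ∧ 4 * |Real.log ε| + δ ≤ ε ^ (-u) := by
  have hpow : ∀ v : ℝ, 0 < v → ∀ M : ℝ, ∀ᶠ ε in 𝓝[>] (0 : ℝ), M ≤ ε ^ (-v) := fun v hv M =>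
    (tendsto_rpow_neg_nhdsGT_zero (neg_lt_zero.2 hv)).eventually_ge_atTop M
  have hlog : ∀ v : ℝ, 0 < v → ∀ q : ℝ, ∀ M : ℝ, 0 < M →
      ∀ᶠ ε in 𝓝[>] (0 : ℝ), |Real.log ε| ^ q ≤ M * ε ^ (-v) := by
    intro v hv q M hM
    have h := (isLittleO_abs_log_rpow_rpow_nhdsGT_zero q (neg_lt_zero.2 hv)).bound hM
    filter_upwards [h, self_mem_nhdsWithin] with ε h1 h2
    rwa [Real.norm_of_nonneg (Real.rpow_nonneg (abs_nonneg _) _),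
      Real.norm_of_nonneg (Real.rpow_nonneg (le_of_lt h2) _)] at h1
  have h1 := hpow s hs κ
  have h2 := hlog s hs p (2 ^ p)⁻¹ (by positivity)
  have h3 := hlog u hu 1 (1 / 8) (by norm_num)
  have h4 := hpow u hu (2 * δ)
  obtain ⟨c, hc, hcs⟩ := mem_nhdsGT_iff_exists_Ioc_subset.1 (h1.and (h2.and (h3.and h4)))
  refine ⟨min c (1 / 2), lt_min hc (by norm_num), (min_le_right _ _).trans_lt (by norm_num),
    fun ε hε hεc => ?_⟩
  obtain ⟨g1, g2, g3, g4⟩ := hcs ⟨hε, hεc.trans (min_le_left _ _)⟩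
  refine ⟨g1, ?_, ?_⟩
  · rw [Real.mul_rpow two_pos.le (abs_nonneg _)]
    calc _ ≤ (2 : ℝ) ^ p * ((2 ^ p)⁻¹ * ε ^ (-s)) := by gcongr
      _ = _ := by rw [← mul_assoc, mul_inv_cancel₀ (by positivity), one_mul]
  · rw [Real.rpow_one] at g3; linarith

variable {ν τ r r' ε : ℝ}

/-- The parameter controlling the loss of width is less than `1`. -/
lemma width_pos_lt (hr' : 0 < r') (hrr : r' < r) :
    0 < min 1 (1 / r) * (r - r') ∧ min 1 (1 / r) * (r - r') < 1 ∧
      min 1 (1 / r) * (r - r') ≤ r - r' ∧ (min 1 (1 / r) * (r - r')) * r ≤ r - r' := by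
  have hr : 0 < r := hr'.trans hrr
  have h0 : 0 < r - r' := sub_pos.2 hrr
  have h1 : min 1 (1 / r) ≤ 1 / r := min_le_right _ _
  refine ⟨mul_pos (lt_min one_pos (by positivity)) h0, ?_, ?_, ?_⟩
  · calc _ ≤ 1 / r * (r - r') := by gcongr
      _ < 1 / r * r := by gcongr; linarith
      _ = 1 := by field_simp
  · exact mul_le_of_le_one_left h0.le (min_le_left _ _)
  · calc _ ≤ 1 / r * (r - r') * r := by gcongr
      _ = _ := by field_simp

lemma width_inv_le (hν : 0 < ν) (hτ : 0 < τ) (hr' : 0 < r') (hrr : r' < r) (hε : 0 < ε)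
    (h : ε ≤ (min 1 (1 / r) * (r - r')) ^ (1100 * τ / ν)) :
    (min 1 (1 / r) * (r - r'))⁻¹ ^ (τ / ν) ≤ ε ^ (-(1 / 1100) : ℝ) ∧
    (min 1 (1 / r) * (r - r'))⁻¹ ≤ ε ^ (-(ν / (1100 * τ))) := by
  obtain ⟨h0, -, -, -⟩ := width_pos_lt hr' hrr
  set D := min 1 (1 / r) * (r - r')
  have key : ∀ s : ℝ, 0 < s → ε ^ s ≤ D ^ (1100 * τ / ν * s) := fun s hs => by
    rw [Real.rpow_mul h0.le]; exact Real.rpow_le_rpow hε.le h hs.le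
  constructor
  · rw [Real.inv_rpow h0.le, Real.rpow_neg hε.le]
    have := key (1 / 1100) (by norm_num)
    rw [show 1100 * τ / ν * (1 / 1100) = τ / ν by ring] at this
    exact inv_anti₀ (by positivity) this
  · rw [Real.rpow_neg hε.le]
    have := key (ν / (1100 * τ)) (by positivity)
    rw [show 1100 * τ / ν * (ν / (1100 * τ)) = 1 by field_simp, Real.rpow_one] at this
    exact inv_anti₀ (by positivity) this

lemma resBound_le (hν : 0 < ν) (hτ : 0 < τ) (hr' : 0 < r') (hrr : r' < r) (hε : 0 < ε)
    (hε1 : ε < 1) (h : ε ≤ (min 1 (1 / r) * (r - r')) ^ (1100 * τ / ν)) {δ : ℝ} (hδ : 0 < δ)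
    (hs : 4 * |Real.log ε| + |Real.log δ| ≤ ε ^ (-(48 * ν / (1100 * τ)))) :
    resBound ν τ r r' ε ≤ δ * ε ^ 2 := by
  obtain ⟨h0, h1, h2, h3⟩ := width_pos_lt hr' hrr
  have h4 := (width_inv_le hν hτ hr' hrr hε h).2
  set D := min 1 (1 / r) * (r - r') with hD
  set s := ε ^ (-(ν / (1100 * τ))) with hsdef
  have hpow : ∀ n : ℕ, ε ^ (-(n * ν / (1100 * τ))) = s ^ n := fun n => by
    rw [hsdef, ← Real.rpow_natCast, ← Real.rpow_mul hε.le]; congr 1; ring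
  have hs1 : 1 ≤ s := (one_le_inv₀ h0).2 h1.le |>.trans h4
  have hs0 : 0 < s := by linarith
  have e50 : ε ^ (-(10 * ν / 11 * ((1 / 20) / τ))) = s ^ 50 := by
    rw [← hpow]; congr 1; push_cast; field_simp; norm_num
  have e48 := hpow 48
  push_cast at e48
  rw [e48] at hs
  have hd0 : 0 < r - r' := sub_pos.2 hrr
  have hd : 1 ≤ (r - r') * s := by
    have : 1 ≤ D * s := by
      rw [← mul_inv_cancel₀ h0.ne']; gcongr
    nlinarith
  have hq : r' / (r - r') ≤ s := by
    rw [div_le_iff₀ hd0]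
    have : 1 ≤ D * s := by
      rw [← mul_inv_cancel₀ h0.ne']; gcongr
    nlinarith
  have hq0 : 0 ≤ r' / (r - r') := by positivity
  have hl : Real.log ε < 0 := Real.log_neg hε hε1
  rw [abs_of_neg hl] at hs
  have main : (5 / 4 + 2 * (r' / (r - r'))) * (-Real.log ε) - Real.log δ ≤ (r - r') * s ^ 50 := by
    have a1 : -Real.log δ ≤ |Real.log δ| := neg_le_abs _
    have a2 : (5 / 4 + 2 * (r' / (r - r'))) * (-Real.log ε) ≤ (4 * s) * (-Real.log ε) := by
      apply mul_le_mul_of_nonneg_right _ (by linarith); linarith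
    have a3 : s * s ^ 48 ≤ (r - r') * s ^ 50 := by
      have : (r - r') * s ^ 50 = ((r - r') * s) * (s * s ^ 48) := by ring
      rw [this]; exact le_mul_of_one_le_left (by positivity) hd
    have a4 : s * (4 * -Real.log ε + |Real.log δ|) ≤ s * s ^ 48 := by gcongr
    nlinarith [abs_nonneg (Real.log δ)]
  rw [resBound, e50, ← Real.exp_log (mul_pos hδ (pow_pos hε 2)), Real.rpow_def_of_pos hε,
    ← Real.exp_add]
  refine Real.exp_le_exp.2 ?_
  rw [Real.log_mul hδ.ne' (by positivity), Real.log_pow]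
  push_cast
  have : 2 * r' / (r - r') = 2 * (r' / (r - r')) := by ring
  rw [this]
  nlinarith

lemma truncN_rpow_le (hν : 0 < ν) (hτ : 0 < τ) (hr' : 0 < r') (hrr : r' < r) (hε : 0 < ε)
    (h : ε ≤ (min 1 (1 / r) * (r - r')) ^ (1100 * τ / ν))
    (hs : (2 * |Real.log ε|) ^ (τ / ν) ≤ ε ^ (-(1 / 1100) : ℝ)) :
    truncN ν r r' ε ^ τ ≤ ε ^ (-(1 / 1100) : ℝ) * ε ^ (-(1 / 1100) : ℝ) := by
  obtain ⟨h0, h1, h2, h3⟩ := width_pos_lt hr' hrr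
  have h4 := (width_inv_le hν hτ hr' hrr hε h).1
  have hd0 : 0 < r - r' := sub_pos.2 hrr
  set D := min 1 (1 / r) * (r - r') with hD
  have hb : 0 ≤ 2 * |Real.log ε| / (r - r') := by positivity
  have hN : truncN ν r r' ε ≤ (2 * |Real.log ε| / (r - r')) ^ (1 / ν) := by
    rw [truncN]
    refine mul_le_of_le_one_left (by positivity) ?_
    rw [div_le_one (by positivity)]; linarith [Real.pi_gt_three]
  calc truncN ν r r' ε ^ τ ≤ ((2 * |Real.log ε| / (r - r')) ^ (1 / ν)) ^ τ := by
        refine Real.rpow_le_rpow ?_ hN hτ.le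
        rw [truncN]; positivity
    _ = (2 * |Real.log ε|) ^ (τ / ν) * (r - r')⁻¹ ^ (τ / ν) := by
        rw [← Real.rpow_mul hb, div_eq_mul_inv (2 * _),
          Real.mul_rpow (by positivity) (by positivity), one_div, inv_mul_eq_div]
    _ ≤ (2 * |Real.log ε|) ^ (τ / ν) * D⁻¹ ^ (τ / ν) := by gcongr
    _ ≤ _ := by gcongr

end Smallness

section ExpDet

open Matrix

lemma det_exp_two (X : Matrix (Fin 2) (Fin 2) ℂ) :
    (NormedSpace.exp X).det = Complex.exp X.trace := by
  set W : Matrix (Fin 2) (Fin 2) ℂ := !![0, 1; -1, 0] with hW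
  have hWdet : IsUnit W := by
    rw [Matrix.isUnit_iff_isUnit_det, hW, det_fin_two_of]; simp
  have hWi : W⁻¹ = -W := by
    refine Matrix.inv_eq_right_inv ?_
    rw [hW]; ext i j; fin_cases i <;> fin_cases j <;> simp [Matrix.mul_apply]
  have hadj : ∀ Y : Matrix (Fin 2) (Fin 2) ℂ, Y.adjugate = W * Yᵀ * W⁻¹ := by
    intro Y
    rw [hWi, Matrix.adjugate_fin_two, hW]
    ext i j; fin_cases i <;> fin_cases j <;>
      simp [Matrix.mul_apply, Matrix.vecMul, dotProduct, Fin.sum_univ_two]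
  have h1 : (NormedSpace.exp X).adjugate = NormedSpace.exp X.adjugate := by
    rw [hadj, hadj, Matrix.exp_conj _ _ hWdet, Matrix.exp_transpose]
  have h2 : X + X.adjugate = Matrix.diagonal fun _ => X.trace := by
    rw [Matrix.adjugate_fin_two, Matrix.trace_fin_two]
    ext i j; fin_cases i <;> fin_cases j <;> simp [add_comm]
  have hcomm : Commute X X.adjugate := by
    rw [Commute, SemiconjBy, Matrix.mul_adjugate, Matrix.adjugate_mul]
  have h3 := Matrix.mul_adjugate (NormedSpace.exp X)
  rw [h1, ← Matrix.exp_add_of_commute _ _ hcomm, h2, Matrix.exp_diagonal] at h3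
  have h4 := congrFun (congrFun h3 0) 0
  simp only [Matrix.diagonal_apply_eq, Matrix.smul_apply, Matrix.one_apply_eq, smul_eq_mul,
    mul_one] at h4
  rw [← h4, Pi.exp_def, Complex.exp_eq_exp_ℂ]

end ExpDet

namespace M2

/-- The trace. -/
def tr (x : M2) : ℂ := x.toMat 0 0 + x.toMat 1 1

/-- The determinant. -/
def det (x : M2) : ℂ := x.toMat.det

lemma det_mul (x y : M2) : (x * y).det = x.det * y.det := Matrix.det_mul _ _

lemma det_exp (x : M2) : (NormedSpace.exp x).det = Complex.exp x.tr := by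
  rw [det, toMat_exp, det_exp_two, Matrix.trace_fin_two, tr]

lemma tr_sub (x y : M2) : (x - y).tr = x.tr - y.tr := by simp only [tr, toMat_sub]; ring
lemma tr_smul (z : ℂ) (x : M2) : (z • x).tr = z * x.tr := by simp only [tr, toMat_smul]; ring
lemma tr_zero : (0 : M2).tr = 0 := by simp [tr]

lemma tr_mul_comm (x y : M2) : (x * y).tr = (y * x).tr := by
  simp only [tr, toMat_mul]; ring

lemma tr_conj {z w : M2} (h : w * z = 1) (x : M2) : (z * x * w).tr = x.tr := by
  rw [tr_mul_comm, ← mul_assoc, h, one_mul]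

/-- The trace as a continuous linear map. -/
def trL : M2 →L[ℝ] ℂ := entryL 0 0 + entryL 1 1

lemma trL_apply (x : M2) : trL x = x.tr := rfl

/-- A matrix with given entries. -/
def of (a b c e : ℂ) : M2 := ofMat !![a, b; c, e]

@[simp] lemma of_00 (a b c e : ℂ) : (of a b c e).toMat 0 0 = a := rfl
@[simp] lemma of_01 (a b c e : ℂ) : (of a b c e).toMat 0 1 = b := rfl
@[simp] lemma of_10 (a b c e : ℂ) : (of a b c e).toMat 1 0 = c := rfl
@[simp] lemma of_11 (a b c e : ℂ) : (of a b c e).toMat 1 1 = e := rfl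

lemma ext' {x y : M2} (h00 : x.toMat 0 0 = y.toMat 0 0) (h01 : x.toMat 0 1 = y.toMat 0 1)
    (h10 : x.toMat 1 0 = y.toMat 1 0) (h11 : x.toMat 1 1 = y.toMat 1 1) : x = y := by
  refine ext fun i j => ?_
  fin_cases i <;> fin_cases j <;> assumption

end M2

/-- A real structure on complex matrices: an isometric antilinear ring homomorphism. -/
structure RealForm where
  σ : M2 →L[ℝ] M2
  mul_eq : ∀ a b, σ (a * b) = σ a * σ b
  one_eq : σ 1 = 1
  norm_le : ∀ a, ‖σ a‖ ≤ ‖a‖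
  smul_eq : ∀ (z : ℂ) a, σ (z • a) = (starRingEnd ℂ z) • σ a
  tr_eq : ∀ a, (σ a).tr = starRingEnd ℂ a.tr

namespace RealForm

/-- Entrywise conjugation. -/
def std : RealForm where
  σ := LinearMap.mkContinuous
    ⟨⟨fun x => M2.of (starRingEnd ℂ (x.toMat 0 0)) (starRingEnd ℂ (x.toMat 0 1))
      (starRingEnd ℂ (x.toMat 1 0)) (starRingEnd ℂ (x.toMat 1 1)),
      fun x y => M2.ext' (by simp) (by simp) (by simp) (by simp)⟩,
      fun r x => M2.ext' (by simp) (by simp) (by simp) (by simp)⟩ 1 fun x => by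
        rw [one_mul]
        refine M2.norm_le ?_ ?_
        · simpa using M2.row_le x 0
        · simpa using M2.row_le x 1
  mul_eq a b := M2.ext' (by simp [M2.toMat_mul]) (by simp [M2.toMat_mul]) (by simp [M2.toMat_mul])
    (by simp [M2.toMat_mul])
  one_eq := M2.ext' (by simp) (by simp) (by simp) (by simp)
  norm_le x := by
    refine M2.norm_le ?_ ?_
    · simpa using M2.row_le x 0
    · simpa using M2.row_le x 1
  smul_eq z a := M2.ext' (by simp) (by simp) (by simp) (by simp)
  tr_eq a := by simp [M2.tr]

/-- The real structure whose real elements are the matrices `(a b; b̄ ā)`. -/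
def su : RealForm where
  σ := LinearMap.mkContinuous
    ⟨⟨fun x => M2.of (starRingEnd ℂ (x.toMat 1 1)) (starRingEnd ℂ (x.toMat 1 0))
      (starRingEnd ℂ (x.toMat 0 1)) (starRingEnd ℂ (x.toMat 0 0)),
      fun x y => M2.ext' (by simp) (by simp) (by simp) (by simp)⟩,
      fun r x => M2.ext' (by simp) (by simp) (by simp) (by simp)⟩ 1 fun x => by
        rw [one_mul]
        refine M2.norm_le ?_ ?_
        · simpa [add_comm] using M2.row_le x 1
        · simpa [add_comm] using M2.row_le x 0
  mul_eq a b := M2.ext' (by simp [M2.toMat_mul, add_comm]) (by simp [M2.toMat_mul, add_comm])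
    (by simp [M2.toMat_mul, add_comm]) (by simp [M2.toMat_mul, add_comm])
  one_eq := M2.ext' (by simp) (by simp) (by simp) (by simp)
  norm_le x := by
    refine M2.norm_le ?_ ?_
    · simpa [add_comm] using M2.row_le x 1
    · simpa [add_comm] using M2.row_le x 0
  smul_eq z a := M2.ext' (by simp) (by simp) (by simp) (by simp)
  tr_eq a := by simp [M2.tr, add_comm]

lemma std_apply (x : M2) : std.σ x = M2.of (starRingEnd ℂ (x.toMat 0 0)) (starRingEnd ℂ (x.toMat 0 1))
      (starRingEnd ℂ (x.toMat 1 0)) (starRingEnd ℂ (x.toMat 1 1)) := rfl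

lemma su_apply (x : M2) : su.σ x = M2.of (starRingEnd ℂ (x.toMat 1 1)) (starRingEnd ℂ (x.toMat 1 0))
      (starRingEnd ℂ (x.toMat 0 1)) (starRingEnd ℂ (x.toMat 0 0)) := rfl

open Wiener

variable {d : ℕ} {ω ω' : Weight (Fin d → ℤ)} (S : RealForm)

/-- The conjugation of the Wiener algebra induced by a real structure. -/
def conjL : Wiener ω M2 →L[ℝ] Wiener ω M2 :=
  push (fun k => -k) (fun _ => S.σ) 1 fun k a => by
    rw [ω.neg_eq, one_mul]
    exact mul_le_mul_of_nonneg_left (S.norm_le a) (ω.pos k).le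

lemma conjL_mono (k : Fin d → ℤ) (a : M2) :
    S.conjL (mono k a : Wiener ω M2) = mono (-k) (S.σ a) := push_mono _ _ _ _ _

lemma coef_conjL (k : Fin d → ℤ) (x : Wiener ω M2) :
    coef k (S.conjL x) = S.σ (coef (-k) x) := by
  have := coef_push (ω := ω) (ω' := ω) (fun k : Fin d → ℤ => -k) neg_injective (fun _ => S.σ)
    (C := 1) (fun k a => by
    rw [ω.neg_eq, one_mul]
    exact mul_le_mul_of_nonneg_left (S.norm_le a) (ω.pos k).le) (-k) x
  simp only [neg_neg] at this
  exact this

lemma eval_conjL (χ : AddChar (Fin d → ℤ) Circle) (x : Wiener ω M2) :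
    eval χ (S.conjL x) = S.σ (eval χ x) := by
  have := ext_mono (f := (eval χ).comp (S.conjL (ω := ω))) (g := S.σ.comp (eval χ)) (fun k a => by
    simp only [ContinuousLinearMap.comp_apply, conjL_mono, eval_mono, S.smul_eq]
    rw [AddChar.map_neg_eq_inv, Circle.coe_inv_eq_conj]) x
  simpa only [ContinuousLinearMap.comp_apply] using this

/-- The real elements of the Wiener algebra. -/
def sub (ω : Weight (Fin d → ℤ)) : Subalgebra ℝ (Wiener ω M2) where
  carrier := {x | S.conjL x = x}
  mul_mem' {x y} hx hy := by
    have h : ∀ x y : Wiener ω M2, S.conjL (x * y) = S.conjL x * S.conjL y :=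
      map_mul_of_mono _ fun k l a b => by
        simp only [conjL_mono, mono_mul_mono, S.mul_eq, neg_add]
    simp only [Set.mem_ofPred_eq] at *
    rw [h, hx, hy]
  add_mem' {x y} hx hy := by
    simp only [Set.mem_ofPred_eq] at *
    rw [map_add, hx, hy]
  algebraMap_mem' r := by
    simp only [Set.mem_ofPred_eq]
    rw [Algebra.algebraMap_eq_smul_one, map_smul, one_def, conjL_mono, neg_zero, S.one_eq]

lemma mem_sub {x : Wiener ω M2} : x ∈ S.sub ω ↔ S.conjL x = x := Iff.rfl

lemma isClosed_sub : IsClosed (S.sub ω : Set (Wiener ω M2)) :=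
  isClosed_eq S.conjL.continuous continuous_id

lemma σ_eval {x : Wiener ω M2} (hx : x ∈ S.sub ω) (χ : AddChar (Fin d → ℤ) Circle) :
    S.σ (eval χ x) = eval χ x := by
  rw [← eval_conjL, S.mem_sub.1 hx]

lemma σ_coef {x : Wiener ω M2} (hx : x ∈ S.sub ω) (k : Fin d → ℤ) :
    S.σ (coef k x) = coef (-k) x := by
  conv_rhs => rw [← S.mem_sub.1 hx, coef_conjL, neg_neg]

lemma mem_sub_of_eval {p : ℝ} (hp : p ≠ 0) {x : Wiener ω M2}
    (h : ∀ θ, S.σ (eval (chi p θ) x) = eval (chi p θ) x) : x ∈ S.sub ω :=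
  eq_of_eval_eq hp fun θ => by rw [eval_conjL, h]

lemma mem_sub_of_coef {x : Wiener ω M2} (h : ∀ k, S.σ (coef (-k) x) = coef k x) : x ∈ S.sub ω :=
  ext_coef fun k => by rw [coef_conjL, h]

lemma tr_im {x : Wiener ω M2} (hx : x ∈ S.sub ω) (χ : AddChar (Fin d → ℤ) Circle) :
    (eval χ x).tr = ((eval χ x).tr.re : ℂ) := by
  have h := S.tr_eq (eval χ x)
  rw [S.σ_eval hx] at h
  exact (Complex.conj_eq_iff_re.1 h.symm).symm

lemma tr_eq_of_exp_det {x : Wiener ω M2} (hx : x ∈ S.sub ω) {χ : AddChar (Fin d → ℤ) Circle}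
    (h : (NormedSpace.exp (eval χ x)).det = 1) : (eval χ x).tr = 0 := by
  rw [M2.det_exp, S.tr_im hx, ← Complex.ofReal_exp] at h
  have h1 : Real.exp (eval χ x).tr.re = 1 := by exact_mod_cast h
  rw [S.tr_im hx, Real.exp_eq_one_iff _ |>.1 h1, Complex.ofReal_zero]

lemma tr_coef_eq_zero {x : Wiener ω M2} (hx : ∀ θ, (eval (chi 1 θ) x).tr = 0)
    (k : Fin d → ℤ) : (coef k x).tr = 0 := by
  have h2 : ∀ θ, (eval (chi 1 θ) x).toMat 1 1 = -(eval (chi 1 θ) x).toMat 0 0 := fun θ =>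
    eq_neg_of_add_eq_zero_right (hx θ)
  rw [M2.tr, ← integral_eval one_ne_zero x k 0 0, ← integral_eval one_ne_zero x k 1 1]
  simp only [h2, neg_mul]
  rw [MeasureTheory.integral_neg, add_neg_cancel]

/-- Both parts of the solution of the conjugacy equation are traceless. -/
lemma tr_eq_zero_of_conjugacy {f y z h : Wiener ω M2} (hy : y ∈ S.sub ω)
    (hz : z ∈ S.sub ω) (hh : h ∈ S.sub ω) {α : Fin d → ℝ}
    (hftr : ∀ θ, (eval (chi 1 θ) f).tr = 0)
    (htr : ∀ k, (coef k z).tr = (chi 1 α k : ℂ) * (coef k y).tr)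
    (heq : NormedSpace.exp f * NormedSpace.exp y = NormedSpace.exp z * NormedSpace.exp h)
    (hmode : ∀ k, (coef k y).tr = 0 ∨ ((coef k h).tr = 0 ∧ (chi 1 α k : ℂ) ≠ 1)) :
    (∀ θ, (eval (chi 1 θ) y).tr = 0) ∧ (∀ θ, (eval (chi 1 θ) h).tr = 0) := by
  have h1 : ∀ θ, (eval (chi 1 θ) (y - z - h)).tr = 0 := by
    intro θ
    have h2 := congrArg (fun x => (eval (chi 1 θ) x).det) heq
    simp only [eval_mul, eval_exp, M2.det_mul, M2.det_exp, hftr, Complex.exp_zero, one_mul] at h2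
    rw [← Complex.exp_add, S.tr_im hy, S.tr_im hz, S.tr_im hh, ← Complex.ofReal_add,
      ← Complex.ofReal_exp, ← Complex.ofReal_exp] at h2
    have h3 := Real.exp_injective (Complex.ofReal_injective h2)
    rw [map_sub, map_sub, M2.tr_sub, M2.tr_sub, S.tr_im hy, S.tr_im hz, S.tr_im hh, h3]
    push_cast; ring
  have hk : ∀ k, (coef k y).tr = 0 ∧ (coef k h).tr = 0 := by
    intro k
    have h4 := tr_coef_eq_zero h1 k
    rw [← coefL_apply, map_sub, map_sub, coefL_apply, coefL_apply, coefL_apply, M2.tr_sub,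
      M2.tr_sub, htr] at h4
    rcases hmode k with h5 | ⟨h5, h6⟩
    · rw [h5] at h4; exact ⟨h5, by simpa using h4⟩
    · refine ⟨?_, h5⟩
      rw [h5, sub_zero] at h4
      have : (1 - (chi 1 α k : ℂ)) * (coef k y).tr = 0 := by rw [← h4]; ring
      exact (mul_eq_zero.1 this).resolve_left (sub_ne_zero.2 h6.symm)
  have hev : ∀ x : Wiener ω M2, (∀ k, (coef k x).tr = 0) → ∀ θ, (eval (chi 1 θ) x).tr = 0 := by
    intro x hx θ
    have := M2.trL.hasSum (eval_hasSum (chi 1 θ) x)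
    simp only [M2.trL_apply, M2.tr_smul, hx, mul_zero] at this
    exact this.unique hasSum_zero
  exact ⟨hev y fun k => (hk k).1, hev h fun k => (hk k).2⟩

end RealForm

section RealMatrices

lemma toC_apply (A : RMat) (i j : Fin 2) : toC A i j = (A i j : ℂ) := rfl

lemma toC_mul (A B : RMat) : toC (A * B) = toC A * toC B :=
  Matrix.map_mul (f := Complex.ofRealHom)

lemma toC_one : toC 1 = 1 := Matrix.map_one _ Complex.ofReal_zero Complex.ofReal_one

lemma toC_sub (A B : RMat) : toC (A - B) = toC A - toC B :=
  Matrix.map_sub _ Complex.ofReal_sub _ _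

lemma toC_injective {A B : RMat} (h : toC A = toC B) : A = B := by
  ext i j
  have := congrFun (congrFun h i) j
  rw [toC_apply, toC_apply] at this
  exact_mod_cast this

lemma det_toC (A : RMat) : (toC A).det = (A.det : ℂ) :=
  (RingHom.map_det Complex.ofRealHom A).symm

lemma canonNorm_toC (A : RMat) : canonNorm (toC A) = canonNorm A := by
  simp [canonNorm, toC_apply]

section

attribute [local instance] Matrix.linftyOpNormedRing Matrix.linftyOpNormedAlgebra

lemma toC_exp (A : RMat) : toC (NormedSpace.exp A) = NormedSpace.exp (toC A) := by
  have h : Continuous (Complex.ofRealHom.mapMatrix : RMat →+* Matrix (Fin 2) (Fin 2) ℂ) :=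
    continuous_id.matrix_map Complex.continuous_ofReal
  exact NormedSpace.map_exp (𝔸 := RMat) (𝔹 := Matrix (Fin 2) (Fin 2) ℂ)
    (Complex.ofRealHom.mapMatrix : RMat →+* Matrix (Fin 2) (Fin 2) ℂ) h A

end

lemma canonNorm_mul_le {𝕜 : Type*} [NormedField 𝕜] (A B : Matrix (Fin 2) (Fin 2) 𝕜) :
    canonNorm (A * B) ≤ canonNorm A * canonNorm B := by
  have hle : ∀ (A : Matrix (Fin 2) (Fin 2) 𝕜) (i j : Fin 2), 2 * ‖A i j‖ ≤ canonNorm A := by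
    intro A i j
    rw [canonNorm]
    gcongr
    fin_cases i <;> fin_cases j <;> simp
  have h0 : ∀ A : Matrix (Fin 2) (Fin 2) 𝕜, 0 ≤ canonNorm A := fun A =>
    (mul_nonneg two_pos.le (norm_nonneg _)).trans (hle A 0 0)
  have hent : ∀ i j, ‖(A * B) i j‖ ≤ canonNorm A * canonNorm B / 2 := by
    intro i j
    rw [Matrix.mul_apply, Fin.sum_univ_two]
    have h1 := mul_le_mul (hle A i 0) (hle B 0 j) (by positivity) (h0 A)
    have h2 := mul_le_mul (hle A i 1) (hle B 1 j) (by positivity) (h0 A)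
    refine (norm_add_le _ _).trans ?_
    rw [norm_mul, norm_mul]
    linarith
  rw [canonNorm]
  linarith [max_le (max_le (hent 0 0) (hent 0 1)) (max_le (hent 1 0) (hent 1 1))]

lemma one_le_canonNorm {A : RMat} (hA : A.det = 1) : 1 ≤ canonNorm A := by
  rw [Matrix.det_fin_two] at hA
  by_contra! h
  rw [canonNorm] at h
  have h' : max (max ‖A 0 0‖ ‖A 0 1‖) (max ‖A 1 0‖ ‖A 1 1‖) < 1 / 2 := by linarith
  simp only [max_lt_iff, Real.norm_eq_abs, abs_lt] at h'
  obtain ⟨⟨h1, h2⟩, h3, h4⟩ := h'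
  nlinarith

/-- A complex matrix fixed by conjugation comes from a real matrix. -/
lemma toC_map_re {x : M2} (hx : RealForm.std.σ x = x) : toC (x.toMat.map Complex.re) = x.toMat := by
  ext i j
  have := congrArg (fun y : M2 => y.toMat i j) hx
  rw [RealForm.std_apply] at this
  rw [toC_apply, Matrix.map_apply]
  refine Complex.conj_eq_iff_re.1 ?_
  fin_cases i <;> fin_cases j <;> simpa using this

lemma std_σ_toC (A : RMat) : RealForm.std.σ (M2.ofMat (toC A)) = M2.ofMat (toC A) := by
  rw [RealForm.std_apply]
  refine M2.ext' ?_ ?_ ?_ ?_ <;> simp [toC_apply]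

end RealMatrices

/-- The map `y ↦ u y v`. -/
def sandwich (u v : M2) : M2 →L[ℝ] M2 :=
  (ContinuousLinearMap.mul ℝ M2 u).comp ((ContinuousLinearMap.mul ℝ M2).flip v)

lemma sandwich_apply (u v y : M2) : sandwich u v y = u * (y * v) := rfl

lemma norm_sandwich_le (u v y : M2) : ‖sandwich u v y‖ ≤ ‖u‖ * ‖v‖ * ‖y‖ := by
  rw [sandwich_apply]
  calc _ ≤ ‖u‖ * (‖y‖ * ‖v‖) := (norm_mul_le _ _).trans
        (mul_le_mul_of_nonneg_left (norm_mul_le _ _) (norm_nonneg _))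
    _ = _ := by ring

lemma exp_sandwich {u v : M2} (h : u * v = 1) (y : M2) :
    NormedSpace.exp (v * (y * u)) = v * (NormedSpace.exp y * u) := by
  have h1 : ∀ y z : M2, sandwich v u (y * z) = sandwich v u y * sandwich v u z := fun y z => by
    simp only [sandwich_apply, mul_assoc]
    rw [← mul_assoc u v, h, one_mul]
  have h2 : v * u = 1 := by
    have : v.toMat * u.toMat = 1 := mul_eq_one_comm.1 (show u.toMat * v.toMat = 1 from h)
    exact this
  have h3 : sandwich v u 1 = 1 := by rw [sandwich_apply, one_mul, h2]
  exact (map_exp_of_hasSum (sandwich v u) h3 h1 y).symm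

namespace Wiener

variable {d : ℕ} {ω ω' : Weight (Fin d → ℤ)}

/-- Termwise action of linear maps with a common bound. -/
def diag (L : (Fin d → ℤ) → M2 →L[ℝ] M2) (C : ℝ) (h : ∀ k a, ‖L k a‖ ≤ C * ‖a‖) :
    Wiener ω M2 →L[ℝ] Wiener ω M2 :=
  push id L C fun k a => by
    rw [id, mul_comm C, mul_assoc]; exact mul_le_mul_of_nonneg_left (h k a) (ω.pos k).le

variable (L : (Fin d → ℤ) → M2 →L[ℝ] M2) {C : ℝ} (h : ∀ k a, ‖L k a‖ ≤ C * ‖a‖)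

lemma diag_mono (k : Fin d → ℤ) (a : M2) : diag L C h (mono k a : Wiener ω M2) = mono k (L k a) :=
  push_mono _ _ _ _ _

lemma coef_diag (k : Fin d → ℤ) (x : Wiener ω M2) : coef k (diag L C h x) = L k (coef k x) :=
  coef_push id Function.injective_id _ _ k x

lemma norm_diag_le (x : Wiener ω M2) : ‖diag L C h x‖ ≤ C * ‖x‖ := norm_push_le _ _ _ x

lemma diag_mem (S : RealForm) (hL : ∀ k a, S.σ (L k a) = L (-k) (S.σ a)) {x : Wiener ω M2}
    (hx : x ∈ S.sub ω) : diag L C h x ∈ S.sub ω :=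
  S.mem_sub_of_coef fun k => by
    rw [coef_diag, coef_diag, hL, neg_neg, S.σ_coef hx, neg_neg]

/-- Inclusion into the functions on the double cover, with a smaller weight. -/
def embed (h : ∀ k : Fin d → ℤ, ω'.w ((2 : ℤ) • k) ≤ ω.w k) : Wiener ω M2 →L[ℝ] Wiener ω' M2 :=
  push (fun k => (2 : ℤ) • k) (fun _ => ContinuousLinearMap.id ℝ M2) 1 fun k a => by
    rw [one_mul]; exact mul_le_mul_of_nonneg_right (h k) (norm_nonneg _)

lemma eval_embed (h : ∀ k : Fin d → ℤ, ω'.w ((2 : ℤ) • k) ≤ ω.w k) (θ : Fin d → ℝ)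
    (x : Wiener ω M2) : eval (chi 2 θ) (embed h x : Wiener ω' M2) = eval (chi 1 θ) x := by
  have := ext_mono (f := (eval (chi 2 θ)).comp (embed (ω' := ω') h)) (g := eval (chi 1 θ))
    (fun k a => by
      rw [ContinuousLinearMap.comp_apply, embed, push_mono, eval_mono, eval_mono, chi_coe, chi_coe,
        ContinuousLinearMap.id_apply, pairing_two_smul]
      congr 3; push_cast; ring) x
  simpa only [ContinuousLinearMap.comp_apply] using this

lemma norm_embed_le (h : ∀ k : Fin d → ℤ, ω'.w ((2 : ℤ) • k) ≤ ω.w k) (x : Wiener ω M2) :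
    ‖(embed h x : Wiener ω' M2)‖ ≤ ‖x‖ := by
  have : ‖(embed h x : Wiener ω' M2)‖ ≤ 1 * ‖x‖ := norm_push_le _ _ _ x
  rwa [one_mul] at this

/-- The translate by `α`, conjugated by constant matrices. -/
def shiftConj (α : Fin d → ℝ) (u v : M2) : Wiener ω M2 →L[ℝ] Wiener ω M2 :=
  diag (fun k => (cmulL (chi 1 α k : ℂ)).comp (sandwich u v)) (‖u‖ * ‖v‖) fun k a => by
    rw [ContinuousLinearMap.comp_apply, cmulL_apply, norm_smul, Circle.norm_coe, one_mul]
    exact norm_sandwich_le u v a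

lemma coef_shiftConj (α : Fin d → ℝ) (u v : M2) (k : Fin d → ℤ) (x : Wiener ω M2) :
    coef k (shiftConj α u v x) = (chi 1 α k : ℂ) • (u * (coef k x * v)) := coef_diag _ _ _ _

lemma eval_shiftConj (α : Fin d → ℝ) (u v : M2) (θ : Fin d → ℝ) (x : Wiener ω M2) :
    eval (chi 1 θ) (shiftConj α u v x) = u * (eval (chi 1 (θ + α)) x * v) := by
  have := ext_mono (f := (eval (chi 1 θ)).comp (shiftConj (ω := ω) α u v))
    (g := (sandwich u v).comp (eval (chi 1 (θ + α)))) (fun k a => by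
      have e : (chi 1 (θ + α) k : ℂ) = chi 1 θ k * chi 1 α k := by
        rw [chi_coe, chi_coe, chi_coe, ← Complex.exp_add, pairing_add_right]
        congr 1; push_cast; ring
      rw [ContinuousLinearMap.comp_apply, shiftConj, diag_mono, eval_mono,
        ContinuousLinearMap.comp_apply, cmulL_apply, smul_smul, ← e, ContinuousLinearMap.comp_apply,
        eval_mono, sandwich_apply, sandwich_apply, smul_mul_assoc, mul_smul_comm]) x
  simpa only [ContinuousLinearMap.comp_apply, sandwich_apply] using this

lemma chi_neg (α : Fin d → ℝ) (k : Fin d → ℤ) :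
    (chi 1 α (-k) : ℂ) = starRingEnd ℂ (chi 1 α k : ℂ) := by
  rw [AddChar.map_neg_eq_inv, Circle.coe_inv_eq_conj]

lemma shiftConj_mem (S : RealForm) (α : Fin d → ℝ) {u v : M2} (hu : S.σ u = u) (hv : S.σ v = v)
    {x : Wiener ω M2} (hx : x ∈ S.sub ω) : shiftConj α u v x ∈ S.sub ω :=
  diag_mem _ _ S (fun k a => by
    simp only [ContinuousLinearMap.comp_apply, cmulL_apply, S.smul_eq, sandwich_apply, S.mul_eq,
      hu, hv, chi_neg]) hx

end Wiener

lemma gevreyWeight_two_le {d : ℕ} {ν r r' : ℝ} (hν : 0 < ν) (hν1 : ν < 1) (hr' : 0 ≤ r')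
    (hrr : r' ≤ r) (k : Fin d → ℤ) :
    (gevreyWeight d two_pos hν hν1 hr').w ((2 : ℤ) • k) ≤
      (gevreyWeight d one_pos hν hν1 (hr'.trans hrr)).w k := by
  refine Real.exp_le_exp.2 ?_
  rw [l1_two_smul, show 2 * Real.pi / 2 * (2 * l1 k) = 2 * Real.pi / 1 * l1 k by ring]
  exact mul_le_mul_of_nonneg_right hrr (Real.rpow_nonneg
    (mul_nonneg (by positivity) (l1_nonneg k)) _)

open Wiener

section Inverse

/-- The solution operator of `w⁻¹ u y v - y = z` for `v = u⁻¹` of trace `t`. -/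
def adInv (u v : M2) (t w : ℂ) : M2 →L[ℝ] M2 :=
  (cmulL (-(w / ((w - 1) * (w ^ 2 - (t ^ 2 - 2) * w + 1))))).comp
    ((sandwich u v).comp (sandwich u v) + (cmulL (w - (t ^ 2 - 1))).comp (sandwich u v) +
      cmulL (w ^ 2 - (t ^ 2 - 1) * w + (t ^ 2 - 1)))

lemma adInv_apply (u v : M2) (t w : ℂ) (y : M2) : adInv u v t w y =
    (-(w / ((w - 1) * (w ^ 2 - (t ^ 2 - 2) * w + 1)))) •
      (u * (u * (y * v) * v) + (w - (t ^ 2 - 1)) • (u * (y * v)) +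
        (w ^ 2 - (t ^ 2 - 1) * w + (t ^ 2 - 1)) • y) := rfl

lemma sandwich_cubic {u v : M2} {t : ℂ} (hu : u * u = t • u - 1) (hv : v * v = t • v - 1) (y : M2) :
    u * (u * (u * (y * v) * v) * v) - (t ^ 2 - 1) • (u * (u * (y * v) * v)) +
      (t ^ 2 - 1) • (u * (y * v)) - y = 0 := by
  have h2 : u * (u * (y * v) * v) = (u * u) * (y * (v * v)) := by simp only [mul_assoc]
  have hu3 : u * (u * u) = (t ^ 2 - 1) • u - t • 1 := by
    rw [hu, mul_sub, mul_smul_comm, hu, mul_one]; module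
  have hv3 : v * v * v = (t ^ 2 - 1) • v - t • 1 := by
    rw [hv, sub_mul, smul_mul_assoc, hv, one_mul]; module
  have h3 : u * (u * (u * (y * v) * v) * v) = (u * (u * u)) * (y * (v * v * v)) := by
    simp only [mul_assoc]
  rw [h3, h2, hu3, hv3, hu, hv]
  simp only [mul_sub, sub_mul, smul_mul_assoc, mul_smul_comm, one_mul, mul_one]
  module

lemma adInv_spec {u v : M2} {t w : ℂ} (hu : u * u = t • u - 1) (hv : v * v = t • v - 1)
    (hw : w ≠ 0) (h1 : w - 1 ≠ 0) (h2 : w ^ 2 - (t ^ 2 - 2) * w + 1 ≠ 0) (y : M2) :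
    w⁻¹ • (u * (adInv u v t w y * v)) - adInv u v t w y = y := by
  have hc := sandwich_cubic hu hv y
  rw [adInv_apply]
  set p := (w - 1) * (w ^ 2 - (t ^ 2 - 2) * w + 1) with hp
  have hp0 : p ≠ 0 := mul_ne_zero h1 h2
  set y1 := u * (y * v)
  set y2 := u * (y1 * v)
  set y3 := u * (y2 * v)
  have e : u * (((-(w / p)) • (y2 + (w - (t ^ 2 - 1)) • y1 +
      (w ^ 2 - (t ^ 2 - 1) * w + (t ^ 2 - 1)) • y)) * v) =
      (-(w / p)) • (y3 + (w - (t ^ 2 - 1)) • y2 + (w ^ 2 - (t ^ 2 - 1) * w + (t ^ 2 - 1)) • y1) := by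
    simp only [smul_mul_assoc, mul_smul_comm, add_mul, mul_add]
    rfl
  have e3 : y3 = (t ^ 2 - 1) • y2 - (t ^ 2 - 1) • y1 + y := by
    rw [← sub_eq_zero, ← hc]; simp only [y3, y2, y1, mul_assoc]; abel
  rw [e, e3, smul_smul]
  have hwp : w⁻¹ * -(w / p) = -(1 / p) := by field_simp
  rw [hwp]
  match_scalars
  · field_simp
    simp only [hp]; ring
  · field_simp; ring
  · field_simp; ring

lemma norm_adInv_le {u v : M2} {t w : ℂ} {P m : ℝ} (hw : ‖w‖ = 1) (hP : 10 ≤ P) (hu : ‖u‖ ≤ P)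
    (hv : ‖v‖ ≤ P) (ht : ‖t‖ ≤ P) (hm : 0 < m)
    (hdiv : m ≤ ‖(w - 1) * (w ^ 2 - (t ^ 2 - 2) * w + 1)‖) (y : M2) :
    ‖adInv u v t w y‖ ≤ m⁻¹ * P ^ 5 * ‖y‖ := by
  rw [adInv_apply, norm_smul, norm_neg, norm_div, hw]
  have hP0 : 0 ≤ P := by linarith
  have hS : ∀ z : M2, ‖u * (z * v)‖ ≤ P ^ 2 * ‖z‖ := fun z => by
    calc _ ≤ ‖u‖ * (‖z‖ * ‖v‖) := (norm_mul_le _ _).trans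
          (mul_le_mul_of_nonneg_left (norm_mul_le _ _) (norm_nonneg _))
      _ ≤ P * (‖z‖ * P) := by gcongr
      _ = _ := by ring
  have hc : ‖t ^ 2 - 1‖ ≤ P ^ 2 + 1 := by
    refine (norm_sub_le _ _).trans ?_
    rw [norm_pow, norm_one]
    gcongr
  have hc1 : ‖w - (t ^ 2 - 1)‖ ≤ P ^ 2 + 2 := by
    refine (norm_sub_le _ _).trans ?_
    rw [hw]; linarith
  have hc2 : ‖w ^ 2 - (t ^ 2 - 1) * w + (t ^ 2 - 1)‖ ≤ 2 * P ^ 2 + 3 := by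
    refine (norm_add_le _ _).trans ?_
    have := norm_sub_le (w ^ 2) ((t ^ 2 - 1) * w)
    rw [norm_pow, norm_mul, hw] at this
    linarith
  have h2 : ‖u * (u * (y * v) * v)‖ ≤ P ^ 2 * (P ^ 2 * ‖y‖) :=
    (hS _).trans (by gcongr; exact hS y)
  have hsum : ‖u * (u * (y * v) * v) + (w - (t ^ 2 - 1)) • (u * (y * v)) +
        (w ^ 2 - (t ^ 2 - 1) * w + (t ^ 2 - 1)) • y‖ ≤ P ^ 5 * ‖y‖ := by
    calc _ ≤ P ^ 2 * (P ^ 2 * ‖y‖) + (P ^ 2 + 2) * (P ^ 2 * ‖y‖) + (2 * P ^ 2 + 3) * ‖y‖ := by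
          refine (norm_add_le _ _).trans (add_le_add ((norm_add_le _ _).trans
            (add_le_add h2 ?_)) ?_)
          · rw [norm_smul]; gcongr; exact hS y
          · rw [norm_smul]; gcongr
      _ = (2 * P ^ 4 + 4 * P ^ 2 + 3) * ‖y‖ := by ring
      _ ≤ _ := by
          gcongr
          have h4 : 100 ≤ P ^ 2 := by nlinarith
          have : 10 * P ^ 4 ≤ P ^ 5 := by
            have : P ^ 5 = P * P ^ 4 := by ring
            rw [this]; gcongr
          nlinarith [sq_nonneg (P ^ 2)]
  have hinv : 1 / ‖(w - 1) * (w ^ 2 - (t ^ 2 - 2) * w + 1)‖ ≤ m⁻¹ := by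
    rw [one_div]; exact inv_anti₀ hm hdiv
  calc _ ≤ m⁻¹ * (P ^ 5 * ‖y‖) := by gcongr
    _ = _ := by ring

lemma std_adInv {u v : M2} {t w : ℂ} (hu : RealForm.std.σ u = u) (hv : RealForm.std.σ v = v)
    (ht : starRingEnd ℂ t = t) (y : M2) : RealForm.std.σ (adInv u v t w y) =
      adInv u v t (starRingEnd ℂ w) (RealForm.std.σ y) := by
  simp only [adInv_apply, RealForm.smul_eq, map_add, RealForm.mul_eq, hu, hv, map_neg, map_div₀,
    _root_.map_mul, map_sub, map_pow, ht, _root_.map_one, map_ofNat]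

end Inverse

section Eigenvalues

lemma trace_eq_of_hasEigenvaluesExp {A : RMat} {ξ : ℂ} (h : HasEigenvaluesExp A ξ) :
    (A.trace : ℂ) = Complex.exp (2 * Real.pi * ξ * Complex.I) +
      Complex.exp (-(2 * Real.pi * ξ * Complex.I)) := by
  have h1 := congrArg (fun p => p.coeff 1) h
  rw [Matrix.charpoly_fin_two] at h1
  have h2 : (toC A).trace = (A.trace : ℂ) := by
    simp [Matrix.trace_fin_two, toC_apply]
  simp [Polynomial.coeff_X, Polynomial.coeff_C, mul_sub, sub_mul, h2,
    Polynomial.coeff_mul_X] at h1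
  linear_combination -h1

/-- The small divisors of the adjoint action of a matrix with eigenvalues `e^{±2πiξ}`. -/
lemma divisor_le {ξ t : ℂ} {x m : ℝ} (ht : t = Complex.exp (2 * Real.pi * ξ * Complex.I) +
      Complex.exp (-(2 * Real.pi * ξ * Complex.I))) (hm : 0 < m) (hm2 : m ≤ 1 / 2)
    (h0 : m ≤ torusDist (x : ℂ)) (h1 : m ≤ torusDist (2 * ξ - x)) (h2 : m ≤ torusDist (2 * ξ + x)) :
    let w := starRingEnd ℂ (Complex.exp (2 * Real.pi * x * Complex.I))
    m ^ 3 ≤ ‖(w - 1) * (w ^ 2 - (t ^ 2 - 2) * w + 1)‖ := by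
  intro w
  have hw : w = Complex.exp (-(2 * Real.pi * x * Complex.I)) := by
    change starRingEnd ℂ (Complex.exp _) = _
    rw [← Complex.exp_conj]; simp [map_ofNat]
  have hwn : ‖w‖ = 1 := by
    rw [RCLike.norm_conj]
    have : (2 * Real.pi * x * Complex.I : ℂ) = ((2 * Real.pi * x : ℝ) : ℂ) * Complex.I := by
      push_cast; rfl
    rw [this, Complex.norm_exp_ofReal_mul_I]
  have hfac : w ^ 2 - (t ^ 2 - 2) * w + 1 =
      (w - Complex.exp (2 * Real.pi * (2 * ξ) * Complex.I)) *
      (w - Complex.exp (-(2 * Real.pi * (2 * ξ) * Complex.I))) := by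
    have e1 : Complex.exp (2 * Real.pi * (2 * ξ) * Complex.I) =
        Complex.exp (2 * Real.pi * ξ * Complex.I) ^ 2 := by
      rw [← Complex.exp_nat_mul]; congr 1; push_cast; ring
    have e2 : Complex.exp (-(2 * Real.pi * (2 * ξ) * Complex.I)) =
        Complex.exp (-(2 * Real.pi * ξ * Complex.I)) ^ 2 := by
      rw [← Complex.exp_nat_mul]; congr 1; push_cast; ring
    have e3 : Complex.exp (2 * Real.pi * ξ * Complex.I) *
        Complex.exp (-(2 * Real.pi * ξ * Complex.I)) = 1 := by
      rw [← Complex.exp_add, add_neg_cancel, Complex.exp_zero]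
    rw [e1, e2, ht]
    set l := Complex.exp (2 * Real.pi * ξ * Complex.I)
    set l' := Complex.exp (-(2 * Real.pi * ξ * Complex.I))
    linear_combination (-2 * w - 1 - l * l') * e3
  have key : ∀ z : ℂ, m ≤ torusDist z → m ≤ ‖w - w * Complex.exp (2 * Real.pi * z * Complex.I)‖ := by
    intro z hz
    rw [← mul_one_sub, norm_mul, hwn, one_mul, norm_sub_rev]
    exact (le_min hm2 hz).trans (min_le_norm_exp_sub_one z)
  have k0 : m ≤ ‖w - 1‖ := by
    have := key x h0
    have e : w * Complex.exp (2 * Real.pi * x * Complex.I) = 1 := by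
      rw [hw, ← Complex.exp_add, neg_add_cancel, Complex.exp_zero]
    rwa [e] at this
  have k1 : m ≤ ‖w - Complex.exp (2 * Real.pi * (2 * ξ) * Complex.I)‖ := by
    have := key (2 * ξ + x) h2
    have e : w * Complex.exp (2 * Real.pi * (2 * ξ + x) * Complex.I) =
        Complex.exp (2 * Real.pi * (2 * ξ) * Complex.I) := by
      rw [hw, ← Complex.exp_add]; congr 1; ring
    rwa [e] at this
  have k2 : m ≤ ‖w - Complex.exp (-(2 * Real.pi * (2 * ξ) * Complex.I))‖ := by
    have := key (-(2 * ξ - x)) (by rwa [torusDist_neg])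
    have e : w * Complex.exp (2 * Real.pi * (-(2 * ξ - x)) * Complex.I) =
        Complex.exp (-(2 * Real.pi * (2 * ξ) * Complex.I)) := by
      rw [hw, ← Complex.exp_add]; congr 1; ring
    rwa [e] at this
  rw [hfac, norm_mul, norm_mul]
  calc m ^ 3 = m * (m * m) := by ring
    _ ≤ _ := by gcongr

end Eigenvalues

section Cut

variable {d : ℕ} {ω ω' : Weight (Fin d → ℤ)}

open scoped Classical in
/-- Restriction of a family of linear maps to a set of indices. -/
def cut (s : Set (Fin d → ℤ)) (L : (Fin d → ℤ) → M2 →L[ℝ] M2) (k : Fin d → ℤ) : M2 →L[ℝ] M2 :=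
  if k ∈ s then L k else 0

lemma cut_of_mem {s : Set (Fin d → ℤ)} {k : Fin d → ℤ} (h : k ∈ s)
    (L : (Fin d → ℤ) → M2 →L[ℝ] M2) : cut s L k = L k := if_pos h

lemma cut_of_notMem {s : Set (Fin d → ℤ)} {k : Fin d → ℤ} (h : k ∉ s)
    (L : (Fin d → ℤ) → M2 →L[ℝ] M2) : cut s L k = 0 := if_neg h

lemma norm_cut_le {s : Set (Fin d → ℤ)} {L : (Fin d → ℤ) → M2 →L[ℝ] M2} {C : ℝ} (hC : 0 ≤ C)
    (h : ∀ k ∈ s, ∀ a, ‖L k a‖ ≤ C * ‖a‖) (k : Fin d → ℤ) (a : M2) : ‖cut s L k a‖ ≤ C * ‖a‖ := by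
  by_cases hk : k ∈ s
  · rw [cut_of_mem hk]; exact h k hk a
  · rw [cut_of_notMem hk, zero_apply, norm_zero]; positivity

lemma σ_cut (S : RealForm) {s : Set (Fin d → ℤ)} (hs : ∀ k, -k ∈ s ↔ k ∈ s)
    {L : (Fin d → ℤ) → M2 →L[ℝ] M2} (hL : ∀ k ∈ s, ∀ a, S.σ (L k a) = L (-k) (S.σ a))
    (k : Fin d → ℤ) (a : M2) : S.σ (cut s L k a) = cut s L (-k) (S.σ a) := by
  by_cases hk : k ∈ s
  · rw [cut_of_mem hk, cut_of_mem ((hs k).2 hk)]; exact hL k hk a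
  · rw [cut_of_notMem hk, cut_of_notMem (fun h => hk ((hs k).1 h)), zero_apply, zero_apply, map_zero]

end Cut

lemma canonNorm_adjugate (A : RMat) : canonNorm A.adjugate = canonNorm A := by
  rw [Matrix.adjugate_fin_two]
  simp only [canonNorm, Matrix.of_apply, Matrix.cons_val', Matrix.cons_val_zero,
    Matrix.cons_val_one, norm_neg, Matrix.cons_val_fin_one]
  rw [max_comm (max ‖A 1 1‖ _), max_comm ‖A 1 0‖, max_comm ‖A 1 1‖, max_max_max_comm,
    max_comm ‖A 0 0‖ ‖A 0 1‖, max_comm ‖A 1 0‖ ‖A 1 1‖, max_max_max_comm, max_comm ‖A 0 1‖ ‖A 1 1‖,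
    max_max_max_comm]

/-- The real matrix underlying a matrix fixed by conjugation. -/
def reMat (x : M2) : RMat := x.toMat.map Complex.re

lemma toC_reMat {x : M2} (hx : RealForm.std.σ x = x) : toC (reMat x) = x.toMat := toC_map_re hx

lemma σ_exp (S : RealForm) {x : M2} (hx : S.σ x = x) :
    S.σ (NormedSpace.exp x) = NormedSpace.exp x := by
  rw [map_exp_of_hasSum S.σ S.one_eq S.mul_eq, hx]

lemma det_reMat_exp {x : M2} (hx : RealForm.std.σ x = x) (htr : x.tr = 0) :
    (reMat (NormedSpace.exp x)).det = 1 := by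
  have h : ((reMat (NormedSpace.exp x)).det : ℂ) = 1 := by
    rw [← det_toC, toC_reMat (σ_exp _ hx)]
    have := M2.det_exp x
    rw [htr, Complex.exp_zero] at this
    exact this
  exact_mod_cast h

lemma trace_reMat {x : M2} (htr : x.tr = 0) : (reMat x).trace = 0 := by
  rw [Matrix.trace_fin_two]
  have := congrArg Complex.re htr
  simpa [M2.tr, reMat] using this

section Params

variable {p P : ℝ}

lemma inv_pow_mul_pow (hp : p ≠ 0) (m n : ℕ) : p⁻¹ ^ m * p ^ (m + n) = p ^ n := by
  rw [pow_add, ← mul_assoc, ← mul_pow, inv_mul_cancel₀ hp, one_pow, one_mul]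

lemma pow_le_of_le (hp : 0 < p) (hp6 : p ≤ 1 / 1000000) {m n : ℕ} (h : m < n) :
    1000000 * p ^ n ≤ p ^ m := by
  obtain ⟨l, rfl⟩ := Nat.exists_eq_add_of_lt h
  have h1 : p ^ (m + l + 1) = p ^ m * p ^ l * p := by ring
  have h2 : p ^ l ≤ 1 := pow_le_one₀ hp.le (by linarith)
  rw [h1]
  have h3 : p ^ m * p ^ l * p ≤ p ^ m * 1 * (1 / 1000000) := by gcongr
  linarith

end Params


section Reduction

variable {d : ℕ} {W : Weight (Fin d → ℤ)}

/-- Removal of the modes selected by `LQ`, for the cocycle `(α, v)` and a real structure. -/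
theorem RealForm.exists_reduction (S : RealForm) (α : Fin d → ℝ) {u v : M2}
    (hvu : v * u = 1) (hu : S.σ u = u) (hv : S.σ v = v) {LK LQ : (Fin d → ℤ) → M2 →L[ℝ] M2}
    {C C' ε : ℝ} (hC : 1 ≤ C) (hLK : ∀ k a, ‖LK k a‖ ≤ C * ‖a‖)
    (hLTK : ‖u‖ * ‖v‖ * C ≤ C') (hCC : C ≤ C')
    (hLQ : ∀ k a, ‖LQ k a‖ ≤ 1 * ‖a‖) (hLQ' : ∀ k a, ‖a - LQ k a‖ ≤ 1 * ‖a‖)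
    (hcoh : ∀ k a, (chi 1 α k : ℂ) • (u * (LK k a * v)) - LK k a = LQ k a)
    (hKσ : ∀ k a, S.σ (LK k a) = LK (-k) (S.σ a)) (hQσ : ∀ k a, S.σ (LQ k a) = LQ (-k) (S.σ a))
    (hmode : ∀ k, (∀ a, (LK k a).tr = 0) ∨ ((∀ a, (a - LQ k a).tr = 0) ∧ (chi 1 α k : ℂ) ≠ 1))
    {x : Wiener W M2} (hx : x ∈ S.sub W) (hxtr : ∀ θ, (eval (chi 1 θ) x).tr = 0)
    (hxε : ‖x‖ ≤ ε) (hε : 300 * C' ^ 2 * ε ≤ 1) :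
    ∃ x' ∈ S.sub W, ∃ y ∈ S.sub W, ∃ h ∈ S.sub W,
      ‖x'‖ ≤ 4 * ε ∧ ‖x' - x‖ ≤ 600 * C' ^ 2 * ε ^ 2 ∧ ‖y‖ ≤ C * ‖x'‖ ∧ ‖h‖ ≤ ‖x'‖ ∧
      (∀ k, coef k h = coef k x' - LQ k (coef k x')) ∧
      (∀ θ, (eval (chi 1 θ) y).tr = 0) ∧ (∀ θ, (eval (chi 1 θ) h).tr = 0) ∧
      (∀ θ, NormedSpace.exp (eval (chi 1 θ) x) * NormedSpace.exp (eval (chi 1 θ) y) =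
        u * (NormedSpace.exp (eval (chi 1 (θ + α)) y) * v) *
          NormedSpace.exp (eval (chi 1 θ) h)) := by
  set K : Wiener W M2 →L[ℝ] Wiener W M2 := diag _ _ hLK with hK
  set Q : Wiener W M2 →L[ℝ] Wiener W M2 := diag _ _ hLQ with hQ
  set T : Wiener W M2 →L[ℝ] Wiener W M2 := shiftConj α u v with hT
  have hLR : ∀ k a, ‖(ContinuousLinearMap.id ℝ M2 - LQ k) a‖ ≤ 1 * ‖a‖ := fun k a => by
    rw [sub_apply, ContinuousLinearMap.id_apply]; exact hLQ' k a
  set R : Wiener W M2 →L[ℝ] Wiener W M2 := diag _ _ hLR with hR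
  have hQR : ∀ z : Wiener W M2, z - Q z = R z := fun z => ext_coef fun k => by
    rw [hR, coef_diag, ← coefL_apply, map_sub, coefL_apply, coefL_apply, hQ, coef_diag, sub_apply,
      ContinuousLinearMap.id_apply]
  have hTn : ∀ z : Wiener W M2, ‖T z‖ ≤ ‖u‖ * ‖v‖ * ‖z‖ := fun z => norm_diag_le _ _ z
  have hRn : ∀ z : Wiener W M2, ‖z - Q z‖ ≤ ‖z‖ := fun z => by
    have : ‖R z‖ ≤ 1 * ‖z‖ := norm_diag_le _ hLR z
    rwa [hQR, ← one_mul ‖z‖]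
  have hKn : ∀ z : Wiener W M2, ‖K z‖ ≤ C * ‖z‖ := fun z => norm_diag_le _ hLK z
  have hQm : ∀ z ∈ S.sub W, Q z ∈ S.sub W := fun z hz => diag_mem _ _ S hQσ hz
  have hKm : ∀ z ∈ S.sub W, K z ∈ S.sub W := fun z hz => diag_mem _ _ S hKσ hz
  have hTm : ∀ z ∈ S.sub W, T z ∈ S.sub W := fun z hz => shiftConj_mem S α hu hv hz
  obtain ⟨x', hx', hn1, hn2, heq⟩ := exists_conjugacy_reduction (S.sub W) S.isClosed_sub T K Q
    (hC.trans hCC) (fun z => (hKn z).trans (by gcongr)) (fun z => (hTn _).trans (by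
      calc _ ≤ ‖u‖ * ‖v‖ * (C * ‖z‖) := by gcongr; exact hKn z
        _ = ‖u‖ * ‖v‖ * C * ‖z‖ := by ring
        _ ≤ _ := by gcongr)) hRn
    (fun z => ext_coef fun k => by
      rw [← coefL_apply, map_sub, coefL_apply, coefL_apply, hT, coef_shiftConj, hK, coef_diag,
        hQ, coef_diag, hcoh]) hTm hKm hQm hx hxε hε
  have hcoefh : ∀ k, coef k (x' - Q x') = coef k x' - LQ k (coef k x') := fun k => by
    rw [← coefL_apply, map_sub, coefL_apply, coefL_apply, hQ, coef_diag]
  obtain ⟨htr1, htr2⟩ := S.tr_eq_zero_of_conjugacy (α := α) (hKm _ hx') (hTm _ (hKm _ hx'))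
    (sub_mem hx' (hQm _ hx')) hxtr (fun k => by
      rw [hT, coef_shiftConj, M2.tr_smul, ← mul_assoc u, M2.tr_conj hvu]) heq (fun k => by
      rw [hcoefh, hK, coef_diag]
      exact (hmode k).imp (fun h => h _) (fun h => ⟨h.1 _, h.2⟩))
  refine ⟨x', hx', K x', hKm _ hx', x' - Q x', sub_mem hx' (hQm _ hx'), hn1, hn2, hKn _, hRn _,
    hcoefh, htr1, htr2, fun θ => ?_⟩
  have := congrArg (eval (chi 1 θ)) heq
  simp only [eval_mul, eval_exp] at this
  rw [this, hT, eval_shiftConj, exp_sandwich hvu]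

lemma RealForm.const_mem (S : RealForm) {a : M2} (ha : S.σ a = a) : (const a : Wiener W M2) ∈ S.sub W :=
  S.mem_sub_of_coef fun k => by
    simp only [const, coef_mono, neg_eq_zero]
    split_ifs
    · exact ha
    · exact map_zero _

/-- The logarithm of `e^{-a} e^h` for a constant `a`. -/
lemma RealForm.exists_log_quotient (S : RealForm) {a : M2} (ha : S.σ a = a) {h : Wiener W M2}
    (hh : h ∈ S.sub W) (hna : ‖a‖ ≤ 1 / 100) (hnh : ‖h‖ ≤ 1 / 100) :
    ∃ z ∈ S.sub W, ‖z‖ ≤ 3 * ‖h - const a‖ ∧ ∀ χ : AddChar (Fin d → ℤ) Circle,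
      NormedSpace.exp (eval χ z) = NormedSpace.exp (-a) * NormedSpace.exp (eval χ h) := by
  have hc := S.const_mem (W := W) ha
  set c : Wiener W M2 := const a with hcdef
  have hcn : ‖c‖ ≤ 1 / 100 := by rw [hcdef, norm_const]; exact hna
  have hinv : NormedSpace.exp (-c) * NormedSpace.exp c = 1 := by
    let := NormedAlgebra.restrictScalars ℚ ℝ (Wiener W M2)
    rw [← NormedSpace.exp_add_of_commute (Commute.neg_left (Commute.refl c)), neg_add_cancel,
      NormedSpace.exp_zero]
  have h1 := norm_exp_sub_one_le (x := -c) (ρ := 1 / 100) (by norm_num) (by rwa [norm_neg])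
  have h2 := norm_exp_sub_exp_le (ρ := 1 / 100) (by norm_num) hnh hcn
  have h3 : ‖NormedSpace.exp (-c)‖ ≤ 1.02 := by
    have := norm_le_norm_add_norm_sub' (NormedSpace.exp (-c)) 1
    rw [norm_one] at this
    rw [norm_neg] at h1
    linarith
  set U := NormedSpace.exp (-c) * NormedSpace.exp h - 1 with hU
  have hUe : U = NormedSpace.exp (-c) * (NormedSpace.exp h - NormedSpace.exp c) := by
    rw [mul_sub, hinv]
  have hUn : ‖U‖ ≤ 1.05 * ‖h - c‖ := by
    rw [hUe]
    calc _ ≤ 1.02 * ((1 + 2 * (1 / 100)) * ‖h - c‖) := (norm_mul_le _ _).trans (by gcongr)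
      _ ≤ _ := by nlinarith [norm_nonneg (h - c)]
  have hhc : ‖h - c‖ ≤ 1 / 50 := (norm_sub_le _ _).trans (by linarith)
  have hUm : U ∈ S.sub W := sub_mem (mul_mem
    (exp_mem_of_isClosed _ S.isClosed_sub (neg_mem hc)) (exp_mem_of_isClosed _ S.isClosed_sub hh))
    (one_mem _)
  obtain ⟨z, hz, hze, hzn, -⟩ := exists_log (S.sub W) S.isClosed_sub hUm (by linarith)
  refine ⟨z, hz, by linarith [norm_nonneg (h - c)], fun χ => ?_⟩
  rw [← eval_exp, hze, hU, add_sub_cancel, eval_mul, eval_exp, eval_exp, map_neg, hcdef, eval_const]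

end Reduction

/-- The step in the absence of resonances, with the smallness expressed through a parameter `p`. -/
theorem nonresonant_step {d : ℕ} {ν r r' ε p N : ℝ} {α : Fin d → ℝ} {A : RMat}
    {f : (Fin d → ℝ) → RMat} {ξ : ℂ} (hν : 0 < ν) (hν1 : ν < 1) (hr' : 0 < r') (hrr : r' < r)
    (hA : A.det = 1) (hξ : HasEigenvaluesExp A ξ) (hf : MemGevreysl 1 ν r f)
    (hfε : gevreyNorm 1 ν r f < ε) (hp : 0 < p) (hp6 : p ≤ 1 / 1000000) (hε : ε = p ^ 1100)
    (hAp : canonNorm A ≤ p⁻¹)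
    (hdiv : ∀ k : Fin d → ℤ, 0 < l1 k → l1 k ≤ N → p ^ 55 ≤ torusDist ((pairing k α : ℝ) : ℂ))
    (hres : ∀ k : Fin d → ℤ, 0 < l1 k → l1 k ≤ N → p ^ 55 ≤ resDist ξ α k)
    (htail : ∀ k : Fin d → ℤ, N < l1 k →
      Real.exp (r' * (2 * Real.pi / 1 * l1 k) ^ ν) ≤
        ε ^ 2 * Real.exp (r * (2 * Real.pi / 1 * l1 k) ^ ν)) :
    ∃ (B : (Fin d → ℝ) → RMat) (A' : RMat) (f' : (Fin d → ℝ) → RMat),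
      MemGevreySL 2 ν r' B ∧ A'.det = 1 ∧ MemGevreysl 1 ν r' f' ∧
      (∀ θ, (B (θ + α))⁻¹ * (A * NormedSpace.exp (f θ)) * B θ = A' * NormedSpace.exp (f' θ)) ∧
      NonresEstimates ν r' ε A A' B f' := by
  have hr : 0 ≤ r := (hr'.trans hrr).le
  set W := gevreyWeight d one_pos hν hν1 hr
  set W' := gevreyWeight d one_pos hν hν1 hr'.le
  set W2 := gevreyWeight d two_pos hν hν1 hr'.le
  obtain ⟨x, hx, hxn⟩ := wiener_of_gevrey one_pos hν hν1 hr hf.1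
  have hxM : ∀ θ, eval (chi 1 θ) x = M2.ofMat (toC (f θ)) := fun θ =>
    M2.toMat_injective (hx θ).symm
  set S := RealForm.std
  have hxS : x ∈ S.sub W := S.mem_sub_of_eval one_ne_zero fun θ => by
    rw [hxM]; exact std_σ_toC _
  have hxtr : ∀ θ, (eval (chi 1 θ) x).tr = 0 := fun θ => by
    rw [hxM]
    have h := hf.2 θ
    rw [Matrix.trace_fin_two] at h
    simp only [M2.tr, M2.toMat_ofMat, toC_apply]
    exact_mod_cast h
  have hxε : ‖x‖ ≤ ε := hxn.trans hfε.le
  set P := p⁻¹ with hPdef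
  have hPp : P * p = 1 := inv_mul_cancel₀ hp.ne'
  have hP6 : 1000000 ≤ P := by
    rw [hPdef, le_inv_comm₀ (by norm_num) hp]; linarith
  have hP1 : 1 ≤ P := by linarith
  have hε0 : 0 < ε := by rw [hε]; positivity
  set a := M2.ofMat (toC A) with ha
  set b := M2.ofMat (toC A.adjugate) with hb
  set t : ℂ := (A.trace : ℂ) with ht
  have hba : b * a = 1 := by
    rw [ha, hb, ← M2.ofMat_mul', ← toC_mul, Matrix.adjugate_mul, hA, one_smul, toC_one]; rfl
  have hab : a * b = 1 := by
    rw [ha, hb, ← M2.ofMat_mul', ← toC_mul, Matrix.mul_adjugate, hA, one_smul, toC_one]; rfl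
  have haP : ‖a‖ ≤ P := (M2.norm_le_canonNorm _).trans (by
    rw [ha, M2.toMat_ofMat, canonNorm_toC]; exact hAp)
  have hbP : ‖b‖ ≤ P := (M2.norm_le_canonNorm _).trans (by
    rw [hb, M2.toMat_ofMat, canonNorm_toC, canonNorm_adjugate]; exact hAp)
  have hbt : b = t • 1 - a := by
    rw [hb, ha, ht, Matrix.adjugate_fin_two, Matrix.trace_fin_two]
    refine M2.ext' ?_ ?_ ?_ ?_ <;> simp [toC_apply]
  have haa : a * a = t • a - 1 := by
    rw [← hab, hbt, mul_sub, mul_smul_comm, mul_one]; abel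
  have hbb : b * b = t • b - 1 := by
    nth_rewrite 1 [hbt]
    rw [sub_mul, hab, smul_mul_assoc, one_mul]
  have htP : ‖t‖ ≤ P := by
    refine le_trans ?_ hAp
    rw [ht, Complex.norm_real, Matrix.trace_fin_two, canonNorm]
    refine (norm_add_le _ _).trans ?_
    linarith [le_max_left (max ‖A 0 0‖ ‖A 0 1‖) (max ‖A 1 0‖ ‖A 1 1‖),
      le_max_right (max ‖A 0 0‖ ‖A 0 1‖) (max ‖A 1 0‖ ‖A 1 1‖),
      le_max_left ‖A 0 0‖ ‖A 0 1‖, le_max_right ‖A 1 0‖ ‖A 1 1‖]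
  set s : Set (Fin d → ℤ) := {k | 0 < l1 k ∧ l1 k ≤ N} with hs
  have hsneg : ∀ k, -k ∈ s ↔ k ∈ s := fun k => by simp only [hs, Set.mem_ofPred_eq, l1_neg]
  have hp55 : 0 < p ^ 55 := by positivity
  have hp55' : p ^ 55 ≤ 1 / 2 := by
    have := pow_le_of_le hp hp6 (m := 0) (n := 55) (by norm_num)
    rw [pow_zero] at this; linarith
  have hdivs : ∀ k ∈ s, (p ^ 55) ^ 3 ≤
      ‖(starRingEnd ℂ (chi 1 α k : ℂ) - 1) * (starRingEnd ℂ (chi 1 α k : ℂ) ^ 2 -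
        (t ^ 2 - 2) * starRingEnd ℂ (chi 1 α k : ℂ) + 1)‖ := by
    intro k hk
    have h2 := hres (-k) (by rw [l1_neg]; exact hk.1) (by rw [l1_neg]; exact hk.2)
    rw [resDist, pairing_neg, Complex.ofReal_neg, sub_neg_eq_add] at h2
    have := divisor_le (trace_eq_of_hasEigenvaluesExp hξ) hp55 hp55' (hdiv k hk.1 hk.2)
      (hres k hk.1 hk.2) h2
    rw [chi_coe]
    simpa using this
  have hchi1 : ∀ k ∈ s, (chi 1 α k : ℂ) ≠ 1 := by
    intro k hk h
    have := hdivs k hk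
    rw [h, map_one, sub_self, zero_mul, norm_zero] at this
    linarith [pow_pos hp55 3]
  have hchi0 : ∀ k, (chi 1 α k : ℂ) ≠ 0 := fun k => Circle.coe_ne_zero _
  have hwi : ∀ k, (starRingEnd ℂ (chi 1 α k : ℂ))⁻¹ = chi 1 α k := fun k => by
    rw [← chi_neg, AddChar.map_neg_eq_inv, Circle.coe_inv, inv_inv]
  have hKbound : ∀ k a', ‖cut s (fun k => adInv b a t (starRingEnd ℂ (chi 1 α k : ℂ))) k a'‖ ≤
      P ^ 170 * ‖a'‖ := norm_cut_le (by positivity) fun k hk a' => by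
    have := norm_adInv_le (w := starRingEnd ℂ (chi 1 α k : ℂ)) (by rw [RCLike.norm_conj, Circle.norm_coe])
      (by linarith) hbP haP htP (pow_pos hp55 3) (hdivs k hk) a'
    refine this.trans (le_of_eq ?_)
    rw [← pow_mul, hPdef, ← inv_pow]
    ring
  have hQbound : ∀ k a', ‖cut s (fun _ => ContinuousLinearMap.id ℝ M2) k a'‖ ≤ 1 * ‖a'‖ :=
    norm_cut_le zero_le_one fun k _ a' => by rw [ContinuousLinearMap.id_apply, one_mul]
  have haS : S.σ a = a := std_σ_toC _
  have hbS : S.σ b = b := std_σ_toC _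
  have hsm : ∀ k, k ∉ s → ∀ L : (Fin d → ℤ) → M2 →L[ℝ] M2, ∀ a', cut s L k a' = 0 :=
    fun k hk L a' => by rw [cut_of_notMem hk, zero_apply]
  have hPpow : ∀ m n : ℕ, P ^ m * p ^ (m + n) = p ^ n := inv_pow_mul_pow hp.ne'
  obtain ⟨x', hx', y, hy, h, hh, hx'n, hx'x, hyn, hhn, hcoefh, hytr, hhtr, heq⟩ :=
    S.exists_reduction (W := W) α (u := b) (v := a) hab hbS haS (C := P ^ 170) (C' := P ^ 172)
      (ε := ε) (one_le_pow₀ hP1) hKbound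
      (by
        calc _ ≤ P * P * P ^ 170 := by gcongr
          _ = _ := by ring)
      (pow_le_pow_right₀ hP1 (by norm_num)) hQbound
      (fun k a' => by
        by_cases hk : k ∈ s
        · rw [cut_of_mem hk, ContinuousLinearMap.id_apply, sub_self, norm_zero]; positivity
        · rw [hsm k hk, sub_zero, one_mul])
      (fun k a' => by
        by_cases hk : k ∈ s
        · have h3 := pow_pos hp55 3 |>.trans_le (hdivs k hk)
          rw [norm_pos_iff, mul_ne_zero_iff] at h3
          have := adInv_spec (w := starRingEnd ℂ (chi 1 α k : ℂ)) hbb haa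
            ((map_ne_zero _).2 (hchi0 k)) h3.1 h3.2 a'
          rw [hwi] at this
          rw [cut_of_mem hk, cut_of_mem hk, this, ContinuousLinearMap.id_apply]
        · simp only [hsm k hk, zero_mul, mul_zero, smul_zero, sub_zero])
      (σ_cut S hsneg fun k _ a' => by
        rw [std_adInv hbS haS (by rw [ht, Complex.conj_ofReal]), ← chi_neg])
      (σ_cut S hsneg fun k _ a' => rfl)
      (fun k => by
        by_cases hk : k ∈ s
        · refine Or.inr ⟨fun a' => ?_, hchi1 k hk⟩
          rw [cut_of_mem hk, ContinuousLinearMap.id_apply, sub_self, M2.tr_zero]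
        · exact Or.inl fun a' => by rw [hsm k hk, M2.tr_zero])
      hxS hxtr hxε
      (by
        have h1 : 300 * (P ^ 172) ^ 2 * ε = 300 * p ^ 756 := by
          rw [hε, ← hPpow 344 756]; ring
        have h2 := pow_le_of_le hp hp6 (m := 0) (n := 756) (by norm_num)
        rw [pow_zero] at h2
        linarith)
  have hsmall : ∀ m n : ℕ, m < n → 1000000 * p ^ n ≤ p ^ m := fun m n => pow_le_of_le hp hp6
  have hε6 : 1000000 * ε ≤ 1 := by
    have := hsmall 0 1100 (by norm_num)
    rwa [pow_zero, ← hε] at this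
  have hx'ε : ‖x'‖ ≤ 1.1 * ε := by
    have h1 : 600 * (P ^ 172) ^ 2 * ε ^ 2 = 600 * p ^ 756 * ε := by
      rw [hε, ← hPpow 344 756]; ring
    have h2 := hsmall 0 756 (by norm_num)
    rw [pow_zero] at h2
    have h3 : 600 * p ^ 756 * ε ≤ 0.1 * ε := by gcongr; linarith
    have := norm_le_norm_add_norm_sub' x' x
    linarith
  have hyp : ‖y‖ ≤ 4 * p ^ 930 := by
    refine hyn.trans ?_
    calc _ ≤ P ^ 170 * (4 * ε) := by gcongr
      _ = 4 * (P ^ 170 * p ^ (170 + 930)) := by rw [hε]; ring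
      _ = _ := by rw [hPpow]
  have h930 : 1000000 * p ^ 930 ≤ p ^ 550 := hsmall _ _ (by norm_num)
  have h550 : 1000000 * p ^ 550 ≤ 1 := by simpa using hsmall 0 550 (by norm_num)
  -- the remainder
  have hincl : ∀ k, W'.w k ≤ W.w k := fun k => by
    refine Real.exp_le_exp.2 (mul_le_mul_of_nonneg_right hrr.le (Real.rpow_nonneg
      (mul_nonneg (by positivity) (l1_nonneg k)) _))
  set incl : Wiener W M2 →L[ℝ] Wiener W' M2 := push id (fun _ => ContinuousLinearMap.id ℝ M2) 1
    (fun k a' => by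
      rw [id, one_mul]; exact mul_le_mul_of_nonneg_right (hincl k) (norm_nonneg _)) with hinclD
  have hcincl : ∀ k z, coef k (incl z) = coef k z := fun k z =>
    coef_push id Function.injective_id _ _ k z
  have heincl : ∀ θ z, eval (chi 1 θ) (incl z) = eval (chi 1 θ) z := fun θ z =>
    ext_mono (f := (eval (chi 1 θ)).comp incl) (g := eval (chi 1 θ)) (fun k a' => by
      rw [ContinuousLinearMap.comp_apply, hinclD, push_mono, eval_mono, eval_mono]; rfl) z
  have hnincl : ∀ z, ‖incl z‖ ≤ ‖z‖ := fun z => by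
    have : ‖incl z‖ ≤ 1 * ‖z‖ := norm_push_le _ _ _ z
    rwa [one_mul] at this
  set q : Set (Fin d → ℤ) := {k | k ≠ 0 ∧ N < l1 k} with hq
  set tail : Wiener W M2 →L[ℝ] Wiener W' M2 :=
    push id (cut q fun _ => ContinuousLinearMap.id ℝ M2) (ε ^ 2) (fun k a' => by
      by_cases hk : k ∈ q
      · rw [cut_of_mem hk]
        exact mul_le_mul_of_nonneg_right (htail k hk.2) (norm_nonneg _)
      · rw [cut_of_notMem hk, zero_apply, norm_zero, mul_zero]
        exact mul_nonneg (mul_nonneg (sq_nonneg _) (W.pos k).le) (norm_nonneg _)) with htailD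
  have hct : ∀ k z, coef k (tail z) = cut q (fun _ => ContinuousLinearMap.id ℝ M2) k (coef k z) :=
    fun k z => coef_push id Function.injective_id _ _ k z
  set h0 := coef 0 h with hh0
  have h0s : (0 : Fin d → ℤ) ∉ s := fun h => by simpa [hs, l1_zero] using h.1
  have hdecomp : incl h - const h0 = tail x' := by
    refine ext_coef fun k => ?_
    rw [← coefL_apply, map_sub, coefL_apply, coefL_apply, hcincl, hct, const, coef_mono]
    by_cases hk0 : k = 0
    · rw [if_pos hk0, hk0, hh0, sub_self, cut_of_notMem (fun h => h.1 rfl), zero_apply]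
    · rw [if_neg hk0, sub_zero, hcoefh]
      by_cases hk : k ∈ q
      · have : k ∉ s := fun h => absurd h.2 (not_le.2 hk.2)
        rw [cut_of_mem hk, hsm k this, sub_zero, ContinuousLinearMap.id_apply]
      · have : k ∈ s := ⟨l1_pos_iff.2 hk0, not_lt.1 fun h => hk ⟨hk0, h⟩⟩
        rw [cut_of_notMem hk, cut_of_mem this, zero_apply, ContinuousLinearMap.id_apply, sub_self]
  have hh0n : ‖h0‖ ≤ 1.1 * ε := by
    have := norm_coef_le 0 h
    rw [W.zero, one_mul] at this
    linarith
  have hh0S : S.σ h0 = h0 := by rw [hh0, S.σ_coef hh, neg_zero]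
  have hh0tr : h0.tr = 0 := RealForm.tr_coef_eq_zero hhtr 0
  have hinclm : incl h ∈ S.sub W' := S.mem_sub_of_coef fun k => by
    rw [hcincl, hcincl, S.σ_coef hh, neg_neg]
  obtain ⟨z, hz, hzn, hze⟩ := S.exists_log_quotient hh0S hinclm (by linarith)
    ((hnincl h).trans (by linarith))
  rw [hdecomp] at hzn
  have hzn' : 2 * ‖z‖ ≤ ε ^ 2 := by
    have h1 : ‖tail x'‖ ≤ ε ^ 2 * ‖x'‖ := norm_push_le _ _ _ x'
    have h2 : ε ^ 2 * ‖x'‖ ≤ ε ^ 2 * (1 / 100) := by gcongr; linarith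
    linarith [sq_nonneg ε]
  have hztr : ∀ θ, (eval (chi 1 θ) z).tr = 0 := fun θ => S.tr_eq_of_exp_det hz (by
    rw [hze, M2.det_mul, M2.det_exp, M2.det_exp, heincl, hhtr, ← neg_one_smul ℂ h0, M2.tr_smul,
      hh0tr, mul_zero, Complex.exp_zero, mul_one])
  have hyS : ∀ θ, S.σ (eval (chi 1 θ) y) = eval (chi 1 θ) y := fun θ => S.σ_eval hy _
  have hB : ∀ θ, toC (reMat (NormedSpace.exp (eval (chi 1 θ) y))) =
      (NormedSpace.exp (eval (chi 1 θ) y)).toMat := fun θ => toC_reMat (σ_exp S (hyS θ))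
  have hf' : ∀ θ, toC (reMat (eval (chi 1 θ) z)) = (eval (chi 1 θ) z).toMat :=
    fun θ => toC_reMat (S.σ_eval hz _)
  have hE0 : toC (reMat (NormedSpace.exp h0)) = (NormedSpace.exp h0).toMat :=
    toC_reMat (σ_exp S hh0S)
  have hw2 := gevreyWeight_two_le (d := d) hν hν1 hr'.le hrr.le
  refine ⟨fun θ => reMat (NormedSpace.exp (eval (chi 1 θ) y)), A * reMat (NormedSpace.exp h0),
    fun θ => reMat (eval (chi 1 θ) z), ⟨?_, fun θ => det_reMat_exp (hyS θ) (hytr θ)⟩, ?_,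
    ⟨?_, fun θ => trace_reMat (hztr θ)⟩, fun θ => ?_, ?_, ?_, ?_⟩
  · refine (gevrey_of_wiener two_pos hν hν1 hr'.le (x := embed hw2 (NormedSpace.exp y))
      fun θ => ?_).1
    rw [eval_embed, eval_exp, hB]
  · rw [Matrix.det_mul, hA, one_mul, det_reMat_exp hh0S hh0tr]
  · exact (gevrey_of_wiener one_pos hν hν1 hr'.le hf').1
  · have key : A * NormedSpace.exp (f θ) * reMat (NormedSpace.exp (eval (chi 1 θ) y)) =
        reMat (NormedSpace.exp (eval (chi 1 (θ + α)) y)) *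
          (A * reMat (NormedSpace.exp h0) * NormedSpace.exp (reMat (eval (chi 1 θ) z))) := by
      refine toC_injective ?_
      simp only [toC_mul, toC_exp, hB, hf', hE0]
      have h1 : a * NormedSpace.exp (eval (chi 1 θ) x) * NormedSpace.exp (eval (chi 1 θ) y) =
          NormedSpace.exp (eval (chi 1 (θ + α)) y) *
            (a * NormedSpace.exp h0 * NormedSpace.exp (eval (chi 1 θ) z)) := by
        have h0i : NormedSpace.exp h0 * NormedSpace.exp (-h0) = 1 := by
          let := NormedAlgebra.restrictScalars ℚ ℝ M2
          rw [← NormedSpace.exp_add_of_commute (Commute.neg_right (Commute.refl h0)),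
            add_neg_cancel, NormedSpace.exp_zero]
        rw [hze, heincl, mul_assoc a, heq, mul_assoc b, ← mul_assoc a b, hab, one_mul,
          mul_assoc a, ← mul_assoc (NormedSpace.exp h0), h0i, one_mul]
        simp only [mul_assoc]
      rw [hxM] at h1
      exact h1
    rw [Matrix.mul_assoc]
    beta_reduce
    rw [key, Matrix.nonsing_inv_mul_cancel_left]
    rw [det_reMat_exp (hyS _) (hytr _)]
    exact isUnit_one
  · have h1 : A * reMat (NormedSpace.exp h0) - A = A * (reMat (NormedSpace.exp h0) - 1) := by
      rw [mul_sub, mul_one]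
    have h2 : canonNorm (reMat (NormedSpace.exp h0) - 1) ≤ 4 * ε := by
      rw [← canonNorm_toC, toC_sub, hE0, toC_one]
      refine (M2.canonNorm_le (NormedSpace.exp h0 - 1)).trans
        ((mul_le_mul_of_nonneg_left (norm_exp_sub_one_le (x := h0) (ρ := 1 / 100) (by norm_num)
          (by linarith)) two_pos.le).trans ?_)
      linarith
    rw [h1]
    refine (canonNorm_mul_le _ _).trans ?_
    calc _ ≤ canonNorm A * (4 * ε) := mul_le_mul_of_nonneg_left h2
          (zero_le_one.trans (one_le_canonNorm hA))
      _ = _ := by ring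
  · exact (gevrey_of_wiener one_pos hν hν1 hr'.le hf').2.trans hzn'
  · refine (gevrey_of_wiener two_pos hν hν1 hr'.le (x := embed hw2 (NormedSpace.exp y - 1))
      fun θ => ?_).2.trans ?_
    · rw [eval_embed, map_sub, eval_one, eval_exp, toC_sub, hB, toC_one]; rfl
    · refine (mul_le_mul_of_nonneg_left ((norm_embed_le hw2 _).trans
        ((norm_exp_sub_one_le (x := y) (ρ := 1) le_rfl (by linarith)).trans
          (mul_le_mul_of_nonneg_left hyp (by norm_num)))) two_pos.le).trans ?_
      have h3 : ε ^ (1 / 2 : ℝ) = p ^ 550 := by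
        rw [hε, ← Real.rpow_natCast, ← Real.rpow_natCast, ← Real.rpow_mul hp.le]; norm_num
      rw [h3]
      linarith [pow_pos hp 550]

namespace M2

section Cayley

/-- The matrix conjugating `SL(2,ℝ)` to `SU(1,1)`. -/
def cay : M2 := ofMat Mmat

/-- The inverse of `cay`. -/
def cayInv : M2 := ofMat Mmat⁻¹

lemma cayley_const_mul : (1 / (1 + Complex.I)) * (1 / (1 + Complex.I)) = -(Complex.I / 2) := by
  have h : (1 + Complex.I) ≠ 0 := fun h => by simpa using congrArg Complex.re h
  field_simp
  linear_combination (2 + Complex.I) * Complex.I_sq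

lemma Mmat_inv : Mmat⁻¹ = (1 / (1 + Complex.I)) • !![Complex.I, Complex.I; -1, 1] := by
  refine Matrix.inv_eq_right_inv ?_
  rw [Mmat, Matrix.smul_mul, Matrix.mul_smul, smul_smul, cayley_const_mul]
  ext i j
  fin_cases i <;> fin_cases j <;> simp <;>
    linear_combination (-1 : ℂ) * Complex.I_sq

lemma cay_eq : cay = (1 / (1 + Complex.I)) • of 1 (-Complex.I) 1 Complex.I := rfl

lemma cayInv_eq : cayInv = (1 / (1 + Complex.I)) • of Complex.I Complex.I (-1) 1 := by
  rw [cayInv, Mmat_inv]; rfl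

lemma cay_mul_cayInv : cay * cayInv = 1 := by
  rw [cay_eq, cayInv_eq, smul_mul_smul_comm, cayley_const_mul]
  refine ext' ?_ ?_ ?_ ?_ <;> simp [toMat_mul] <;> linear_combination (-1 : ℂ) * Complex.I_sq

lemma cayInv_mul_cay : cayInv * cay = 1 := by
  have : cayInv.toMat * cay.toMat = 1 := mul_eq_one_comm.1 cay_mul_cayInv
  exact this

lemma norm_cayley_const : ‖(1 / (1 + Complex.I) : ℂ)‖ ≤ 3 / 4 := by
  have h : ‖(1 / (1 + Complex.I) : ℂ)‖ * ‖(1 / (1 + Complex.I) : ℂ)‖ = 1 / 2 := by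
    rw [← norm_mul, cayley_const_mul]; simp
  nlinarith [norm_nonneg (1 / (1 + Complex.I) : ℂ)]

lemma norm_cay_le : ‖cay‖ ≤ 3 / 2 := by
  rw [cay_eq, norm_smul]
  have h : ‖of 1 (-Complex.I) 1 Complex.I‖ ≤ 2 := norm_le (by simp; norm_num) (by simp; norm_num)
  calc _ ≤ (3 / 4 : ℝ) * 2 := mul_le_mul norm_cayley_const h (norm_nonneg _) (by norm_num)
    _ = _ := by norm_num

lemma norm_cayInv_le : ‖cayInv‖ ≤ 3 / 2 := by
  rw [cayInv_eq, norm_smul]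
  have h : ‖of Complex.I Complex.I (-1) 1‖ ≤ 2 := norm_le (by simp; norm_num) (by simp; norm_num)
  calc _ ≤ (3 / 4 : ℝ) * 2 := mul_le_mul norm_cayley_const h (norm_nonneg _) (by norm_num)
    _ = _ := by norm_num

lemma cay_conj (a : M2) : cay * (a * cayInv) = of
    ((a.toMat 0 0 + a.toMat 1 1 + Complex.I * (a.toMat 0 1 - a.toMat 1 0)) / 2)
    ((a.toMat 0 0 - a.toMat 1 1 - Complex.I * (a.toMat 0 1 + a.toMat 1 0)) / 2)
    ((a.toMat 0 0 - a.toMat 1 1 + Complex.I * (a.toMat 0 1 + a.toMat 1 0)) / 2)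
    ((a.toMat 0 0 + a.toMat 1 1 - Complex.I * (a.toMat 0 1 - a.toMat 1 0)) / 2) := by
  rw [cay_eq, cayInv_eq, smul_mul_assoc, mul_smul_comm, mul_smul_comm, smul_smul, cayley_const_mul]
  refine ext' ?_ ?_ ?_ ?_ <;> simp [toMat_mul] <;> ring_nf <;> simp [Complex.I_sq] <;> ring

lemma cayInv_conj (b : M2) : cayInv * (b * cay) = of
    ((b.toMat 0 0 + b.toMat 0 1 + b.toMat 1 0 + b.toMat 1 1) / 2)
    (-Complex.I * (b.toMat 0 0 - b.toMat 0 1 + b.toMat 1 0 - b.toMat 1 1) / 2)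
    (Complex.I * (b.toMat 0 0 + b.toMat 0 1 - b.toMat 1 0 - b.toMat 1 1) / 2)
    ((b.toMat 0 0 - b.toMat 0 1 - b.toMat 1 0 + b.toMat 1 1) / 2) := by
  rw [cay_eq, cayInv_eq, smul_mul_assoc, mul_smul_comm, mul_smul_comm, smul_smul, cayley_const_mul]
  refine ext' ?_ ?_ ?_ ?_ <;> simp [toMat_mul] <;> ring_nf <;> simp [Complex.I_sq] <;> ring

lemma su_cay_conj (a : M2) :
    RealForm.su.σ (cay * (a * cayInv)) = cay * (RealForm.std.σ a * cayInv) := by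
  rw [cay_conj, cay_conj, RealForm.su_apply, RealForm.std_apply]
  refine ext' ?_ ?_ ?_ ?_ <;> simp [map_ofNat] <;> ring

lemma std_cayInv_conj (b : M2) :
    RealForm.std.σ (cayInv * (b * cay)) = cayInv * (RealForm.su.σ b * cay) := by
  rw [cayInv_conj, cayInv_conj, RealForm.su_apply, RealForm.std_apply]
  refine ext' ?_ ?_ ?_ ?_ <;> simp [map_ofNat] <;> ring

end Cayley

section Diagonal

/-- The diagonal matrix `diag(e^{2πiφ}, e^{-2πiφ})`. -/
def dg (φ : ℝ) : M2 := of (Complex.exp (2 * Real.pi * φ * Complex.I)) 0 0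
  (Complex.exp (-(2 * Real.pi * φ * Complex.I)))

lemma dg_add (φ ψ : ℝ) : dg (φ + ψ) = dg φ * dg ψ := by
  refine ext' ?_ ?_ ?_ ?_ <;> simp [dg, toMat_mul, ← Complex.exp_add] <;> ring_nf

lemma dg_zero : dg 0 = 1 := by refine ext' ?_ ?_ ?_ ?_ <;> simp [dg]

lemma dg_mul_neg (φ : ℝ) : dg φ * dg (-φ) = 1 := by rw [← dg_add, add_neg_cancel, dg_zero]

lemma norm_exp_two_pi (φ : ℝ) : ‖Complex.exp (2 * Real.pi * φ * Complex.I)‖ = 1 := by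
  rw [show (2 * Real.pi * φ * Complex.I : ℂ) = ((2 * Real.pi * φ : ℝ) : ℂ) * Complex.I by
    push_cast; rfl, Complex.norm_exp_ofReal_mul_I]

lemma norm_dg_le (φ : ℝ) : ‖dg φ‖ ≤ 1 := by
  refine norm_le ?_ ?_
  · simp [dg, norm_exp_two_pi]
  · have := norm_exp_two_pi (-φ)
    simp only [Complex.ofReal_neg, mul_neg, neg_mul] at this
    simp [dg, this]

lemma su_dg (φ : ℝ) : RealForm.su.σ (dg φ) = dg φ := by
  rw [RealForm.su_apply]
  refine ext' ?_ ?_ ?_ ?_ <;> simp [dg, ← Complex.exp_conj, map_ofNat]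

lemma det_dg (φ : ℝ) : (dg φ).det = 1 := by
  rw [det, Matrix.det_fin_two]
  simp [dg, ← Complex.exp_add]

lemma norm_dg_sub_one_le (φ : ℝ) : ‖dg φ - 1‖ ≤ 2 * Real.pi * |φ| := by
  have h : ∀ φ : ℝ, ‖Complex.exp (2 * Real.pi * φ * Complex.I) - 1‖ ≤ 2 * Real.pi * |φ| := by
    intro φ
    have := Real.norm_exp_I_mul_ofReal_sub_one_le (x := 2 * Real.pi * φ)
    rw [show (2 * Real.pi * φ * Complex.I : ℂ) = Complex.I * ((2 * Real.pi * φ : ℝ) : ℂ) by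
      push_cast; ring]
    refine this.trans (le_of_eq ?_)
    rw [Real.norm_eq_abs, abs_mul, abs_of_pos Real.two_pi_pos]
  refine norm_le ?_ ?_
  · simpa [dg] using h φ
  · have := h (-φ)
    simp only [Complex.ofReal_neg, mul_neg, neg_mul, abs_neg] at this
    simpa [dg] using this

lemma dg_half_int (j : ℤ) : dg (j / 2) = ((-1 : ℝ) ^ j) • 1 := by
  have h : ∀ j : ℤ, Complex.exp (2 * Real.pi * ((j / 2 : ℝ) : ℂ) * Complex.I) = (-1) ^ j := by
    intro j
    rw [← Complex.exp_pi_mul_I, ← Complex.exp_int_mul]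
    congr 1; push_cast; ring
  have h' := h (-j)
  rw [zpow_neg, ← inv_zpow, inv_neg, inv_one] at h'
  have e : -(2 * Real.pi * ((j / 2 : ℝ) : ℂ) * Complex.I) =
      2 * Real.pi * (((-j : ℤ) / 2 : ℝ) : ℂ) * Complex.I := by push_cast; ring
  refine ext' ?_ ?_ ?_ ?_
  · simpa [dg] using h j
  · simp [dg]
  · simp [dg]
  · simp only [dg, of_11, e, h']; simp

lemma toC_rot (φ : ℝ) : ofMat (toC (rot φ)) = cayInv * (dg φ * cay) := by
  rw [cayInv_conj]
  have hc : ((Real.cos (2 * Real.pi * φ) : ℝ) : ℂ) = (Complex.exp (2 * Real.pi * φ * Complex.I) +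
      Complex.exp (-(2 * Real.pi * φ * Complex.I))) / 2 := by
    rw [Complex.ofReal_cos, Complex.cos]; push_cast; ring_nf
  have hs : ((Real.sin (2 * Real.pi * φ) : ℝ) : ℂ) =
      (Complex.exp (-(2 * Real.pi * φ * Complex.I)) -
      Complex.exp (2 * Real.pi * φ * Complex.I)) * Complex.I / 2 := by
    rw [Complex.ofReal_sin, Complex.sin]; push_cast; ring_nf
  refine ext' ?_ ?_ ?_ ?_
  · simp only [toMat_ofMat, toC_apply, rot, of_00, dg]
    simp only [Matrix.of_apply, Matrix.cons_val', Matrix.cons_val_zero, of_01, of_10, of_11, hc]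
    ring
  · simp only [toMat_ofMat, toC_apply, rot, of_00, dg]
    simp only [Matrix.of_apply, Matrix.cons_val', Matrix.cons_val_zero, Matrix.cons_val_one,
      of_01, of_10, of_11, Matrix.cons_val_fin_one, hs]
    ring
  · simp only [toMat_ofMat, toC_apply, rot, of_00, dg]
    simp only [Matrix.of_apply, Matrix.cons_val', Matrix.cons_val_zero, Matrix.cons_val_one,
      of_01, of_10, of_11, Matrix.cons_val_fin_one, Complex.ofReal_neg, hs]
    ring
  · simp only [toMat_ofMat, toC_apply, rot, of_00, dg]
    simp only [Matrix.of_apply, Matrix.cons_val', Matrix.cons_val_one,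
      of_01, of_10, of_11, Matrix.cons_val_fin_one, hc]
    ring

end Diagonal

section OffDiagonal

/-- The lower triangular matrices. -/
def lower : Subalgebra ℝ M2 where
  carrier := {x | x.toMat 0 1 = 0}
  mul_mem' {x y} hx hy := by
    simp only [Set.mem_ofPred_eq] at *
    rw [toMat_mul, hx, hy, mul_zero, zero_mul, add_zero]
  add_mem' {x y} hx hy := by
    simp only [Set.mem_ofPred_eq] at *
    rw [toMat_add, hx, hy, add_zero]
  algebraMap_mem' r := by
    simp [Algebra.algebraMap_eq_smul_one]

lemma isClosed_lower : IsClosed (lower : Set M2) :=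
  isClosed_eq (entryL 0 1).continuous continuous_const

/-- The lower triangular part. -/
def lowerPart (a : M2) : M2 := of (a.toMat 0 0) 0 (a.toMat 1 0) (a.toMat 1 1)

lemma norm_lowerPart_le (a : M2) : ‖lowerPart a‖ ≤ ‖a‖ := by
  refine norm_le ?_ (row_le a 1)
  simp only [lowerPart, of_00, of_01, norm_zero, add_zero]
  exact entry_le a 0 0

lemma norm_sub_lowerPart (a : M2) : ‖a - lowerPart a‖ ≤ ‖a.toMat 0 1‖ := by
  refine norm_le ?_ ?_ <;> simp [lowerPart]

lemma expRem_entry_le {a : M2} {ρ : ℝ} (hρ : ρ ≤ 1) (ha : ‖a‖ ≤ ρ) :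
    ‖(expRem a).toMat 0 1‖ ≤ 2 * ρ * ‖a.toMat 0 1‖ := by
  have h0 : 0 ≤ ρ := (norm_nonneg a).trans ha
  have h1 : (expRem (lowerPart a)).toMat 0 1 = 0 := by
    have h2 := exp_mem_of_isClosed lower isClosed_lower (x := lowerPart a) rfl
    have h3 : (expRem (lowerPart a)) ∈ lower := by
      rw [show expRem (lowerPart a) = NormedSpace.exp (lowerPart a) - 1 - lowerPart a by
        rw [exp_eq_expRem]; abel]
      exact sub_mem (sub_mem h2 (one_mem _)) rfl
    exact h3
  have h4 := norm_expRem_sub_le hρ ha ((norm_lowerPart_le a).trans ha)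
  have h5 := entry_le (expRem a - expRem (lowerPart a)) 0 1
  rw [toMat_sub, h1, sub_zero] at h5
  refine h5.trans (h4.trans ?_)
  gcongr
  exact norm_sub_lowerPart a

end OffDiagonal

end M2

namespace RealForm

variable (S : RealForm)

/-- The real matrices. -/
def fixed : Subalgebra ℝ M2 where
  carrier := {x | S.σ x = x}
  mul_mem' {x y} hx hy := by
    simp only [Set.mem_ofPred_eq] at *
    rw [S.mul_eq, hx, hy]
  add_mem' {x y} hx hy := by
    simp only [Set.mem_ofPred_eq] at *
    rw [map_add, hx, hy]
  algebraMap_mem' r := by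
    simp only [Set.mem_ofPred_eq]
    rw [Algebra.algebraMap_eq_smul_one, map_smul, S.one_eq]

lemma isClosed_fixed : IsClosed (S.fixed : Set M2) := isClosed_eq S.σ.continuous continuous_id

lemma tr_eq_zero_of_det_exp {a : M2} (ha : S.σ a = a) (h : (NormedSpace.exp a).det = 1) :
    a.tr = 0 := by
  have h1 := S.tr_eq a
  rw [ha] at h1
  have h2 : (a.tr.re : ℂ) = a.tr := Complex.conj_eq_iff_re.1 h1.symm
  rw [M2.det_exp, ← h2, ← Complex.ofReal_exp] at h
  have h3 : Real.exp a.tr.re = 1 := by exact_mod_cast h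
  rw [← h2, Real.exp_eq_one_iff _ |>.1 h3, Complex.ofReal_zero]

end RealForm

namespace M2

/-- The entrywise product with a given matrix. -/
def had (c : M2) : M2 →L[ℝ] M2 :=
  LinearMap.mkContinuous
    ⟨⟨fun a => of (c.toMat 0 0 * a.toMat 0 0) (c.toMat 0 1 * a.toMat 0 1)
      (c.toMat 1 0 * a.toMat 1 0) (c.toMat 1 1 * a.toMat 1 1),
      fun a b => ext' (by simp [mul_add]) (by simp [mul_add]) (by simp [mul_add])
        (by simp [mul_add])⟩,
      fun r a => ext' (by simp [mul_left_comm]) (by simp [mul_left_comm]) (by simp [mul_left_comm])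
        (by simp [mul_left_comm])⟩ ‖c‖ fun a => by
        have h := fun i j => mul_le_mul_of_nonneg_right (entry_le c i j)
          (norm_nonneg (a.toMat i j))
        refine norm_le ?_ ?_
        · simp only [LinearMap.coe_mk, AddHom.coe_mk, of_00, of_01, norm_mul]
          nlinarith [h 0 0, h 0 1, row_le a 0, norm_nonneg c]
        · simp only [LinearMap.coe_mk, AddHom.coe_mk, of_10, of_11, norm_mul]
          nlinarith [h 1 0, h 1 1, row_le a 1, norm_nonneg c]

@[simp] lemma had_apply (c a : M2) (i j : Fin 2) :
    (had c a).toMat i j = c.toMat i j * a.toMat i j := by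
  fin_cases i <;> fin_cases j <;> rfl

lemma norm_had_le {c : M2} {C : ℝ} (h : ∀ i j, ‖c.toMat i j‖ ≤ C) (a : M2) :
    ‖had c a‖ ≤ C * ‖a‖ := by
  have h' := fun i j => mul_le_mul_of_nonneg_right (h i j) (norm_nonneg (a.toMat i j))
  have hC : 0 ≤ C := (norm_nonneg _).trans (h 0 0)
  refine norm_le ?_ ?_ <;> simp only [had_apply, norm_mul]
  · nlinarith [h' 0 0, h' 0 1, row_le a 0]
  · nlinarith [h' 1 0, h' 1 1, row_le a 1]

lemma su_had {c c' : M2} (h : RealForm.su.σ c = c') (a : M2) :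
    RealForm.su.σ (had c a) = had c' (RealForm.su.σ a) := by
  rw [← h, RealForm.su_apply, RealForm.su_apply, RealForm.su_apply]
  refine ext' ?_ ?_ ?_ ?_ <;> simp

/-- The matrix with entries `g i j`. -/
def mk (g : Fin 2 → Fin 2 → ℂ) : M2 := ofMat (Matrix.of g)

@[simp] lemma mk_apply (g : Fin 2 → Fin 2 → ℂ) (i j : Fin 2) : (mk g).toMat i j = g i j := rfl

end M2

/-- The weight `j - i` of the `(i,j)` entry under conjugation by diagonal matrices. -/
def entryWt (i j : Fin 2) : ℤ := (j.val : ℤ) - (i.val : ℤ)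

lemma entryWt_cases (i j : Fin 2) : entryWt i j = 0 ∨ entryWt i j = 1 ∨ entryWt i j = -1 := by
  fin_cases i <;> fin_cases j <;> simp [entryWt]

namespace Wiener

variable {d : ℕ} {ω ω' : Weight (Fin d → ℤ)}

/-- The matrix unit at `(i, j)`, as a Hadamard multiplier. -/
def unitAt (i j : Fin 2) : M2 →L[ℝ] M2 :=
  M2.had (M2.mk fun k l => if k = i ∧ l = j then 1 else 0)

lemma norm_unitAt_le (i j : Fin 2) (a : M2) : ‖unitAt i j a‖ ≤ 1 * ‖a‖ :=
  M2.norm_had_le (fun k l => by rw [M2.mk_apply]; split_ifs <;> simp) a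

/-- The shift of the `(i,j)` entry by `(j - i) n`, after restriction to a set of modes. -/
def shear (n : Fin d → ℤ) (q : Set (Fin d → ℤ)) (C : ℝ)
    (h : ∀ i j, ∀ k ∈ q, ω'.w (k - entryWt i j • n) ≤ C * ω.w k) (hC : 0 ≤ C) :
    Wiener ω M2 →L[ℝ] Wiener ω' M2 :=
  ∑ i, ∑ j, push (fun k => k - entryWt i j • n) (cut q fun _ => unitAt i j) C fun k a => by
    by_cases hk : k ∈ q
    · rw [cut_of_mem hk]
      have h1 := norm_unitAt_le i j a
      rw [one_mul] at h1
      exact mul_le_mul (h i j k hk) h1 (norm_nonneg _) (mul_nonneg hC (ω.pos k).le)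
    · rw [cut_of_notMem hk, zero_apply, norm_zero, mul_zero]
      exact mul_nonneg (mul_nonneg hC (ω.pos k).le) (norm_nonneg _)

variable {n : Fin d → ℤ} {q : Set (Fin d → ℤ)} {C : ℝ}
  (h : ∀ i j, ∀ k ∈ q, ω'.w (k - entryWt i j • n) ≤ C * ω.w k) (hC : 0 ≤ C)

lemma norm_shear_le (x : Wiener ω M2) : ‖shear n q C h hC x‖ ≤ 4 * C * ‖x‖ := by
  rw [shear]
  simp only [Fin.sum_univ_two, add_apply]
  refine (norm_add_le _ _).trans ?_
  refine (add_le_add ((norm_add_le _ _).trans (add_le_add (norm_push_le _ _ _ x)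
    (norm_push_le _ _ _ x))) ((norm_add_le _ _).trans (add_le_add (norm_push_le _ _ _ x)
    (norm_push_le _ _ _ x)))).trans ?_
  linarith

lemma shear_mono {k : Fin d → ℤ} (hk : k ∈ q) (a : M2) : shear n q C h hC (mono k a) =
    ∑ i, ∑ j, mono (k - entryWt i j • n) (unitAt i j a) := by
  rw [shear]
  simp only [Fin.sum_univ_two, add_apply, push_mono, cut_of_mem hk]

lemma coef_shear (k : Fin d → ℤ) (x : Wiener ω M2) (i j : Fin 2)
    [Decidable (k + entryWt i j • n ∈ q)] :
    (coef k (shear n q C h hC x)).toMat i j =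
      if k + entryWt i j • n ∈ q then (coef (k + entryWt i j • n) x).toMat i j else 0 := by
  have e : ∀ i' j', ∀ hh, coef k (push (ω := ω) (ω' := ω') (fun k => k - entryWt i' j' • n)
      (cut q fun _ => unitAt i' j') C hh x) =
      cut q (fun _ => unitAt i' j') (k + entryWt i' j' • n) (coef (k + entryWt i' j' • n) x) := by
    intro i' j' hh
    have := coef_push (ω := ω) (ω' := ω') (fun k => k - entryWt i' j' • n)
      (fun a b hab => by simpa using hab) (cut q fun _ => unitAt i' j') hh
      (k + entryWt i' j' • n) x
    simp only [add_sub_cancel_right] at this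
    exact this
  have hsum : coef k (shear n q C h hC x) = ∑ i', ∑ j', cut q (fun _ => unitAt i' j')
      (k + entryWt i' j' • n) (coef (k + entryWt i' j' • n) x) := by
    rw [shear]
    simp only [Fin.sum_univ_two, add_apply, coef_add, e]
  have hterm : ∀ i' j', (cut q (fun _ => unitAt i' j') (k + entryWt i' j' • n)
      (coef (k + entryWt i' j' • n) x)).toMat i j = if i = i' ∧ j = j' then
        (if k + entryWt i j • n ∈ q then (coef (k + entryWt i j • n) x).toMat i j else 0)
        else 0 := by
    intro i' j'
    by_cases hk : k + entryWt i' j' • n ∈ q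
    · rw [cut_of_mem hk, unitAt, M2.had_apply, M2.mk_apply]
      split_ifs with h1 h2
      · rw [h1.1, h1.2, one_mul]
      · rw [h1.1, h1.2] at h2; exact absurd hk h2
      · rw [zero_mul]
    · rw [cut_of_notMem hk, zero_apply, M2.toMat_zero]
      split_ifs with h1 h2
      · rw [h1.1, h1.2] at h2; exact absurd h2 hk
      · rfl
      · rfl
  rw [hsum]
  simp only [Fin.sum_univ_two, M2.toMat_add, hterm]
  fin_cases i <;> fin_cases j <;> simp

/-- The shear on all modes is the conjugation by `diag(e^{πi⟨n,θ⟩}, e^{-πi⟨n,θ⟩})`. -/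
lemma eval_shear (hq : q = Set.univ) (θ : Fin d → ℝ) (x : Wiener ω M2) :
    eval (chi 1 θ) (shear n q C h hC x) =
      M2.dg (-(pairing n θ / 2)) * (eval (chi 1 θ) x * M2.dg (pairing n θ / 2)) := by
  refine ext_mono (f := (eval (chi 1 θ)).comp (shear n q C h hC))
    (g := (sandwich (M2.dg (-(pairing n θ / 2))) (M2.dg (pairing n θ / 2))).comp (eval (chi 1 θ)))
    (fun k a => ?_) x
  rw [ContinuousLinearMap.comp_apply, ContinuousLinearMap.comp_apply,
    shear_mono h hC (by rw [hq]; trivial), sandwich_apply, eval_mono]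
  simp only [Fin.sum_univ_two, map_add, eval_mono]
  have e0 : entryWt 0 0 = 0 := rfl
  have e1 : entryWt 0 1 = 1 := rfl
  have e2 : entryWt 1 0 = -1 := rfl
  have e3 : entryWt 1 1 = 0 := rfl
  rw [e0, e1, e2, e3, zero_smul, sub_zero, one_smul, neg_one_smul, sub_neg_eq_add, chi_coe, chi_coe,
    chi_coe, pairing_sub, pairing_add]
  have x1 : Complex.exp (2 * Real.pi * ((pairing k θ - pairing n θ : ℝ) : ℂ) / (1 : ℝ) * Complex.I) =
      Complex.exp (2 * Real.pi * pairing k θ / (1 : ℝ) * Complex.I) *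
        (Complex.exp (-(2 * Real.pi * ((pairing n θ / 2 : ℝ) : ℂ) * Complex.I)) *
        Complex.exp (-(2 * Real.pi * ((pairing n θ / 2 : ℝ) : ℂ) * Complex.I))) := by
    rw [← Complex.exp_add, ← Complex.exp_add]; congr 1; push_cast; ring
  have x2 : Complex.exp (2 * Real.pi * ((pairing k θ + pairing n θ : ℝ) : ℂ) / (1 : ℝ) * Complex.I) =
      Complex.exp (2 * Real.pi * pairing k θ / (1 : ℝ) * Complex.I) *
        (Complex.exp (2 * Real.pi * ((pairing n θ / 2 : ℝ) : ℂ) * Complex.I) *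
        Complex.exp (2 * Real.pi * ((pairing n θ / 2 : ℝ) : ℂ) * Complex.I)) := by
    rw [← Complex.exp_add, ← Complex.exp_add]; congr 1; push_cast; ring
  have x3 : Complex.exp (2 * Real.pi * ((-(pairing n θ / 2) : ℝ) : ℂ) * Complex.I) =
      Complex.exp (-(2 * Real.pi * ((pairing n θ / 2 : ℝ) : ℂ) * Complex.I)) := by
    congr 1; push_cast; ring
  have x4 : Complex.exp (-(2 * Real.pi * ((-(pairing n θ / 2) : ℝ) : ℂ) * Complex.I)) =
      Complex.exp (2 * Real.pi * ((pairing n θ / 2 : ℝ) : ℂ) * Complex.I) := by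
    congr 1; push_cast; ring
  have x5 : Complex.exp (2 * Real.pi * ((pairing n θ / 2 : ℝ) : ℂ) * Complex.I) *
      Complex.exp (-(2 * Real.pi * ((pairing n θ / 2 : ℝ) : ℂ) * Complex.I)) = 1 := by
    rw [← Complex.exp_add, add_neg_cancel, Complex.exp_zero]
  rw [x1, x2]
  simp only [M2.dg, x3, x4]
  set E := Complex.exp (2 * Real.pi * ((pairing n θ / 2 : ℝ) : ℂ) * Complex.I)
  set F := Complex.exp (-(2 * Real.pi * ((pairing n θ / 2 : ℝ) : ℂ) * Complex.I))
  set c := Complex.exp (2 * Real.pi * pairing k θ / (1 : ℝ) * Complex.I)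
  refine M2.ext' ?_ ?_ ?_ ?_ <;> simp [M2.toMat_mul, unitAt]
  · left; linear_combination (-a.toMat 0 0) * x5
  · ring
  · ring
  · left; linear_combination (-a.toMat 1 1) * x5

end Wiener

section Multipliers

variable {d : ℕ} (α : Fin d → ℝ) (x N : ℝ) (n : Fin d → ℤ) (g : ℂ → ℂ)

/-- The divisor of the `(i,j)` entry at the mode `k`, for the cocycle
`(α, diag(e^{2πix}, e^{-2πix}))`. -/
def divisor (k : Fin d → ℤ) (i j : Fin 2) : ℂ :=
  Complex.exp (2 * Real.pi * ((pairing k α - entryWt i j * (2 * x) : ℝ) : ℂ) * Complex.I)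

open scoped Classical in
/-- The multiplier `g` evaluated at the divisors of the modes of size at most `N` different from
the resonances at `0` and `±n`. -/
def divMul (k : Fin d → ℤ) : M2 →L[ℝ] M2 :=
  M2.had (M2.mk fun i j => if k ≠ entryWt i j • n ∧ l1 k ≤ N then g (divisor α x k i j) else 0)

variable {α x N n g} {k : Fin d → ℤ} {i j : Fin 2}

lemma divMul_of (h : k ≠ entryWt i j • n ∧ l1 k ≤ N) (a : M2) :
    (divMul α x N n g k a).toMat i j = g (divisor α x k i j) * a.toMat i j := by
  rw [divMul, M2.had_apply, M2.mk_apply, if_pos h]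

lemma divMul_of_not (h : ¬(k ≠ entryWt i j • n ∧ l1 k ≤ N)) (a : M2) :
    (divMul α x N n g k a).toMat i j = 0 := by
  rw [divMul, M2.had_apply, M2.mk_apply, if_neg h, zero_mul]

lemma norm_divMul_le {C : ℝ} (hC : 0 ≤ C) (h : ∀ i j, k ≠ entryWt i j • n → l1 k ≤ N →
    ‖g (divisor α x k i j)‖ ≤ C) (a : M2) : ‖divMul α x N n g k a‖ ≤ C * ‖a‖ :=
  M2.norm_had_le (fun i j => by
    rw [M2.mk_apply]
    split_ifs with hm
    · exact h i j hm.1 hm.2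
    · simpa using hC) a

lemma norm_sub_divMul_le (a : M2) : ‖a - divMul α x N n (fun _ => 1) k a‖ ≤ 1 * ‖a‖ := by
  have e : a - divMul α x N n (fun _ => 1) k a = M2.had (M2.mk fun i j =>
      1 - (M2.mk fun i j => by
        classical exact if k ≠ entryWt i j • n ∧ l1 k ≤ N then (1 : ℂ) else 0).toMat i j) a := by
    refine M2.ext fun i j => ?_
    rw [M2.toMat_sub, divMul, M2.had_apply, M2.had_apply, M2.mk_apply, M2.mk_apply, M2.mk_apply]
    ring
  rw [e]
  refine M2.norm_had_le (fun i j => ?_) a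
  rw [M2.mk_apply, M2.mk_apply]
  split_ifs <;> simp

lemma entryWt_rev (i j : Fin 2) : entryWt i.rev j.rev = -entryWt i j := by
  fin_cases i <;> fin_cases j <;> rfl

lemma divisor_neg (k : Fin d → ℤ) (i j : Fin 2) :
    divisor α x (-k) i.rev j.rev = starRingEnd ℂ (divisor α x k i j) := by
  rw [divisor, divisor, ← Complex.exp_conj, entryWt_rev, pairing_neg]
  congr 1
  simp only [map_mul, Complex.conj_ofReal, Complex.conj_I, map_ofNat]
  push_cast; ring

lemma su_divMul (hg : ∀ w, starRingEnd ℂ (g w) = g (starRingEnd ℂ w)) (k : Fin d → ℤ) (a : M2) :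
    RealForm.su.σ (divMul α x N n g k a) = divMul α x N n g (-k) (RealForm.su.σ a) := by
  refine M2.su_had ?_ a
  have key : ∀ i j : Fin 2, starRingEnd ℂ ((M2.mk fun i j => by
      classical exact if k ≠ entryWt i j • n ∧ l1 k ≤ N then g (divisor α x k i j)
        else 0).toMat i j) = (M2.mk fun i j => by
      classical exact if -k ≠ entryWt i j • n ∧ l1 (-k) ≤ N then g (divisor α x (-k) i j)
        else 0).toMat i.rev j.rev := by
    intro i j
    rw [M2.mk_apply, M2.mk_apply, entryWt_rev, neg_smul, l1_neg, divisor_neg, ← hg]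
    have : (-k ≠ -(entryWt i j • n) ∧ l1 k ≤ N) ↔ (k ≠ entryWt i j • n ∧ l1 k ≤ N) := by
      rw [Ne, neg_inj]
    by_cases hm : k ≠ entryWt i j • n ∧ l1 k ≤ N
    · rw [if_pos hm, if_pos (this.2 hm)]
    · rw [if_neg hm, if_neg (fun h => hm (this.1 h)), map_zero]
  rw [RealForm.su_apply]
  refine M2.ext' ?_ ?_ ?_ ?_
  · exact key 1 1
  · exact key 1 0
  · exact key 0 1
  · exact key 0 0

lemma dg_conj_apply (b : M2) (i j : Fin 2) : (chi 1 α k : ℂ) *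
    (M2.dg (-x) * (b * M2.dg x)).toMat i j = divisor α x k i j * b.toMat i j := by
  have e : ∀ s : ℝ, Complex.exp (2 * Real.pi * ((pairing k α - s * (2 * x) : ℝ) : ℂ) * Complex.I) =
      chi 1 α k * Complex.exp (-(s * (2 * Real.pi * (2 * x) * Complex.I))) := by
    intro s
    rw [chi_coe, ← Complex.exp_add]; congr 1; push_cast; ring
  rw [divisor, e, mul_assoc]
  congr 1
  have e1 : Complex.exp (2 * Real.pi * ((-x : ℝ) : ℂ) * Complex.I) =
      Complex.exp (-(2 * Real.pi * x * Complex.I)) := by congr 1; push_cast; ring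
  have e2 : Complex.exp (-(2 * Real.pi * ((-x : ℝ) : ℂ) * Complex.I)) =
      Complex.exp (2 * Real.pi * x * Complex.I) := by congr 1; push_cast; ring
  have e3 : Complex.exp (2 * Real.pi * x * Complex.I) *
      Complex.exp (-(2 * Real.pi * x * Complex.I)) = 1 := by
    rw [← Complex.exp_add, add_neg_cancel, Complex.exp_zero]
  have e4 : Complex.exp (2 * Real.pi * (2 * x) * Complex.I) =
      Complex.exp (2 * Real.pi * x * Complex.I) * Complex.exp (2 * Real.pi * x * Complex.I) := by
    rw [← Complex.exp_add]; congr 1; ring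
  have e5 : Complex.exp (-(2 * Real.pi * (2 * x) * Complex.I)) =
      Complex.exp (-(2 * Real.pi * x * Complex.I)) *
        Complex.exp (-(2 * Real.pi * x * Complex.I)) := by
    rw [← Complex.exp_add]; congr 1; ring
  fin_cases i <;> fin_cases j <;> simp [M2.toMat_mul, M2.dg, entryWt, e4, e5]
  · linear_combination b.toMat 0 0 * e3
  · ring
  · ring
  · linear_combination b.toMat 1 1 * e3

lemma divMul_coh (h : ∀ i j, k ≠ entryWt i j • n → l1 k ≤ N → divisor α x k i j ≠ 1) (a : M2) :
    (chi 1 α k : ℂ) • (M2.dg (-x) * (divMul α x N n (fun w => (w - 1)⁻¹) k a * M2.dg x)) -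
      divMul α x N n (fun w => (w - 1)⁻¹) k a = divMul α x N n (fun _ => 1) k a := by
  refine M2.ext fun i j => ?_
  rw [M2.toMat_sub, M2.toMat_smul, dg_conj_apply]
  by_cases hm : k ≠ entryWt i j • n ∧ l1 k ≤ N
  · rw [divMul_of hm, divMul_of hm]
    have := sub_ne_zero.2 (h i j hm.1 hm.2)
    field_simp
  · rw [divMul_of_not hm, divMul_of_not hm, mul_zero, sub_zero]

lemma divMul_mode (h : k ≠ 0 → l1 k ≤ N → (chi 1 α k : ℂ) ≠ 1) :
    (∀ a, (divMul α x N n g k a).tr = 0) ∨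
      ((∀ a, (a - divMul α x N n (fun _ => 1) k a).tr = 0) ∧ (chi 1 α k : ℂ) ≠ 1) := by
  have h00 : entryWt 0 0 • n = 0 := zero_smul _ _
  have h11 : entryWt 1 1 • n = 0 := zero_smul _ _
  by_cases hm : k ≠ 0 ∧ l1 k ≤ N
  · refine Or.inr ⟨fun a => ?_, h hm.1 hm.2⟩
    rw [M2.tr, M2.toMat_sub, M2.toMat_sub, divMul_of (by rwa [h00]), divMul_of (by rwa [h11])]
    ring
  · refine Or.inl fun a => ?_
    rw [M2.tr, divMul_of_not (by rwa [h00]), divMul_of_not (by rwa [h11]), add_zero]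

end Multipliers

section Degree

variable {d : ℕ} {ω : Weight (Fin d → ℤ)}

lemma continuous_chi (p : ℝ) (k : Fin d → ℤ) : Continuous fun θ : Fin d → ℝ => (chi p θ k : ℂ) := by
  simp only [chi_coe]
  fun_prop

lemma Wiener.continuous_eval (p : ℝ) (x : Wiener ω M2) :
    Continuous fun θ : Fin d → ℝ => eval (chi p θ) x := by
  have h : ∀ θ : Fin d → ℝ, eval (chi p θ) x = ∑' k, (chi p θ k : ℂ) • coef k x :=
    fun θ => (eval_hasSum (chi p θ) x).tsum_eq.symm
  simp only [h]
  refine continuous_tsum (fun k => (continuous_chi p k).smul continuous_const)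
    (summable_norm_coef x) fun k θ => ?_
  rw [norm_smul, Circle.norm_coe, one_mul]

lemma pairing_int (k m : Fin d → ℤ) : pairing k (fun i => (m i : ℝ)) = ((∑ i, k i * m i : ℤ) : ℝ) := by
  rw [pairing]; push_cast; rfl

lemma pairing_add_two (k m : Fin d → ℤ) (θ : Fin d → ℝ) :
    pairing k (fun i => θ i + 2 * (m i : ℝ)) = pairing k θ + 2 * ((∑ i, k i * m i : ℤ) : ℝ) := by
  rw [← pairing_int, ← pairing_smul, ← pairing_add_right]
  rfl

lemma chi_periodic (m : Fin d → ℤ) (θ : Fin d → ℝ) :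
    chi 1 (fun i => θ i + 2 * (m i : ℝ)) = chi 1 θ := by
  ext k
  rw [chi_coe, chi_coe, pairing_add_two]
  have := Complex.exp_periodic.int_mul (2 * ∑ i, k i * m i)
    (2 * Real.pi * pairing k θ / (1 : ℝ) * Complex.I)
  rw [← this]
  congr 1; push_cast; ring

lemma rot_add_int (φ : ℝ) (j : ℤ) : rot (φ + j) = rot φ := by
  have h : 2 * Real.pi * (φ + j) = 2 * Real.pi * φ + j * (2 * Real.pi) := by ring
  rw [rot, rot, h, Real.cos_add_int_mul_two_pi, Real.sin_add_int_mul_two_pi]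

lemma continuous_rot : Continuous rot := by
  unfold rot
  refine continuous_matrix fun i j => ?_
  fin_cases i <;> fin_cases j <;> simp <;> fun_prop

lemma det_rot (φ : ℝ) : (rot φ).det = 1 := by
  rw [rot, Matrix.det_fin_two_of]
  nlinarith [Real.sin_sq_add_cos_sq (2 * Real.pi * φ)]

lemma continuous_reMat : Continuous reMat := by
  refine continuous_matrix fun i j => ?_
  exact Complex.continuous_re.comp (M2.entryL i j).continuous

/-- The lower triangular matrices of positive diagonal and determinant one. -/
def triMat (l c : ℝ) : RMat := !![Real.exp l, 0; c, Real.exp (-l)]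

lemma det_triMat (l c : ℝ) : (triMat l c).det = 1 := by
  rw [triMat, Matrix.det_fin_two_of, ← Real.exp_add, add_neg_cancel, Real.exp_zero]; ring

lemma triMat_zero : triMat 0 0 = 1 := by
  ext i j; fin_cases i <;> fin_cases j <;> simp [triMat]

lemma std_exp_conj {Y : M2} (hY : RealForm.su.σ Y = Y) :
    RealForm.std.σ (M2.cayInv * (NormedSpace.exp Y * M2.cay)) =
      M2.cayInv * (NormedSpace.exp Y * M2.cay) := by
  rw [M2.std_cayInv_conj, σ_exp _ hY]

lemma det_reMat {x : M2} (hx : RealForm.std.σ x = x) (h : x.det = 1) : (reMat x).det = 1 := by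
  have : ((reMat x).det : ℂ) = 1 := by
    rw [← det_toC, toC_reMat hx]; exact h
  exact_mod_cast this

lemma det_conj {u v : M2} (h : u * v = 1) (x : M2) : (u * (x * v)).det = x.det := by
  have h1 : u.det * v.det = 1 := by
    rw [← M2.det_mul, h]; exact Matrix.det_one
  rw [M2.det_mul, M2.det_mul]
  linear_combination x.det * h1

lemma det_conj_exp {Y : M2} (hY : RealForm.su.σ Y = Y) (htr : Y.tr = 0) :
    (reMat (M2.cayInv * (NormedSpace.exp Y * M2.cay))).det = 1 := by
  refine det_reMat (std_exp_conj hY) ?_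
  rw [det_conj M2.cayInv_mul_cay, M2.det_exp, htr, Complex.exp_zero]

/-- The conjugation which removes a resonance at `n`. -/
def resConj (l c : ℝ) (y : Wiener ω M2) (n : Fin d → ℤ) (θ : Fin d → ℝ) : RMat :=
  triMat l c * reMat (M2.cayInv * (NormedSpace.exp (eval (chi 1 θ) y) * M2.cay)) *
    rot (pairing n θ / 2)

variable {l c : ℝ} {y : Wiener ω M2} {n : Fin d → ℤ}

lemma det_resConj (hy : y ∈ RealForm.su.sub ω) (htr : ∀ θ, (eval (chi 1 θ) y).tr = 0)
    (θ : Fin d → ℝ) : (resConj l c y n θ).det = 1 := by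
  rw [resConj, Matrix.det_mul, Matrix.det_mul, det_triMat, det_rot,
    det_conj_exp (RealForm.su.σ_eval hy _) (htr θ), mul_one, mul_one]

lemma hasDegree_resConj (hy : y ∈ RealForm.su.sub ω) (htr : ∀ θ, (eval (chi 1 θ) y).tr = 0) :
    HasDegree (resConj l c y n) n := by
  set K : unitInterval × (Fin d → ℝ) → RMat := fun p =>
    triMat ((1 - p.1) * l) ((1 - p.1) * c) * reMat (M2.cayInv *
      (NormedSpace.exp ((1 - (p.1 : ℝ)) • eval (chi 1 p.2) y) * M2.cay)) *
      rot (pairing n p.2 / 2) with hK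
  refine ⟨K, ?_, fun s θ => ?_, fun s θ m => ?_, fun θ => ?_, fun θ => ?_⟩
  · have h1 : Continuous fun p : unitInterval × (Fin d → ℝ) =>
        triMat ((1 - (p.1 : ℝ)) * l) ((1 - (p.1 : ℝ)) * c) := by
      unfold triMat
      refine continuous_matrix fun i j => ?_
      fin_cases i <;> fin_cases j <;> simp <;> fun_prop
    have h2 : Continuous fun p : unitInterval × (Fin d → ℝ) =>
        (1 - (p.1 : ℝ)) • eval (chi 1 p.2) y :=
      (by fun_prop : Continuous fun p : unitInterval × (Fin d → ℝ) => 1 - (p.1 : ℝ)).smul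
        ((continuous_eval 1 y).comp continuous_snd)
    have h3 : Continuous (NormedSpace.exp : M2 → M2) := by
      let := NormedAlgebra.restrictScalars ℚ ℝ M2
      exact NormedSpace.exp_continuous
    have h4 : Continuous fun p : unitInterval × (Fin d → ℝ) => reMat (M2.cayInv *
        (NormedSpace.exp ((1 - (p.1 : ℝ)) • eval (chi 1 p.2) y) * M2.cay)) :=
      continuous_reMat.comp (continuous_const.mul ((h3.comp h2).mul continuous_const))
    have h5 : Continuous fun p : unitInterval × (Fin d → ℝ) => rot (pairing n p.2 / 2) :=
      continuous_rot.comp (((continuous_pairing n).comp continuous_snd).div_const 2)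
    exact (h1.matrix_mul h4).matrix_mul h5
  · have h1 : RealForm.su.σ ((1 - (s : ℝ)) • eval (chi 1 θ) y) = (1 - (s : ℝ)) • eval (chi 1 θ) y := by
      rw [map_smul, RealForm.su.σ_eval hy]
    have h2 : ((1 - (s : ℝ)) • eval (chi 1 θ) y).tr = 0 := by
      have := M2.trL.map_smul (1 - (s : ℝ)) (eval (chi 1 θ) y)
      rw [M2.trL_apply, M2.trL_apply, htr, smul_zero] at this
      exact this
    simp only [hK]
    rw [Matrix.det_mul, Matrix.det_mul, det_triMat, det_rot, det_conj_exp h1 h2, mul_one, mul_one]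
  · simp only [hK]
    rw [chi_periodic, pairing_add_two, add_div, mul_div_cancel_left₀ _ (two_ne_zero), rot_add_int]
  · simp only [hK, resConj, Set.Icc.coe_zero, sub_zero, one_mul, one_smul]
  · simp only [hK, Set.Icc.coe_one, sub_self, zero_mul, zero_smul, NormedSpace.exp_zero,
      triMat_zero, one_mul, M2.cayInv_mul_cay]
    have : reMat 1 = 1 := by
      refine toC_injective ?_
      rw [toC_reMat RealForm.std.one_eq, toC_one]; rfl
    rw [this, one_mul]

end Degree

section ResConjNorm

variable {d : ℕ} {ν r r'' : ℝ}

/-- The diagonal matrices `diag(e^{πi⟨n,θ⟩}, e^{-πi⟨n,θ⟩})`, on the double cover. -/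
def halfTwist (ω : Weight (Fin d → ℤ)) (n : Fin d → ℤ) : Wiener ω M2 :=
  mono n (M2.of 1 0 0 0) + mono (-n) (M2.of 0 0 0 1)

lemma eval_halfTwist (ω : Weight (Fin d → ℤ)) (n : Fin d → ℤ) (θ : Fin d → ℝ) :
    eval (chi 2 θ) (halfTwist ω n) = M2.dg (pairing n θ / 2) := by
  rw [halfTwist, map_add, eval_mono, eval_mono, chi_coe, chi_coe, pairing_neg]
  have e1 : (2 * Real.pi * (pairing n θ : ℂ) / ((2 : ℝ) : ℂ) * Complex.I) =
      2 * Real.pi * ((pairing n θ / 2 : ℝ) : ℂ) * Complex.I := by push_cast; ring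
  have e2 : (2 * Real.pi * ((-pairing n θ : ℝ) : ℂ) / ((2 : ℝ) : ℂ) * Complex.I) =
      -(2 * Real.pi * ((pairing n θ / 2 : ℝ) : ℂ) * Complex.I) := by push_cast; ring
  rw [e1, e2]
  refine M2.ext' ?_ ?_ ?_ ?_ <;> simp [M2.dg]

lemma norm_halfTwist_le (ω : Weight (Fin d → ℤ)) (n : Fin d → ℤ) :
    ‖halfTwist ω n‖ ≤ 2 * ω.w n := by
  have h1 : ‖M2.of 1 0 0 0‖ ≤ 1 := M2.norm_le (by simp) (by simp)
  have h2 : ‖M2.of 0 0 0 1‖ ≤ 1 := M2.norm_le (by simp) (by simp)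
  refine (norm_add_le _ _).trans ?_
  rw [norm_mono, norm_mono, ω.neg_eq]
  nlinarith [ω.pos n]

lemma gevrey_resConj (hν : 0 < ν) (hν1 : ν < 1) (hr0 : 0 ≤ r'') (hrr : r'' ≤ r)
    {y : Wiener (gevreyWeight d one_pos hν hν1 (hr0.trans hrr)) M2} {l c q : ℝ} {n : Fin d → ℤ}
    (hy : y ∈ RealForm.su.sub _) (hyn : ‖y‖ ≤ 1 / 30) (hq : canonNorm (triMat l c) ≤ q) :
    MemGevrey 2 ν r'' (resConj l c y n) ∧ gevreyNorm 2 ν r'' (resConj l c y n) ≤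
      10 * q * Real.exp (r'' * (Real.pi * l1 n) ^ ν) := by
  set W2 := gevreyWeight d two_pos hν hν1 hr0 with hW2
  have hw2 := gevreyWeight_two_le (d := d) hν hν1 hr0 hrr
  set T : M2 := M2.ofMat (toC (triMat l c)) with hT
  have hTn : ‖T‖ ≤ q := (M2.norm_le_canonNorm _).trans (by
    rw [hT, M2.toMat_ofMat, canonNorm_toC]; exact hq)
  set X : Wiener W2 M2 := const T * (const M2.cayInv * (embed hw2 (NormedSpace.exp y) *
    (halfTwist W2 n * const M2.cay))) with hX
  have hXn : ‖X‖ ≤ 5 * q * W2.w n := by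
    have h1 : ‖(embed hw2 (NormedSpace.exp y) : Wiener W2 M2)‖ ≤ 1.1 := by
      have h2 := norm_exp_sub_one_le (x := y) (ρ := 1 / 30) (by norm_num) hyn
      have h3 := norm_le_norm_add_norm_sub' (NormedSpace.exp y) 1
      have h4 : ‖(1 : Wiener (gevreyWeight d one_pos hν hν1 (hr0.trans hrr)) M2)‖ = 1 := norm_one
      refine (norm_embed_le hw2 _).trans ?_
      linarith
    have hw := W2.pos n
    have hq0 : 0 ≤ q := (norm_nonneg _).trans hTn
    calc ‖X‖ ≤ ‖(const T : Wiener W2 M2)‖ * (‖(const M2.cayInv : Wiener W2 M2)‖ *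
          (‖(embed hw2 (NormedSpace.exp y) : Wiener W2 M2)‖ *
          (‖halfTwist W2 n‖ * ‖(const M2.cay : Wiener W2 M2)‖))) := by
          refine (norm_mul_le _ _).trans (mul_le_mul_of_nonneg_left ?_ (norm_nonneg _))
          refine (norm_mul_le _ _).trans (mul_le_mul_of_nonneg_left ?_ (norm_nonneg _))
          refine (norm_mul_le _ _).trans (mul_le_mul_of_nonneg_left ?_ (norm_nonneg _))
          exact norm_mul_le _ _
      _ ≤ q * (3 / 2 * (1.1 * ((2 * W2.w n) * (3 / 2)))) := by
          rw [norm_const, norm_const, norm_const]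
          gcongr
          · exact M2.norm_cayInv_le
          · exact norm_halfTwist_le _ _
          · exact M2.norm_cay_le
      _ ≤ _ := by nlinarith [mul_nonneg hq0 hw.le]
  have hXe : ∀ θ, toC (resConj l c y n θ) = (eval (chi 2 θ) X).toMat := by
    intro θ
    rw [hX]
    simp only [eval_mul, eval_const, eval_embed, eval_halfTwist, eval_exp]
    rw [resConj, toC_mul, toC_mul, toC_reMat (std_exp_conj (RealForm.su.σ_eval hy _))]
    have h1 : toC (rot (pairing n θ / 2)) = (M2.cayInv * (M2.dg (pairing n θ / 2) * M2.cay)).toMat := by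
      rw [← M2.toC_rot]; rfl
    rw [h1]
    have h2 : T * (M2.cayInv * (NormedSpace.exp (eval (chi 1 θ) y) * M2.cay)) *
        (M2.cayInv * (M2.dg (pairing n θ / 2) * M2.cay)) =
        T * (M2.cayInv * (NormedSpace.exp (eval (chi 1 θ) y) *
          (M2.dg (pairing n θ / 2) * M2.cay))) := by
      simp only [mul_assoc]
      rw [← mul_assoc M2.cay M2.cayInv, M2.cay_mul_cayInv, one_mul]
    exact h2
  obtain ⟨h1, h2⟩ := gevrey_of_wiener two_pos hν hν1 hr0 hXe
  refine ⟨h1, h2.trans ?_⟩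
  have h3 : W2.w n = Real.exp (r'' * (Real.pi * l1 n) ^ ν) := by
    change Real.exp (r'' * (2 * Real.pi / 2 * l1 n) ^ ν) = _
    rw [mul_div_cancel_left₀ _ (two_ne_zero' ℝ)]
  rw [← h3]
  linarith

end ResConjNorm

lemma Weight.entryWt_le {d : ℕ} (ω : Weight (Fin d → ℤ)) (n k : Fin d → ℤ) (i j : Fin 2) :
    ω.w (k - entryWt i j • n) ≤ ω.w n * ω.w k := by
  have h : ω.w (-(entryWt i j • n)) ≤ ω.w n := by
    rw [ω.neg_eq]
    rcases entryWt_cases i j with h | h | h <;> rw [h]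
    · rw [zero_smul, ω.zero]; exact ω.one_le n
    · rw [one_smul]
    · rw [neg_one_smul, ω.neg_eq]
  rw [sub_eq_add_neg, mul_comm]
  exact (ω.add_le _ _).trans (mul_le_mul_of_nonneg_left h (ω.pos k).le)

lemma l1_entryWt_le {d : ℕ} (n : Fin d → ℤ) (i j : Fin 2) : l1 (entryWt i j • n) ≤ l1 n := by
  rcases entryWt_cases i j with h | h | h <;> rw [h]
  · rw [zero_smul, l1_zero]; exact l1_nonneg n
  · rw [one_smul]
  · rw [neg_one_smul, l1_neg]

/-- The logarithm of the constant part in the resonant case. -/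
lemma exists_resonant_log {h0 : M2} {φ p δ : ℝ} (hS : RealForm.su.σ h0 = h0) (htr : h0.tr = 0)
    (hp0 : 0 < p) (hp : p ≤ 1 / 1000) (hφ : |φ| ≤ p / 2) (hh0 : ‖h0‖ ≤ p / 100)
    (hδ : ‖h0.toMat 0 1‖ ≤ δ) (hδp : δ ≤ p / 100) :
    ∃ (a : M2) (t : ℝ) (μ : ℂ), NormedSpace.exp a = M2.dg φ * NormedSpace.exp h0 ∧ a.tr = 0 ∧
      RealForm.su.σ a = a ∧ a.toMat = su11 t μ ∧ |t| ≤ 4 * p ∧ ‖μ‖ ≤ 2 * δ ∧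
      canonNorm (reMat (M2.cayInv * (a * M2.cay))) ≤ 8 * p := by
  set S := RealForm.su
  set U := M2.dg φ * NormedSpace.exp h0 - 1 with hU
  have hE : ‖NormedSpace.exp h0 - 1‖ ≤ p / 50 :=
    (norm_exp_sub_one_le (x := h0) (ρ := 1 / 10) (by norm_num) (by linarith)).trans (by linarith)
  have hUn : ‖U‖ ≤ 3.2 * p := by
    have e : U = (M2.dg φ - 1) + M2.dg φ * (NormedSpace.exp h0 - 1) := by rw [hU]; noncomm_ring
    have h1 := M2.norm_dg_sub_one_le φ
    have h2 : ‖M2.dg φ * (NormedSpace.exp h0 - 1)‖ ≤ 1 * (p / 50) :=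
      (norm_mul_le _ _).trans (mul_le_mul (M2.norm_dg_le φ) hE (norm_nonneg _) zero_le_one)
    have h3 : 2 * Real.pi * |φ| ≤ 3.15 * p := by
      have := Real.pi_lt_d2
      nlinarith [abs_nonneg φ, Real.pi_pos]
    rw [e]
    refine (norm_add_le _ _).trans ?_
    linarith
  have hUm : U ∈ S.fixed := sub_mem (mul_mem (M2.su_dg φ) (σ_exp S hS)) (one_mem S.fixed)
  obtain ⟨a, ha, hae, han, hau⟩ := exists_log S.fixed S.isClosed_fixed hUm (by linarith)
  have haS : S.σ a = a := ha
  have haexp : NormedSpace.exp a = M2.dg φ * NormedSpace.exp h0 := by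
    rw [hae, hU, add_sub_cancel]
  have hatr : a.tr = 0 := S.tr_eq_zero_of_det_exp haS (by
    rw [haexp, M2.det_mul, M2.det_dg, M2.det_exp, htr, Complex.exp_zero, one_mul])
  have han' : ‖a‖ ≤ 3.4 * p := by
    have h1 := norm_le_norm_add_norm_sub' a U
    have h2 : 8 * ‖U‖ ^ 2 ≤ 0.2 * p := by
      have : ‖U‖ ^ 2 ≤ (3.2 * p) ^ 2 := by gcongr
      nlinarith
    linarith
  have h11 : a.toMat 1 1 = -a.toMat 0 0 := by
    rw [M2.tr] at hatr; linear_combination hatr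
  have h00 : starRingEnd ℂ (a.toMat 1 1) = a.toMat 0 0 :=
    congrArg (fun x : M2 => x.toMat 0 0) haS
  have h10 : starRingEnd ℂ (a.toMat 0 1) = a.toMat 1 0 :=
    congrArg (fun x : M2 => x.toMat 1 0) haS
  have him : a.toMat 0 0 = Complex.I * ((a.toMat 0 0).im : ℂ) := by
    have hre : (a.toMat 0 0).re = 0 := by
      have := congrArg Complex.re h00
      rw [h11] at this
      simp at this
      linarith
    refine Complex.ext ?_ ?_ <;> simp [hre]
  have hμ : ‖a.toMat 0 1‖ ≤ 2 * δ := by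
    have h1 : (NormedSpace.exp a).toMat 0 1 = a.toMat 0 1 + (expRem a).toMat 0 1 := by
      rw [exp_eq_expRem]; simp
    have h2 : (NormedSpace.exp h0).toMat 0 1 = h0.toMat 0 1 + (expRem h0).toMat 0 1 := by
      rw [exp_eq_expRem]; simp
    have h3 : (NormedSpace.exp a).toMat 0 1 =
        Complex.exp (2 * Real.pi * φ * Complex.I) * (NormedSpace.exp h0).toMat 0 1 := by
      rw [haexp, M2.toMat_mul]; simp [M2.dg]
    have h4 := M2.expRem_entry_le (a := a) (ρ := 1 / 20) (by norm_num) (by linarith)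
    have h5 := M2.expRem_entry_le (a := h0) (ρ := 1 / 20) (by norm_num) (by linarith)
    have h6 : ‖a.toMat 0 1 + (expRem a).toMat 0 1‖ = ‖h0.toMat 0 1 + (expRem h0).toMat 0 1‖ := by
      rw [← h1, h3, norm_mul, M2.norm_exp_two_pi, one_mul, h2]
    have h7 := norm_add_le (h0.toMat 0 1) ((expRem h0).toMat 0 1)
    have h8 := norm_sub_le (a.toMat 0 1 + (expRem a).toMat 0 1) ((expRem a).toMat 0 1)
    rw [add_sub_cancel_right] at h8
    linarith [norm_nonneg (h0.toMat 0 1)]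
  have haR : S.σ a = a → RealForm.std.σ (M2.cayInv * (a * M2.cay)) = M2.cayInv * (a * M2.cay) :=
    fun h => by rw [M2.std_cayInv_conj, h]
  have hn00 := M2.entry_le a 0 0
  have hn11 := M2.entry_le a 1 1
  have hn10 : ‖a.toMat 1 0‖ = ‖a.toMat 0 1‖ := by rw [← h10, RCLike.norm_conj]
  refine ⟨a, (a.toMat 0 0).im, a.toMat 0 1, haexp, hatr, haS, ?_, ?_, hμ, ?_⟩
  · have : a = M2.ofMat (su11 (a.toMat 0 0).im (a.toMat 0 1)) := by
      refine M2.ext' ?_ ?_ ?_ ?_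
      · rw [M2.toMat_ofMat]; simpa [su11] using him
      · rw [M2.toMat_ofMat]; simp [su11]
      · rw [M2.toMat_ofMat, ← h10]; simp [su11]
      · rw [M2.toMat_ofMat, h11]; simpa [su11] using him
    exact this
  · have := Complex.abs_im_le_norm (a.toMat 0 0)
    linarith
  · have key : ∀ z1 z2 z3 z4 : ℂ, ‖z1‖ ≤ 3.4 * p → ‖z2‖ ≤ p / 50 → ‖z3‖ ≤ p / 50 →
        ‖z4‖ ≤ 3.4 * p → ‖(z1 + z2 + z3 + z4) / 2‖ ≤ 4 * p := by
      intro z1 z2 z3 z4 h1 h2 h3 h4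
      rw [norm_div, Complex.norm_two]
      have := (norm_add_le (z1 + z2 + z3) z4).trans
        (add_le_add_left ((norm_add_le (z1 + z2) z3).trans (add_le_add_left (norm_add_le z1 z2) _)) _)
      linarith
    rw [← canonNorm_toC, toC_reMat (haR haS), M2.cayInv_conj]
    have b1 : ‖a.toMat 0 0‖ ≤ 3.4 * p := hn00.trans han'
    have b2 : ‖a.toMat 0 1‖ ≤ p / 50 := by linarith
    have b3 : ‖a.toMat 1 0‖ ≤ p / 50 := by linarith
    have b4 : ‖a.toMat 1 1‖ ≤ 3.4 * p := hn11.trans han'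
    rw [canonNorm]
    have e00 := key _ _ _ _ b1 b2 b3 b4
    have e01 : ‖-Complex.I * (a.toMat 0 0 - a.toMat 0 1 + a.toMat 1 0 - a.toMat 1 1) / 2‖ ≤ 4 * p := by
      have := key _ (-a.toMat 0 1) _ (-a.toMat 1 1) b1 (by rwa [norm_neg]) b3 (by rwa [norm_neg])
      rw [mul_div_assoc, norm_mul, norm_neg, Complex.norm_I, one_mul]
      simpa only [← sub_eq_add_neg] using this
    have e10 : ‖Complex.I * (a.toMat 0 0 + a.toMat 0 1 - a.toMat 1 0 - a.toMat 1 1) / 2‖ ≤ 4 * p := by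
      have := key _ _ (-a.toMat 1 0) (-a.toMat 1 1) b1 b2 (by rwa [norm_neg]) (by rwa [norm_neg])
      rw [mul_div_assoc, norm_mul, Complex.norm_I, one_mul]
      simpa only [← sub_eq_add_neg] using this
    have e11 : ‖(a.toMat 0 0 - a.toMat 0 1 - a.toMat 1 0 + a.toMat 1 1) / 2‖ ≤ 4 * p := by
      have := key _ (-a.toMat 0 1) (-a.toMat 1 0) _ b1 (by rwa [norm_neg]) (by rwa [norm_neg]) b4
      simpa only [← sub_eq_add_neg] using this
    have := max_le (max_le e00 e01) (max_le e10 e11)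
    simp only [M2.of_00, M2.of_01, M2.of_10, M2.of_11]
    linarith

set_option maxHeartbeats 1000000 in
/-- The step at a resonance `n`, for a matrix conjugate to a rotation. -/
theorem resonant_core {d : ℕ} {ν r r' p N η q x l c : ℝ} {n : Fin d → ℤ} {j : ℤ}
    {α : Fin d → ℝ} {A : RMat} {f : (Fin d → ℝ) → RMat} (hν : 0 < ν) (hν1 : ν < 1) (hr' : 0 < r')
    (hrr : r' < r) (hf : MemGevreysl 1 ν r f) (hfε : gevreyNorm 1 ν r f ≤ p ^ 1100) (hp : 0 < p)
    (hp6 : p ≤ 1 / 1000000) (hA : A = triMat l c * rot x * triMat (-l) (-c))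
    (hq1 : canonNorm (triMat l c) ≤ q) (hq2 : canonNorm (triMat (-l) (-c)) ≤ q)
    (hq : q ^ 2 ≤ p⁻¹ ^ 5)
    (hdiv : ∀ i j, ∀ k : Fin d → ℤ, k ≠ entryWt i j • n → l1 k ≤ N →
      p ^ 55 ≤ torusDist ((pairing k α - entryWt i j * (2 * x) : ℝ) : ℂ))
    (hres : |2 * x - pairing n α - j| < p ^ 55) (hnN : l1 n ≤ N) (hη0 : 0 ≤ η)
    (hη : p ^ 825 * η ≤ 1)
    (htail : ∀ k : Fin d → ℤ, N < l1 k → Real.exp (r' * (2 * Real.pi / 1 * l1 n) ^ ν) *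
      Real.exp (r' * (2 * Real.pi / 1 * l1 k) ^ ν) ≤
        η * Real.exp (r * (2 * Real.pi / 1 * l1 k) ^ ν)) :
    ∃ (y : Wiener (gevreyWeight d one_pos hν hν1 (hr'.trans hrr).le) M2) (a : RMat) (t : ℝ) (μ : ℂ)
      (f' : (Fin d → ℝ) → RMat), y ∈ RealForm.su.sub _ ∧ ‖y‖ ≤ 1 / 30 ∧
      (∀ θ, (eval (chi 1 θ) y).tr = 0) ∧ MemGevreysl 1 ν r' f' ∧ a.trace = 0 ∧
      (∀ θ, (resConj l c y n (θ + α))⁻¹ * (A * NormedSpace.exp (f θ)) * resConj l c y n θ =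
        (((-1 : ℝ) ^ j) • NormedSpace.exp a) * NormedSpace.exp (f' θ)) ∧
      canonNorm a ≤ 8 * p ^ 55 ∧ toC a = Mmat⁻¹ * su11 t μ * Mmat ∧ |t| ≤ 4 * p ^ 55 ∧
      ‖μ‖ ≤ p ^ 825 * Real.exp (-(r * (2 * Real.pi * l1 n) ^ ν)) ∧
      gevreyNorm 1 ν r' f' ≤ p ^ 825 * η := by
  have hr : 0 ≤ r := (hr'.trans hrr).le
  set W := gevreyWeight d one_pos hν hν1 hr
  set W' := gevreyWeight d one_pos hν hν1 hr'.le
  obtain ⟨x0, hx0, hx0n⟩ := wiener_of_gevrey one_pos hν hν1 hr hf.1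
  have hxM : ∀ θ, eval (chi 1 θ) x0 = M2.ofMat (toC (f θ)) := fun θ =>
    M2.toMat_injective (hx0 θ).symm
  set S := RealForm.su
  set P := p⁻¹ with hPdef
  have hP6 : 1000000 ≤ P := by
    rw [hPdef, le_inv_comm₀ (by norm_num) hp]; linarith
  have hP1 : 1 ≤ P := by linarith
  have hPpow : ∀ m n : ℕ, P ^ m * p ^ (m + n) = p ^ n := inv_pow_mul_pow hp.ne'
  have hsmall : ∀ m n : ℕ, m < n → 1000000 * p ^ n ≤ p ^ m := fun m n => pow_le_of_le hp hp6
  have hsmall0 : ∀ n : ℕ, 0 < n → 1000000 * p ^ n ≤ 1 := fun n hn => by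
    simpa using hsmall 0 n hn
  have hpp : ∀ n : ℕ, 0 < p ^ n := fun n => pow_pos hp n
  set ε1 := p ^ 1094 with hε1
  -- the conjugated perturbation
  set T := M2.ofMat (toC (triMat l c)) with hT
  set T' := M2.ofMat (toC (triMat (-l) (-c))) with hT'
  have hTT' : triMat l c * triMat (-l) (-c) = 1 := by
    ext i j; fin_cases i <;> fin_cases j <;>
      simp [triMat, Matrix.mul_apply, Fin.sum_univ_two, ← Real.exp_add]
    ring
  have hT'T : triMat (-l) (-c) * triMat l c = 1 := mul_eq_one_comm.1 hTT'
  have hTT : T * T' = 1 := by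
    rw [hT, hT', ← M2.ofMat_mul', ← toC_mul, hTT', toC_one]; rfl
  have hTT2 : T' * T = 1 := by
    rw [hT, hT', ← M2.ofMat_mul', ← toC_mul, hT'T, toC_one]; rfl
  have hTn : ‖T‖ ≤ q := (M2.norm_le_canonNorm _).trans (by
    rw [hT, M2.toMat_ofMat, canonNorm_toC]; exact hq1)
  have hTn' : ‖T'‖ ≤ q := (M2.norm_le_canonNorm _).trans (by
    rw [hT', M2.toMat_ofMat, canonNorm_toC]; exact hq2)
  set Z := M2.cay * T' with hZ
  set Z' := T * M2.cayInv with hZ'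
  have hZZ : Z * Z' = 1 := by
    rw [hZ, hZ', mul_assoc, ← mul_assoc T', hTT2, one_mul, M2.cay_mul_cayInv]
  have hZZ2 : Z' * Z = 1 := by
    rw [hZ, hZ', mul_assoc, ← mul_assoc M2.cayInv, M2.cayInv_mul_cay, one_mul, hTT]
  have hq0 : 0 ≤ q := (norm_nonneg _).trans hTn
  set g : Wiener W M2 := const Z * (x0 * const Z') with hg
  have hge : ∀ θ, eval (chi 1 θ) g = Z * (eval (chi 1 θ) x0 * Z') := fun θ => by
    rw [hg, eval_mul, eval_mul, eval_const, eval_const]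
  have hgn : ‖g‖ ≤ ε1 := by
    have h1 : ‖Z‖ ≤ 3 / 2 * q := (norm_mul_le _ _).trans
      (mul_le_mul M2.norm_cay_le hTn' (norm_nonneg _) (by norm_num))
    have h2 : ‖Z'‖ ≤ q * (3 / 2) := (norm_mul_le _ _).trans
      (mul_le_mul hTn M2.norm_cayInv_le (norm_nonneg _) hq0)
    calc ‖g‖ ≤ ‖(const Z : Wiener W M2)‖ * (‖x0‖ * ‖(const Z' : Wiener W M2)‖) :=
          (norm_mul_le _ _).trans (mul_le_mul_of_nonneg_left (norm_mul_le _ _) (norm_nonneg _))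
      _ ≤ (3 / 2 * q) * (p ^ 1100 * (q * (3 / 2))) := by
          rw [norm_const, norm_const]
          have h3 := hx0n.trans hfε
          gcongr
      _ = 9 / 4 * q ^ 2 * p ^ 1100 := by ring
      _ ≤ 9 / 4 * P ^ 5 * p ^ 1100 := by gcongr
      _ = 9 / 4 * p ^ 1095 := by rw [← hPpow 5 1095]; ring
      _ ≤ _ := by linarith [hsmall 1094 1095 (by norm_num), hpp 1095]
  have hgS : g ∈ S.sub W := S.mem_sub_of_eval one_ne_zero fun θ => by
    have e : Z * (eval (chi 1 θ) x0 * Z') =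
        M2.cay * ((T' * (eval (chi 1 θ) x0 * T)) * M2.cayInv) := by
      rw [hZ, hZ']; simp only [mul_assoc]
    rw [hge, e, M2.su_cay_conj, RealForm.mul_eq, RealForm.mul_eq, hxM, std_σ_toC, hT, hT',
      std_σ_toC, std_σ_toC]
  have hgtr : ∀ θ, (eval (chi 1 θ) g).tr = 0 := fun θ => by
    rw [hge, ← mul_assoc, M2.tr_conj hZZ2, hxM]
    have h := hf.2 θ
    rw [Matrix.trace_fin_two] at h
    simp only [M2.tr, M2.toMat_ofMat, toC_apply]
    exact_mod_cast h
  -- the divisors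
  have hp55' : p ^ 55 ≤ 1 / 2 := by linarith [hsmall0 55 (by norm_num)]
  have hdv : ∀ k i j, k ≠ entryWt i j • n → l1 k ≤ N → p ^ 55 ≤ ‖divisor α x k i j - 1‖ :=
    fun k i j h1 h2 => (le_min hp55' (hdiv i j k h1 h2)).trans (min_le_norm_exp_sub_one _)
  have hdv1 : ∀ k i j, k ≠ entryWt i j • n → l1 k ≤ N → divisor α x k i j ≠ 1 := by
    intro k i j h1 h2 h
    have := hdv k i j h1 h2
    rw [h, sub_self, norm_zero] at this
    linarith [hpp 55]
  have hchi1 : ∀ k : Fin d → ℤ, k ≠ 0 → l1 k ≤ N → (chi 1 α k : ℂ) ≠ 1 := by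
    intro k h1 h2
    have h3 := hdv1 k 0 0 (by rwa [show entryWt 0 0 = 0 from rfl, zero_smul]) h2
    rw [divisor, show entryWt 0 0 = 0 from rfl] at h3
    rw [chi_coe]
    have e : (2 * Real.pi * (pairing k α : ℂ) / ((1 : ℝ) : ℂ) * Complex.I) = 2 * Real.pi *
        ((pairing k α - ((0 : ℤ) : ℝ) * (2 * x) : ℝ) : ℂ) * Complex.I := by push_cast; ring
    rwa [e]
  obtain ⟨x', hx', y, hy, h, hh, hx'n, -, hyn, hhn, hcoefh, hytr, hhtr, heq⟩ :=
    S.exists_reduction (W := W) α (u := M2.dg (-x)) (v := M2.dg x) (M2.dg_mul_neg x)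
      (M2.su_dg _) (M2.su_dg _) (LK := divMul α x N n fun w => (w - 1)⁻¹)
      (LQ := divMul α x N n fun _ => 1) (C := P ^ 55) (C' := P ^ 55) (ε := ε1)
      (one_le_pow₀ hP1) (fun k a => norm_divMul_le (by positivity) (fun i j h1 h2 => by
        rw [norm_inv, hPdef, inv_pow]
        exact inv_anti₀ (hpp 55) (hdv k i j h1 h2)) a)
      (by
        have h1 := mul_le_mul (M2.norm_dg_le (-x)) (M2.norm_dg_le x) (norm_nonneg _) zero_le_one
        calc _ ≤ 1 * 1 * P ^ 55 := by gcongr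
          _ = _ := by ring) le_rfl
      (fun k a => norm_divMul_le zero_le_one (fun i j _ _ => by rw [norm_one]) a)
      (fun k a => norm_sub_divMul_le a) (fun k a => divMul_coh (fun i j => hdv1 k i j) a)
      (su_divMul fun w => by rw [map_inv₀, map_sub, map_one]) (su_divMul fun w => map_one _)
      (fun k => divMul_mode (hchi1 k)) hgS hgtr hgn
      (by
        have h1 : 300 * (P ^ 55) ^ 2 * ε1 = 300 * p ^ 984 := by
          rw [hε1, ← hPpow 110 984]; ring
        linarith [hsmall0 984 (by norm_num)])
  have hy30 : ‖y‖ ≤ 1 / 30 := by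
    refine hyn.trans ?_
    calc P ^ 55 * ‖x'‖ ≤ P ^ 55 * (4 * ε1) := by gcongr
      _ = 4 * (P ^ 55 * p ^ (55 + 1039)) := by rw [hε1]; ring
      _ ≤ _ := by rw [hPpow]; linarith [hsmall0 1039 (by norm_num)]
  -- the twisted remainder
  have hW' : ∀ k, W'.w k ≤ W.w k := fun k => by
    refine Real.exp_le_exp.2 (mul_le_mul_of_nonneg_right hrr.le (Real.rpow_nonneg
      (mul_nonneg (by positivity) (l1_nonneg k)) _))
  have htw : ∀ i j, ∀ k ∈ (Set.univ : Set (Fin d → ℤ)),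
      W'.w (k - entryWt i j • n) ≤ W'.w n * W.w k := fun i j k _ =>
    (W'.entryWt_le n k i j).trans (mul_le_mul_of_nonneg_left (hW' k) (W'.pos n).le)
  have htl : ∀ i j, ∀ k ∈ {k : Fin d → ℤ | N < l1 k},
      W'.w (k - entryWt i j • n) ≤ η * W.w k := fun i j k hk =>
    (W'.entryWt_le n k i j).trans (htail k hk)
  set h' := shear n Set.univ (W'.w n) htw (W'.pos n).le h with hh'
  set tail := shear n {k | N < l1 k} η htl hη0 x' with htailD
  have hh'e : ∀ θ, eval (chi 1 θ) h' = M2.dg (-(pairing n θ / 2)) *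
      (eval (chi 1 θ) h * M2.dg (pairing n θ / 2)) := fun θ => eval_shear htw _ rfl θ h
  have hh'S : h' ∈ S.sub W' := S.mem_sub_of_eval one_ne_zero fun θ => by
    rw [hh'e, S.mul_eq, S.mul_eq, M2.su_dg, M2.su_dg, S.σ_eval hh]
  have hh'tr : ∀ θ, (eval (chi 1 θ) h').tr = 0 := fun θ => by
    rw [hh'e, ← mul_assoc, M2.tr_conj (M2.dg_mul_neg _), hhtr]
  set h0 := coef 0 h' with hh0
  have hcoefh' : ∀ k i j, (coef k h').toMat i j = (coef (k + entryWt i j • n) h).toMat i j := by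
    classical
    exact fun k i j => by rw [hh', coef_shear, if_pos (Set.mem_univ _)]
  have hh0S : S.σ h0 = h0 := by rw [hh0, S.σ_coef hh'S, neg_zero]
  have hh0tr : h0.tr = 0 := RealForm.tr_coef_eq_zero hh'tr 0
  have hh0e : ∀ i j, W.w n * ‖h0.toMat i j‖ ≤ W.w n * (4 * ε1) ∧
      ‖h0.toMat 0 1‖ ≤ 4 * ε1 * (W.w n)⁻¹ := by
    have hb : ∀ k : Fin d → ℤ, W.w k * ‖coef k h‖ ≤ 4 * ε1 := fun k =>
      (norm_coef_le k h).trans (hhn.trans hx'n)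
    intro i j
    constructor
    · refine mul_le_mul_of_nonneg_left ?_ (W.pos n).le
      rw [hh0, hcoefh']
      refine (M2.entry_le _ _ _).trans (le_trans ?_ (hb (0 + entryWt i j • n)))
      exact le_mul_of_one_le_left (norm_nonneg _) (W.one_le _)
    · rw [hh0, hcoefh', show entryWt 0 1 = 1 from rfl, one_smul, zero_add,
        ← div_eq_mul_inv, le_div_iff₀ (W.pos n), mul_comm]
      exact (mul_le_mul_of_nonneg_left (M2.entry_le _ _ _) (W.pos n).le).trans (hb n)
  have hh0n : ‖h0‖ ≤ 8 * ε1 := by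
    have := fun i j => le_of_mul_le_mul_left (hh0e i j).1 (W.pos n)
    refine M2.norm_le ?_ ?_
    · linarith [this 0 0, this 0 1]
    · linarith [this 1 0, this 1 1]
  have hdecomp : h' - const h0 = tail := by
    classical
    refine ext_coef fun k => M2.ext fun i j => ?_
    rw [← coefL_apply, map_sub, coefL_apply, coefL_apply, M2.toMat_sub, hcoefh', htailD, coef_shear,
      const, coef_mono]
    simp only [Set.mem_ofPred_eq]
    by_cases hk0 : k = 0
    · have : ¬ N < l1 (k + entryWt i j • n) := by
        rw [hk0, zero_add, not_lt]; exact (l1_entryWt_le n i j).trans hnN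
      rw [if_pos hk0, hh0, hcoefh', hk0, sub_self, if_neg (by rwa [hk0] at this)]
    · rw [if_neg hk0, M2.toMat_zero, sub_zero, hcoefh, M2.toMat_sub]
      have hne : k + entryWt i j • n ≠ entryWt i j • n := by simpa using hk0
      by_cases hk : N < l1 (k + entryWt i j • n)
      · rw [if_pos hk, divMul_of_not (fun h => absurd h.2 (not_le.2 hk)), sub_zero]
      · rw [if_neg hk, divMul_of ⟨hne, not_lt.1 hk⟩, one_mul, sub_self]
  have htn : ‖tail‖ ≤ 16 * η * ε1 := by
    refine (norm_shear_le htl hη0 x').trans ?_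
    calc 4 * η * ‖x'‖ ≤ 4 * η * (4 * ε1) := by gcongr
      _ = _ := by ring
  have hε1s : 1000000 * ε1 ≤ 1 := hsmall0 1094 (by norm_num)
  have hηε : 1000000 * (η * ε1) ≤ p ^ 825 * η := by
    have h1 := mul_le_mul_of_nonneg_right (hsmall 825 1094 (by norm_num)) hη0
    linarith
  have hh'n : ‖h'‖ ≤ 1 / 100 := by
    have h1 := norm_add_le (const h0 : Wiener W' M2) tail
    rw [← hdecomp, add_sub_cancel, norm_const, hdecomp] at h1
    linarith
  obtain ⟨z, hz, hzn, hze⟩ := S.exists_log_quotient hh0S hh'S (by linarith) hh'n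
  rw [hdecomp] at hzn
  have hztr : ∀ θ, (eval (chi 1 θ) z).tr = 0 := fun θ => S.tr_eq_of_exp_det hz (by
    rw [hze, M2.det_mul, M2.det_exp, M2.det_exp, hh'tr, ← neg_one_smul ℂ h0, M2.tr_smul,
      hh0tr, mul_zero, Complex.exp_zero, mul_one])
  -- the constant part
  set φ := x - pairing n α / 2 - j / 2 with hφ
  have hφn : |φ| ≤ p ^ 55 / 2 := by
    have e : φ = (2 * x - pairing n α - j) / 2 := by rw [hφ]; ring
    rw [e, abs_div, abs_two]
    linarith
  have hwn : (W.w n)⁻¹ ≤ 1 := inv_le_one_of_one_le₀ (W.one_le n)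
  have hwn0 : 0 < (W.w n)⁻¹ := inv_pos.2 (W.pos n)
  have h55 : 1000000 * ε1 ≤ p ^ 55 := hsmall 55 1094 (by norm_num)
  have h825 : 1000000 * ε1 ≤ p ^ 825 := hsmall 825 1094 (by norm_num)
  have hε10 : 0 < ε1 := hpp 1094
  have hδ : 4 * ε1 * (W.w n)⁻¹ ≤ p ^ 55 / 100 := by
    calc 4 * ε1 * (W.w n)⁻¹ ≤ 4 * ε1 * 1 := by gcongr
      _ ≤ _ := by linarith
  obtain ⟨a, t, μ, hae, hatr, haS, hamat, ht, hμ, hacan⟩ := exists_resonant_log (p := p ^ 55) hh0S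
    hh0tr (hpp 55) (by linarith [hsmall0 55 (by norm_num)]) hφn (by linarith) (hh0e 0 0).2
    hδ
  have haR : RealForm.std.σ (M2.cayInv * (a * M2.cay)) = M2.cayInv * (a * M2.cay) := by
    rw [M2.std_cayInv_conj, haS]
  have hzR : ∀ θ, RealForm.std.σ (M2.cayInv * (eval (chi 1 θ) z * M2.cay)) =
      M2.cayInv * (eval (chi 1 θ) z * M2.cay) := fun θ => by
    rw [M2.std_cayInv_conj, S.σ_eval hz]
  set zR : Wiener W' M2 := const M2.cayInv * (z * const M2.cay) with hzRdef
  have hzRe : ∀ θ, eval (chi 1 θ) zR = M2.cayInv * (eval (chi 1 θ) z * M2.cay) := fun θ => by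
    rw [hzRdef, eval_mul, eval_mul, eval_const, eval_const]
  have hf' : ∀ θ, toC (reMat (M2.cayInv * (eval (chi 1 θ) z * M2.cay))) =
      (eval (chi 1 θ) zR).toMat := fun θ => by rw [toC_reMat (hzR θ), hzRe]
  have hzRn : ‖zR‖ ≤ 9 / 4 * (48 * (η * ε1)) := by
    calc ‖zR‖ ≤ ‖(const M2.cayInv : Wiener W' M2)‖ * (‖z‖ * ‖(const M2.cay : Wiener W' M2)‖) :=
          (norm_mul_le _ _).trans (mul_le_mul_of_nonneg_left (norm_mul_le _ _) (norm_nonneg _))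
      _ ≤ 3 / 2 * ((48 * (η * ε1)) * (3 / 2)) := by
          rw [norm_const, norm_const]
          have h1 : ‖z‖ ≤ 48 * (η * ε1) := by linarith
          gcongr
          · exact M2.norm_cayInv_le
          · exact M2.norm_cay_le
      _ = _ := by ring
  refine ⟨y, reMat (M2.cayInv * (a * M2.cay)), t, μ,
    fun θ => reMat (M2.cayInv * (eval (chi 1 θ) z * M2.cay)), hy, hy30, hytr,
    ⟨(gevrey_of_wiener one_pos hν hν1 hr'.le hf').1, fun θ => trace_reMat ?_⟩, trace_reMat ?_,
    fun θ => ?_, hacan, ?_, ht, ?_, ?_⟩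
  · rw [← mul_assoc, M2.tr_conj M2.cay_mul_cayInv, hztr]
  · rw [← mul_assoc, M2.tr_conj M2.cay_mul_cayInv, hatr]
  · have key : A * NormedSpace.exp (f θ) * resConj l c y n θ = resConj l c y n (θ + α) *
        ((((-1 : ℝ) ^ j) • NormedSpace.exp (reMat (M2.cayInv * (a * M2.cay)))) *
          NormedSpace.exp (reMat (M2.cayInv * (eval (chi 1 θ) z * M2.cay)))) := by
      refine toC_injective ?_
      have hsm : ∀ (s : ℝ) (X : RMat), toC (s • X) = (s • M2.ofMat (toC X)).toMat := fun s X => by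
        ext i j; rw [M2.toMat_real_smul, toC_apply, Matrix.smul_apply, smul_eq_mul]; simp [toC_apply]
      have hrot : ∀ ψ, toC (rot ψ) = (M2.cayInv * (M2.dg ψ * M2.cay)).toMat := fun ψ => by
        rw [← M2.toC_rot]; rfl
      have hY := fun θ => toC_reMat (std_exp_conj (S.σ_eval hy (chi 1 θ)))
      rw [hA, resConj, resConj]
      simp only [toC_mul, toC_exp, hsm, hrot, hY, toC_reMat haR, toC_reMat (hzR θ)]
      -- the identity between complex matrices
      set Y := NormedSpace.exp (eval (chi 1 θ) y)
      set Y' := NormedSpace.exp (eval (chi 1 (θ + α)) y)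
      set Q := M2.dg (pairing n θ / 2)
      set Q' := M2.dg (pairing n (θ + α) / 2)
      have hconj : ∀ b : M2, NormedSpace.exp (M2.cayInv * (b * M2.cay)) =
          M2.cayInv * (NormedSpace.exp b * M2.cay) := exp_sandwich M2.cay_mul_cayInv
      have h1 : NormedSpace.exp (eval (chi 1 θ) g) = Z * (NormedSpace.exp (eval (chi 1 θ) x0) * Z') := by
        rw [hge, exp_sandwich hZZ2]
      have h2 : NormedSpace.exp (eval (chi 1 θ) h) * Q = Q * NormedSpace.exp (eval (chi 1 θ) h') := by
        rw [hh'e, exp_sandwich (M2.dg_mul_neg _), ← mul_assoc, M2.dg_mul_neg, one_mul]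
      have h3 : M2.dg x * Q = Q' * ((((-1 : ℝ) ^ j) • 1) * M2.dg φ) := by
        rw [← M2.dg_half_int, ← M2.dg_add, ← M2.dg_add, ← M2.dg_add, hφ, pairing_add_right]
        congr 1; ring
      have h0i : NormedSpace.exp h0 * NormedSpace.exp (-h0) = 1 := by
        let := NormedAlgebra.restrictScalars ℚ ℝ M2
        rw [← NormedSpace.exp_add_of_commute (Commute.neg_right (Commute.refl h0)),
          add_neg_cancel, NormedSpace.exp_zero]
      have h4 : NormedSpace.exp a * NormedSpace.exp (eval (chi 1 θ) z) =
          M2.dg φ * NormedSpace.exp (eval (chi 1 θ) h') := by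
        rw [hae, hze, mul_assoc, ← mul_assoc (NormedSpace.exp h0), h0i, one_mul]
      have h5 : M2.dg x * (NormedSpace.exp (eval (chi 1 θ) g) * (Y * Q)) =
          Y' * (Q' * (((-1 : ℝ) ^ j) • (NormedSpace.exp a * NormedSpace.exp (eval (chi 1 θ) z)))) := by
        rw [h4, ← mul_assoc (NormedSpace.exp _), heq, mul_assoc, h2]
        have h6 : M2.dg x * (M2.dg (-x) * (Y' * M2.dg x) * (Q * NormedSpace.exp (eval (chi 1 θ) h'))) =
            (M2.dg x * M2.dg (-x)) * (Y' * ((M2.dg x * Q) * NormedSpace.exp (eval (chi 1 θ) h'))) := by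
          simp only [mul_assoc]
        rw [h6, M2.dg_mul_neg, one_mul, h3]
        simp only [mul_assoc, smul_mul_assoc, one_mul]
      have h7 : T * (M2.cayInv * (M2.dg x * M2.cay)) * T' * NormedSpace.exp (eval (chi 1 θ) x0) *
          (T * (M2.cayInv * (Y * M2.cay)) * (M2.cayInv * (Q * M2.cay))) =
          T * (M2.cayInv * (Y' * M2.cay)) * (M2.cayInv * (Q' * M2.cay)) *
          ((((-1 : ℝ) ^ j) • NormedSpace.exp (M2.cayInv * (a * M2.cay))) *
            NormedSpace.exp (M2.cayInv * (eval (chi 1 θ) z * M2.cay))) := by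
        rw [hconj, hconj]
        have cc : ∀ b, M2.cay * (M2.cayInv * b) = b := fun b => by
          rw [← mul_assoc, M2.cay_mul_cayInv, one_mul]
        have h8 := congrArg (fun b => T * (M2.cayInv * (b * M2.cay))) h5
        rw [h1, hZ, hZ'] at h8
        simp only [mul_assoc, smul_mul_assoc, mul_smul_comm, cc] at h8 ⊢
        exact h8
      rw [hxM] at h7
      exact h7
    rw [Matrix.mul_assoc, key, Matrix.nonsing_inv_mul_cancel_left]
    rw [det_resConj hy hytr]
    exact isUnit_one
  · rw [toC_reMat haR, Matrix.mul_assoc, ← hamat]; rfl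
  · refine hμ.trans ?_
    have e : (W.w n)⁻¹ = Real.exp (-(r * (2 * Real.pi * l1 n) ^ ν)) := by
      rw [Real.exp_neg]
      change (Real.exp (r * (2 * Real.pi / 1 * l1 n) ^ ν))⁻¹ = _
      rw [div_one]
    rw [← e]
    calc 2 * (4 * ε1 * (W.w n)⁻¹) = 8 * ε1 * (W.w n)⁻¹ := by ring
      _ ≤ _ := by gcongr; linarith
  · refine (gevrey_of_wiener one_pos hν hν1 hr'.le hf').2.trans ?_
    have : 0 ≤ η * ε1 := mul_nonneg hη0 (hpp 1094).le
    linarith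

section NormalForm

lemma triMat_rot (l c φ : ℝ) : triMat l c * rot φ * triMat (-l) (-c) =
    !![Real.cos (2 * Real.pi * φ) - Real.sin (2 * Real.pi * φ) * (Real.exp l * c),
      Real.sin (2 * Real.pi * φ) * (Real.exp l * Real.exp l);
      -(Real.sin (2 * Real.pi * φ) * (Real.exp (-l) * Real.exp (-l) + c * c)),
      Real.cos (2 * Real.pi * φ) + Real.sin (2 * Real.pi * φ) * (Real.exp l * c)] := by
  have h : Real.exp l * Real.exp (-l) = 1 := by rw [← Real.exp_add, add_neg_cancel, Real.exp_zero]
  ext i j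
  fin_cases i <;> fin_cases j <;>
    simp [triMat, rot, Matrix.mul_apply, Fin.sum_univ_two]
  · linear_combination Real.cos (2 * Real.pi * φ) * h
  · ring
  · ring
  · linear_combination Real.cos (2 * Real.pi * φ) * h

lemma triMat_mul_neg (l c : ℝ) : triMat (-l) (-c) * triMat l c = 1 := by
  ext i j
  fin_cases i <;> fin_cases j <;>
    simp [triMat, Matrix.mul_apply, Fin.sum_univ_two, ← Real.exp_add]
  ring

lemma abs_entry_le (A : RMat) (i j : Fin 2) : |A i j| ≤ canonNorm A / 2 := by
  have : ‖A i j‖ ≤ max (max ‖A 0 0‖ ‖A 0 1‖) (max ‖A 1 0‖ ‖A 1 1‖) := by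
    fin_cases i <;> fin_cases j <;> simp
  rw [canonNorm, mul_div_cancel_left₀ _ (two_ne_zero)]
  exact this

/-- An elliptic matrix is conjugate to a rotation by a triangular matrix of controlled size. -/
lemma exists_rotation_form {A : RMat} (hA : A.det = 1) {x : ℝ}
    (htr : A.trace = 2 * Real.cos (2 * Real.pi * x)) (hs : Real.sin (2 * Real.pi * x) ≠ 0) :
    ∃ (e : ℤ) (l c : ℝ), (e = 1 ∨ e = -1) ∧
      A = triMat l c * rot (e * x) * triMat (-l) (-c) ∧
      canonNorm (triMat l c) ≤ √(2 * canonNorm A / |Real.sin (2 * Real.pi * x)|) ∧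
      canonNorm (triMat (-l) (-c)) ≤ √(2 * canonNorm A / |Real.sin (2 * Real.pi * x)|) := by
  have hdet := hA
  rw [Matrix.det_fin_two] at hdet
  rw [Matrix.trace_fin_two] at htr
  have hsc := Real.sin_sq_add_cos_sq (2 * Real.pi * x)
  have h01 : A 0 1 ≠ 0 := by
    intro h
    rw [h] at hdet
    have : 0 < Real.sin (2 * Real.pi * x) ^ 2 := by positivity
    have h2 : (A 0 0 + A 1 1) ^ 2 = (2 * Real.cos (2 * Real.pi * x)) ^ 2 := by rw [htr]
    nlinarith [sq_nonneg (A 0 0 - A 1 1)]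
  obtain ⟨e, he, hpos⟩ : ∃ e : ℤ, (e = 1 ∨ e = -1) ∧
      0 < A 0 1 / Real.sin (2 * Real.pi * (e * x)) := by
    rcases lt_or_gt_of_ne (div_ne_zero h01 hs) with h | h
    · refine ⟨-1, Or.inr rfl, ?_⟩
      rw [show 2 * Real.pi * (((-1 : ℤ) : ℝ) * x) = -(2 * Real.pi * x) by push_cast; ring,
        Real.sin_neg, div_neg]
      linarith
    · exact ⟨1, Or.inl rfl, by simpa using h⟩
  have hcos : Real.cos (2 * Real.pi * (e * x)) = Real.cos (2 * Real.pi * x) := by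
    rcases he with rfl | rfl
    · simp
    · rw [show 2 * Real.pi * (((-1 : ℤ) : ℝ) * x) = -(2 * Real.pi * x) by push_cast; ring,
        Real.cos_neg]
  have hsin : |Real.sin (2 * Real.pi * (e * x))| = |Real.sin (2 * Real.pi * x)| := by
    rcases he with rfl | rfl
    · simp
    · rw [show 2 * Real.pi * (((-1 : ℤ) : ℝ) * x) = -(2 * Real.pi * x) by push_cast; ring,
        Real.sin_neg, abs_neg]
  have hsc' := Real.sin_sq_add_cos_sq (2 * Real.pi * (e * x))
  rw [← hsin]
  rw [← hcos] at htr
  set s := Real.sin (2 * Real.pi * (e * x)) with hsdef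
  set C := Real.cos (2 * Real.pi * (e * x)) with hC
  have hs0 : s ≠ 0 := fun h => by rw [h, abs_zero] at hsin; exact hs (abs_eq_zero.1 hsin.symm)
  set Y := A 0 1 / s with hY
  set l := Real.log Y / 2 with hl
  have hll : Real.exp l * Real.exp l = Y := by
    rw [← Real.exp_add, hl, add_halves, Real.exp_log hpos]
  have hli : Real.exp l * Real.exp (-l) = 1 := by rw [← Real.exp_add, add_neg_cancel, Real.exp_zero]
  set c := -((A 0 0 - A 1 1) / (2 * s)) * Real.exp (-l) with hc
  have hlc : Real.exp l * c = -((A 0 0 - A 1 1) / (2 * s)) := by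
    rw [hc]; linear_combination -((A 0 0 - A 1 1) / (2 * s)) * hli
  have hsY : s * Y = A 0 1 := by rw [hY]; field_simp
  have hA10 : A 1 0 = -(s * (Real.exp (-l) * Real.exp (-l) + c * c)) := by
    have h1 : Y * (Real.exp (-l) * Real.exp (-l) + c * c) =
        1 + ((A 0 0 - A 1 1) / (2 * s)) ^ 2 := by
      have h2 : (Real.exp l * c) * (Real.exp l * c) = ((A 0 0 - A 1 1) / (2 * s)) ^ 2 := by
        rw [hlc]; ring
      rw [← hll, ← h2]
      linear_combination (Real.exp l * Real.exp (-l) + 1) * hli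
    have h3 : s ^ 2 * ((A 0 0 - A 1 1) / (2 * s)) ^ 2 = (A 0 0 - A 1 1) ^ 2 / 4 := by
      field_simp; norm_num
    have h4 : A 0 1 * A 1 0 = A 0 1 * -(s * (Real.exp (-l) * Real.exp (-l) + c * c)) := by
      rw [← hsY]
      have h5 : s * Y * A 1 0 = A 0 0 * A 1 1 - 1 := by rw [hsY]; linarith
      rw [h5]
      linear_combination s ^ 2 * h1 + h3 + hsc' + (A 0 0 + A 1 1 + 2 * C) / 4 * htr
    exact mul_left_cancel₀ h01 h4
  have hform : A = triMat l c * rot (e * x) * triMat (-l) (-c) := by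
    have h00 : A 0 0 = C - s * (Real.exp l * c) := by
      rw [hlc]; field_simp; linarith
    have h11 : A 1 1 = C + s * (Real.exp l * c) := by
      rw [hlc]; field_simp; linarith
    have h01' : A 0 1 = s * (Real.exp l * Real.exp l) := by rw [hll, hsY]
    rw [triMat_rot]
    ext i j
    fin_cases i <;> fin_cases j
    · exact h00
    · exact h01'
    · exact hA10
    · exact h11
  set q := √(2 * canonNorm A / |s|) with hq
  have hs1 : 0 < |s| := abs_pos.2 hs0
  have hAn : 0 ≤ canonNorm A := zero_le_one.trans (one_le_canonNorm hA)
  have hqq : q ^ 2 = 2 * canonNorm A / |s| := Real.sq_sqrt (by positivity)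
  have hbound : ∀ v : ℝ, v ^ 2 ≤ canonNorm A / 2 / |s| → |v| ≤ q / 2 := by
    intro v hv
    refine abs_le_of_sq_le_sq ?_ (by positivity)
    rw [div_pow, hqq]
    refine hv.trans (le_of_eq ?_)
    field_simp
  have he1 : |Real.exp l| ≤ q / 2 := hbound _ (by
    rw [sq, hll, le_div_iff₀ hs1]
    have := abs_entry_le A 0 1
    rw [← hsY, abs_mul, abs_of_pos hpos] at this
    linarith)
  have h10 : (Real.exp (-l) * Real.exp (-l) + c * c) * |s| ≤ canonNorm A / 2 := by
    have := abs_entry_le A 1 0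
    rw [hA10, abs_neg, abs_mul, abs_of_nonneg (add_nonneg (mul_self_nonneg _) (mul_self_nonneg c))]
      at this
    linarith
  have he2 : |Real.exp (-l)| ≤ q / 2 := hbound _ (by
    rw [le_div_iff₀ hs1]
    nlinarith [mul_nonneg (mul_self_nonneg c) hs1.le])
  have he3 : |c| ≤ q / 2 := hbound _ (by
    rw [le_div_iff₀ hs1]
    nlinarith [mul_nonneg (mul_self_nonneg (Real.exp (-l))) hs1.le])
  have hq0 : |(0 : ℝ)| ≤ q / 2 := by rw [abs_zero]; positivity
  refine ⟨e, l, c, he, hform, ?_, ?_⟩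
  · have := max_le (max_le he1 hq0) (max_le he3 he2)
    exact (mul_le_mul_of_nonneg_left this two_pos.le).trans (by linarith)
  · have := max_le (max_le he2 hq0) (max_le (by rwa [abs_neg] : |-c| ≤ q / 2) he1)
    rw [← neg_neg l] at this
    simp only [neg_neg (-l)] at this
    exact (mul_le_mul_of_nonneg_left this two_pos.le).trans (by linarith)

lemma conjSL_triMat (l c φ : ℝ) : ConjSL (triMat l c * rot φ * triMat (-l) (-c)) (rot φ) := by
  refine ⟨triMat (-l) (-c), det_triMat _ _, ?_⟩
  rw [Matrix.inv_eq_right_inv (triMat_mul_neg l c)]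

/-- The sense of rotation of a matrix conjugate to a rotation can be read off an entry. -/
lemma ConjSL.pos_of_rot {A : RMat} {φ : ℝ} (h : ConjSL A (rot φ))
    (hs : Real.sin (2 * Real.pi * φ) ≠ 0) : 0 < A 0 1 * Real.sin (2 * Real.pi * φ) := by
  obtain ⟨P, hP, rfl⟩ := h
  have hPd := hP
  rw [Matrix.det_fin_two] at hPd
  have hinv : P⁻¹ = P.adjugate := by
    rw [Matrix.inv_def, hP]; simp
  have h1 : (P⁻¹ * rot φ * P) 0 1 = Real.sin (2 * Real.pi * φ) * (P 1 1 ^ 2 + P 0 1 ^ 2) := by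
    rw [hinv, Matrix.adjugate_fin_two]
    simp [Matrix.mul_apply, Fin.sum_univ_two, rot]
    ring
  have h2 : 0 < P 1 1 ^ 2 + P 0 1 ^ 2 := by
    rcases eq_or_ne (P 1 1) 0 with h | h
    · have : P 0 1 ≠ 0 := fun h' => by rw [h, h'] at hPd; norm_num at hPd
      positivity
    · positivity
  rw [h1]
  have : 0 < Real.sin (2 * Real.pi * φ) ^ 2 := by positivity
  nlinarith

end NormalForm

section RealEigenvalue

/-- If `2 cos(2πξ)` is real then `ξ` is real or `2 Re ξ` is an integer. -/
lemma real_or_half_int_of_trace {ξ : ℂ} {T : ℝ} (h : (T : ℂ) =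
    Complex.exp (2 * Real.pi * ξ * Complex.I) + Complex.exp (-(2 * Real.pi * ξ * Complex.I))) :
    ξ = (ξ.re : ℂ) ∨ ∃ m : ℤ, 2 * ξ.re = m := by
  have hc : (T : ℂ) = 2 * Complex.cos (2 * Real.pi * ξ) := by
    rw [h, Complex.two_cos]; ring_nf
  have e : (2 * Real.pi * ξ : ℂ) = ((2 * Real.pi * ξ.re : ℝ) : ℂ) +
      ((2 * Real.pi * ξ.im : ℝ) : ℂ) * Complex.I := by
    conv_lhs => rw [← Complex.re_add_im ξ]
    push_cast; ring
  have h2 : (T : ℂ) = ((2 * (Real.cos (2 * Real.pi * ξ.re) * Real.cosh (2 * Real.pi * ξ.im)) : ℝ) : ℂ) +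
      ((-(2 * (Real.sin (2 * Real.pi * ξ.re) * Real.sinh (2 * Real.pi * ξ.im))) : ℝ) : ℂ) *
        Complex.I := by
    rw [hc, e, Complex.cos_add_mul_I]
    simp only [Complex.ofReal_mul, Complex.ofReal_neg, Complex.ofReal_cos, Complex.ofReal_sin,
      Complex.ofReal_cosh, Complex.ofReal_sinh, Complex.ofReal_ofNat]
    ring
  have h1 := congrArg Complex.im h2
  rw [Complex.add_im, Complex.im_ofReal_mul, Complex.ofReal_im, Complex.ofReal_im, Complex.I_im,
    mul_one, zero_add, eq_comm, neg_eq_zero, mul_eq_zero_iff_left two_ne_zero, mul_eq_zero,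
    Real.sinh_eq_zero, mul_eq_zero_iff_left Real.two_pi_pos.ne'] at h1
  rcases h1 with h1 | h1
  · right
    obtain ⟨m, hm⟩ := Real.sin_eq_zero_iff.1 h1
    refine ⟨m, ?_⟩
    have := Real.pi_pos.ne'
    field_simp at hm
    linarith
  · left
    exact Complex.ext (by simp) (by simpa using h1)

lemma two_mul_torusDist_le_abs_sin (u : ℝ) :
    2 * torusDist (u : ℂ) ≤ |Real.sin (Real.pi * u)| := by
  set m := round u with hm
  have h1 : |u - m| ≤ 1 / 2 := abs_sub_round u
  have h2 : |Real.sin (Real.pi * u)| = |Real.sin (Real.pi * (u - m))| := by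
    have : Real.pi * u = Real.pi * (u - m) + m * Real.pi := by ring
    rw [this, Real.sin_add_int_mul_pi, abs_mul, abs_zpow, abs_neg, abs_one, one_zpow, one_mul]
  have h3 : |Real.pi * (u - m)| ≤ Real.pi / 2 := by
    rw [abs_mul, abs_of_pos Real.pi_pos]
    nlinarith [Real.pi_pos]
  have h4 := Real.mul_abs_le_abs_sin h3
  rw [abs_mul, abs_of_pos Real.pi_pos] at h4
  have h5 : 2 / Real.pi * (Real.pi * |u - m|) = 2 * |u - m| := by
    field_simp
  have h6 := torusDist_le (u : ℂ) m
  rw [← Complex.ofReal_intCast, ← Complex.ofReal_sub, Complex.norm_real, Real.norm_eq_abs] at h6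
  rw [h2]
  linarith

end RealEigenvalue

section Diophantine

variable {d : ℕ} {γ τ p N : ℝ} {α : Fin d → ℝ}

lemma DC.lower_bound (hα : α ∈ DC d γ τ) (hγ : 0 < γ) (hτ : 0 < τ) (hp : 0 < p)
    (hγp : 2 ^ (τ + 1) / γ ≤ p⁻¹) (hN : 0 < N) (hNτ : N ^ τ = p⁻¹ ^ 50) {k : Fin d → ℤ} (hk : k ≠ 0)
    (hkN : l1 k ≤ 2 * N) : 2 * p ^ 51 ≤ torusDist ((pairing k α : ℝ) : ℂ) := by
  refine le_trans ?_ (hα k hk)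
  have hl : 0 < l1 k := l1_pos_iff.2 hk
  have h1 : l1 k ^ τ ≤ 2 ^ τ * p⁻¹ ^ 50 := by
    rw [← hNτ, ← Real.mul_rpow two_pos.le hN.le]
    exact Real.rpow_le_rpow hl.le hkN hτ.le
  rw [le_div_iff₀ (Real.rpow_pos_of_pos hl τ)]
  have h2 : 2 ^ τ * 2 * p ≤ γ := by
    rw [Real.rpow_add two_pos, Real.rpow_one, div_le_iff₀ hγ] at hγp
    calc 2 ^ τ * 2 * p ≤ p⁻¹ * γ * p := by gcongr
      _ = γ := by field_simp
  calc 2 * p ^ 51 * l1 k ^ τ ≤ 2 * p ^ 51 * (2 ^ τ * p⁻¹ ^ 50) := by gcongr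
    _ = 2 ^ τ * 2 * p * (p⁻¹ ^ 50 * p ^ (50 + 0)) := by ring
    _ ≤ γ := by rw [inv_pow_mul_pow hp.ne', pow_zero, mul_one]; exact h2

end Diophantine

lemma det_smul_exp {a : RMat} (ha : a.trace = 0) (j : ℤ) :
    (((-1 : ℝ) ^ j) • NormedSpace.exp a).det = 1 := by
  have h1 : ((NormedSpace.exp a).det : ℂ) = 1 := by
    rw [← det_toC, toC_exp, det_exp_two]
    have : (toC a).trace = (a.trace : ℂ) := by simp [Matrix.trace_fin_two, toC_apply]
    rw [this, ha, Complex.ofReal_zero, Complex.exp_zero]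
  have h2 : (NormedSpace.exp a).det = 1 := by exact_mod_cast h1
  rw [Matrix.det_smul, h2, mul_one, Fintype.card_fin, ← zpow_natCast, ← zpow_mul, mul_comm,
    zpow_mul]
  norm_num

set_option maxHeartbeats 1000000 in
/-- The step in the presence of a resonance, with the smallness expressed through a parameter. -/
theorem resonant_step {d : ℕ} {γ τ ν r r' ε p : ℝ} {α : Fin d → ℝ} {A : RMat}
    {f : (Fin d → ℝ) → RMat} {ξ : ℂ} {n : Fin d → ℤ} (hγ : 0 < γ) (hτ : 0 < τ) (hν : 0 < ν)
    (hν1 : ν < 1) (hr' : 0 < r') (hrr : r' < r) (hα : α ∈ DC d γ τ) (hA : A.det = 1)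
    (hξ : HasEigenvaluesExp A ξ) (hf : MemGevreysl 1 ν r f) (hfε : gevreyNorm 1 ν r f < ε)
    (hp : 0 < p) (hp6 : p ≤ 1 / 1000000) (hε : ε = p ^ 1100) (hAp : canonNorm A ≤ p⁻¹)
    (hγp : 2 ^ (τ + 1) / γ ≤ p⁻¹) (hN : truncN ν r r' ε ^ τ ≤ p⁻¹ ^ 2)
    (hb : resBound ν τ r r' ε ≤ ε ^ 2) (hn : 0 < l1 n) (hnN : l1 n ≤ truncN ν r r' ε)
    (hres : resDist ξ α n < p ^ 55) :
    ∃ (B : (Fin d → ℝ) → RMat) (A' : RMat) (f' : (Fin d → ℝ) → RMat),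
      MemGevreySL 2 ν r' B ∧ A'.det = 1 ∧ MemGevreysl 1 ν r' f' ∧
      (∀ θ, (B (θ + α))⁻¹ * (A * NormedSpace.exp (f θ)) * B θ = A' * NormedSpace.exp (f' θ)) ∧
      ResEstimates γ τ ν r r' ε α ξ n A A' B f' := by
  have hd0 : 0 < r - r' := sub_pos.2 hrr
  have hε0 : 0 < ε := by rw [hε]; positivity
  have hpp : ∀ n : ℕ, 0 < p ^ n := fun n => pow_pos hp n
  have hsmall : ∀ m n : ℕ, m < n → 1000000 * p ^ n ≤ p ^ m := fun m n => pow_le_of_le hp hp6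
  set P := p⁻¹ with hPdef
  have hP6 : 1000000 ≤ P := by
    rw [hPdef, le_inv_comm₀ (by norm_num) hp]; linarith
  have hP1 : 1 ≤ P := by linarith
  have hP0 : 0 < P := by linarith
  have hPp : P * p = 1 := inv_mul_cancel₀ hp.ne'
  have hε1 : ε < 1 := by
    have := hsmall 0 1100 (by norm_num)
    rw [pow_zero, ← hε] at this; linarith
  have hεpow : ∀ (m : ℕ) (s : ℝ), 1100 * s = m → ε ^ s = p ^ m := fun m s h => by
    rw [hε, ← Real.rpow_natCast, ← Real.rpow_mul hp.le, ← Real.rpow_natCast]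
    congr 1
  have h55 : ε ^ (1 / 20 : ℝ) = p ^ 55 := hεpow 55 _ (by norm_num)
  have h825 : ε ^ (3 / 4 : ℝ) = p ^ 825 := hεpow 825 _ (by norm_num)
  -- the truncation
  set N := ε ^ (-(10 / 11 * ((1 / 20) / τ))) with hNdef
  have hN0 : 0 < N := Real.rpow_pos_of_pos hε0 _
  have hNτ : N ^ τ = P ^ 50 := by
    rw [hNdef, ← Real.rpow_mul hε0.le]
    have e : -(10 / 11 * ((1 / 20) / τ)) * τ = -(1 / 22) := by field_simp; norm_num
    rw [e, Real.rpow_neg hε0.le, hεpow 50 _ (by norm_num), hPdef, inv_pow]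
  have hNν : N ^ ν = ε ^ (-(10 * ν / 11 * ((1 / 20) / τ))) := by
    rw [hNdef, ← Real.rpow_mul hε0.le]; congr 1; ring
  have hT0 : 0 ≤ truncN ν r r' ε := hn.le.trans hnN
  have hTN : truncN ν r r' ε ≤ N := by
    rw [← Real.rpow_le_rpow_iff hT0 hN0.le hτ, hNτ]
    exact hN.trans (pow_le_pow_right₀ hP1 (by norm_num))
  have hnN' : l1 n ≤ N := hnN.trans hTN
  have hn0 : n ≠ 0 := l1_pos_iff.1 hn
  have hnτ : l1 n ^ τ ≤ P ^ 2 := (Real.rpow_le_rpow hn.le hnN hτ.le).trans hN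
  have hnτ0 : 0 < l1 n ^ τ := Real.rpow_pos_of_pos hn τ
  have hγP : 2 * γ⁻¹ ≤ P := by
    refine le_trans ?_ hγp
    rw [div_eq_mul_inv]
    gcongr
    calc (2 : ℝ) = 2 ^ (1 : ℝ) := (Real.rpow_one 2).symm
      _ ≤ 2 ^ (τ + 1) := Real.rpow_le_rpow_of_exponent_le one_le_two (by linarith)
  set G := γ / l1 n ^ τ with hG
  have hG0 : 0 < G := by positivity
  have hGi : G⁻¹ = γ⁻¹ * l1 n ^ τ := by rw [hG, inv_div, div_eq_inv_mul]
  have hGp : 2 * p ^ 55 ≤ G := by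
    have h1 : 2 * G⁻¹ ≤ P ^ 3 := by
      calc 2 * G⁻¹ = 2 * γ⁻¹ * l1 n ^ τ := by rw [hGi]; ring
        _ ≤ P * P ^ 2 := by gcongr
        _ = _ := by ring
    have h2 : 2 * p ^ 3 ≤ G := by
      have h3 : G * (2 * G⁻¹) ≤ G * P ^ 3 := by gcongr
      have h4 : G * G⁻¹ = 1 := mul_inv_cancel₀ hG0.ne'
      have h5 : P ^ 3 * p ^ 3 = 1 := by rw [← mul_pow, hPp, one_pow]
      nlinarith [hpp 3]
    linarith [hsmall 3 55 (by norm_num), hpp 55]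
  have hGd : G ≤ torusDist ((pairing n α : ℝ) : ℂ) := hα n hn0
  obtain ⟨j, hj⟩ := exists_of_torusDist_lt hres
  -- the eigenvalue is real
  have hreal : ξ = (ξ.re : ℂ) := by
    refine (real_or_half_int_of_trace (trace_eq_of_hasEigenvaluesExp hξ)).resolve_right ?_
    rintro ⟨m, hm⟩
    have h1 := (Complex.abs_re_le_norm _).trans_lt hj
    have h2 := torusDist_le ((pairing n α : ℝ) : ℂ) (m - j)
    rw [← Complex.ofReal_intCast, ← Complex.ofReal_sub, Complex.norm_real, Real.norm_eq_abs] at h2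
    have h3 : (2 * ξ - ((pairing n α : ℝ) : ℂ) - (j : ℂ)).re = 2 * ξ.re - pairing n α - j := by
      simp
    rw [h3, hm, abs_sub_comm] at h1
    have h4 : |pairing n α - ((m - j : ℤ) : ℝ)| = |(j : ℝ) - (m - pairing n α)| := by
      congr 1; push_cast; ring
    rw [h4] at h2
    linarith [hpp 55]
  set x := ξ.re with hx
  have hjx : |2 * x - pairing n α - j| < p ^ 55 := by
    have e : 2 * ξ - ((pairing n α : ℝ) : ℂ) - (j : ℂ) = ((2 * x - pairing n α - j : ℝ) : ℂ) := by
      rw [hreal]; push_cast; ring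
    rwa [e, Complex.norm_real, Real.norm_eq_abs] at hj
  have hz : torusDist ((2 * x - pairing n α : ℝ) : ℂ) < p ^ 55 := by
    have e : 2 * ξ - ((pairing n α : ℝ) : ℂ) = ((2 * x - pairing n α : ℝ) : ℂ) := by
      rw [hreal]; push_cast; ring
    rwa [resDist, e] at hres
  have hsin : G ≤ |Real.sin (2 * Real.pi * x)| := by
    have h1 := two_mul_torusDist_le_abs_sin (2 * x)
    have h2 := torusDist_add_le ((2 * x : ℝ) : ℂ) (-((2 * x - pairing n α : ℝ) : ℂ))
    rw [torusDist_neg] at h2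
    have e : ((2 * x : ℝ) : ℂ) + -((2 * x - pairing n α : ℝ) : ℂ) = ((pairing n α : ℝ) : ℂ) := by
      push_cast; ring
    rw [e] at h2
    rw [show 2 * Real.pi * x = Real.pi * (2 * x) by ring]
    linarith
  have hsin0 : Real.sin (2 * Real.pi * x) ≠ 0 := abs_pos.1 (hG0.trans_le hsin)
  have htrA : A.trace = 2 * Real.cos (2 * Real.pi * x) := by
    have h1 := trace_eq_of_hasEigenvaluesExp hξ
    have h2 : (A.trace : ℂ) = ((2 * Real.cos (2 * Real.pi * x) : ℝ) : ℂ) := by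
      rw [h1, hreal]
      push_cast
      rw [Complex.two_cos]; ring_nf
    exact_mod_cast h2
  obtain ⟨e, l, c, he, hform, hq1, hq2⟩ := exists_rotation_form hA htrA hsin0
  set q := √(2 * canonNorm A * G⁻¹) with hq
  have hA1 := one_le_canonNorm hA
  have hqle : √(2 * canonNorm A / |Real.sin (2 * Real.pi * x)|) ≤ q := by
    refine Real.sqrt_le_sqrt ?_
    rw [div_eq_mul_inv]
    gcongr
  have hqq : q ^ 2 = 2 * canonNorm A * G⁻¹ := Real.sq_sqrt (by positivity)
  have hq5 : q ^ 2 ≤ P ^ 5 := by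
    rw [hqq, hGi]
    have h2 : 0 < γ⁻¹ := inv_pos.2 hγ
    calc 2 * canonNorm A * (γ⁻¹ * l1 n ^ τ) = canonNorm A * (2 * γ⁻¹) * l1 n ^ τ := by ring
      _ ≤ P * P * P ^ 2 := by gcongr
      _ = P ^ 4 := by ring
      _ ≤ _ := pow_le_pow_right₀ hP1 (by norm_num)
  -- the resonant site, up to sign
  have hl1 : l1 (e • n) = l1 n := by
    rcases he with rfl | rfl
    · rw [one_smul]
    · rw [neg_one_smul, l1_neg]
  have hpair : pairing (e • n) α = e * pairing n α := by
    rcases he with rfl | rfl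
    · rw [one_smul]; simp
    · rw [neg_one_smul, pairing_neg]; simp
  have hdiv : ∀ i i', ∀ k : Fin d → ℤ, k ≠ entryWt i i' • (e • n) → l1 k ≤ N →
      p ^ 55 ≤ torusDist ((pairing k α - entryWt i i' * (2 * (e * x)) : ℝ) : ℂ) := by
    intro i i' k hk hkN
    have h1 : k - entryWt i i' • (e • n) ≠ 0 := sub_ne_zero.2 hk
    have h2 : l1 (k - entryWt i i' • (e • n)) ≤ 2 * N := by
      have := l1_sub_le k (entryWt i i' • (e • n))
      have h3 := l1_entryWt_le (e • n) i i'
      rw [hl1] at h3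
      linarith
    have h3 := DC.lower_bound hα hγ hτ hp hγp hN0 hNτ h1 h2
    have hsm : pairing (entryWt i i' • (e • n)) α = entryWt i i' * (e * pairing n α) := by
      rw [← hpair]
      rcases entryWt_cases i i' with h | h | h <;> rw [h]
      · rw [zero_smul, pairing_zero]; simp
      · rw [one_smul]; simp
      · rw [neg_one_smul, pairing_neg]; simp
    have h4 : torusDist ((((entryWt i i' * e : ℤ) : ℝ) * (2 * x - pairing n α) : ℝ) : ℂ) ≤ p ^ 55 := by
      have hs : entryWt i i' * e = 0 ∨ entryWt i i' * e = 1 ∨ entryWt i i' * e = -1 := by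
        rcases entryWt_cases i i' with h | h | h <;> rcases he with h' | h' <;> rw [h, h'] <;>
          norm_num
      rcases hs with h | h | h <;> rw [h]
      · rw [Int.cast_zero, zero_mul]
        refine (torusDist_le _ 0).trans ?_
        simpa using (hpp 55).le
      · rw [Int.cast_one, one_mul]; exact hz.le
      · rw [Int.cast_neg, Int.cast_one, neg_one_mul, Complex.ofReal_neg, torusDist_neg]; exact hz.le
    have h5 := torusDist_add_le ((pairing k α - entryWt i i' * (2 * (e * x)) : ℝ) : ℂ)
      ((((entryWt i i' * e : ℤ) : ℝ) * (2 * x - pairing n α) : ℝ) : ℂ)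
    have h6 : ((pairing k α - entryWt i i' * (2 * (e * x)) : ℝ) : ℂ) +
        ((((entryWt i i' * e : ℤ) : ℝ) * (2 * x - pairing n α) : ℝ) : ℂ) =
        ((pairing (k - entryWt i i' • (e • n)) α : ℝ) : ℂ) := by
      rw [pairing_sub, hsm]; push_cast; ring
    rw [h6] at h5
    linarith [hsmall 51 55 (by norm_num), hpp 51]
  have hres' : |2 * (e * x) - pairing (e • n) α - (e * j : ℤ)| < p ^ 55 := by
    have h1 : 2 * (e * x) - pairing (e • n) α - (e * j : ℤ) = e * (2 * x - pairing n α - j) := by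
      rw [hpair]; push_cast; ring
    rw [h1, abs_mul]
    rcases he with rfl | rfl <;> simpa using hjx
  -- the tail
  set η := ε ^ (-(2 * r' / (r - r'))) *
    Real.exp (-((r - r') * ε ^ (-(10 * ν / 11 * ((1 / 20) / τ))))) with hη
  have hη0 : 0 ≤ η := by positivity
  have hηb : p ^ 825 * η = resBound ν τ r r' ε := by
    rw [resBound, hη, ← h825, ← mul_assoc, ← Real.rpow_add hε0, ← sub_eq_add_neg]
  have hηe : η = Real.exp (r' * (2 * |Real.log ε| / (r - r')) - (r - r') * N ^ ν) := by
    rw [hη, ← hNν, Real.rpow_def_of_pos hε0, ← Real.exp_add, abs_of_neg (Real.log_neg hε0 hε1)]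
    congr 1
    ring
  have hnν : (2 * Real.pi * l1 n) ^ ν ≤ 2 * |Real.log ε| / (r - r') := by
    have hb0 : 0 ≤ 2 * |Real.log ε| / (r - r') := by positivity
    have h1 : 2 * Real.pi * l1 n ≤ (2 * |Real.log ε| / (r - r')) ^ (1 / ν) := by
      have := mul_le_mul_of_nonneg_left hnN Real.two_pi_pos.le
      rw [truncN] at this
      refine this.trans (le_of_eq ?_)
      field_simp
    calc (2 * Real.pi * l1 n) ^ ν ≤ ((2 * |Real.log ε| / (r - r')) ^ (1 / ν)) ^ ν :=
          Real.rpow_le_rpow (by positivity) h1 hν.le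
      _ = _ := by rw [← Real.rpow_mul hb0, one_div_mul_cancel hν.ne', Real.rpow_one]
  have htail : ∀ k : Fin d → ℤ, N < l1 k → Real.exp (r' * (2 * Real.pi / 1 * l1 (e • n)) ^ ν) *
      Real.exp (r' * (2 * Real.pi / 1 * l1 k) ^ ν) ≤
        η * Real.exp (r * (2 * Real.pi / 1 * l1 k) ^ ν) := by
    intro k hk
    rw [hηe, ← Real.exp_add, ← Real.exp_add, hl1, div_one]
    refine Real.exp_le_exp.2 ?_
    have h1 : N ^ ν ≤ (2 * Real.pi * l1 k) ^ ν := by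
      refine Real.rpow_le_rpow hN0.le ?_ hν.le
      calc N ≤ 1 * l1 k := by rw [one_mul]; exact hk.le
        _ ≤ 2 * Real.pi * l1 k :=
          mul_le_mul_of_nonneg_right (by linarith [Real.pi_gt_three]) (hN0.trans hk).le
    have h2 := mul_le_mul_of_nonneg_left hnν hr'.le
    have h3 := mul_le_mul_of_nonneg_left h1 hd0.le
    linarith
  have hηle : p ^ 825 * η ≤ 1 := by
    rw [hηb]
    exact hb.trans (pow_le_one₀ hε0.le hε1.le)
  obtain ⟨y, a, t, μ, f', hy, hyn, hytr, hf', hatr, hid, hacan, hamat, ht, hμ, hfn⟩ :=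
    resonant_core (N := N) (η := η) (x := e * x) (n := e • n) (j := e * j) (α := α) hν hν1 hr' hrr hf
      (hfε.le.trans hε.le) hp hp6 hform (hq1.trans hqle) (hq2.trans hqle) hq5 hdiv hres'
      (hl1.trans_le hnN') hη0 hηle htail
  have hsign : ((-1 : ℝ)) ^ (e * j) = (-1) ^ j := by
    rcases he with rfl | rfl
    · rw [one_mul]
    · rw [neg_one_mul, zpow_neg, ← inv_zpow, inv_neg, inv_one]
  rw [hsign] at hid
  rw [hl1] at hμ
  have hBg := fun (r'' : ℝ) (h0 : 0 < r'') (h1 : r'' ≤ r') => gevrey_resConj (c := c) (l := l)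
    (n := e • n) hν hν1 h0.le (h1.trans hrr.le) hy hyn (hq1.trans hqle)
  have hconj : ConjSL A (rot (e * x)) := by
    rw [hform]; exact conjSL_triMat l c _
  have hexcl : ¬ (ConjSL A (rot x) ∧ ConjSL A (rot (-x))) := by
    rintro ⟨h1, h2⟩
    have h3 := h1.pos_of_rot hsin0
    have e1 : Real.sin (2 * Real.pi * -x) = -Real.sin (2 * Real.pi * x) := by
      rw [mul_neg, Real.sin_neg]
    have h4 := h2.pos_of_rot (by rw [e1]; exact neg_ne_zero.2 hsin0)
    rw [e1] at h4
    linarith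
  have hdeg : HasDegree (resConj l c y (e • n)) (e • n) := hasDegree_resConj hy hytr
  refine ⟨resConj l c y (e • n), ((-1 : ℝ) ^ j) • NormedSpace.exp a, f',
    ⟨(hBg r' hr' le_rfl).1, det_resConj hy hytr⟩, det_smul_exp hatr j, hf', hid,
    ⟨a, t, μ, fun j' hj' => ?_, ?_, hamat, ?_, ?_⟩, ?_, hb, fun r'' h0 h1 => ?_,
    fun x1 hx1 => ?_, x, hreal, ?_⟩
  · have hjj : j' = j := by
      have h1 := norm_sub_le (2 * ξ - ((pairing n α : ℝ) : ℂ) - (j : ℂ))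
        (2 * ξ - ((pairing n α : ℝ) : ℂ) - (j' : ℂ))
      have h2 : (2 * ξ - ((pairing n α : ℝ) : ℂ) - (j : ℂ)) -
          (2 * ξ - ((pairing n α : ℝ) : ℂ) - (j' : ℂ)) = (((j' - j : ℤ) : ℝ) : ℂ) := by
        push_cast; ring
      rw [h2, Complex.norm_real, Real.norm_eq_abs, ← Int.cast_abs] at h1
      rw [h55] at hj'
      have h3 : ((|j' - j| : ℤ) : ℝ) < 1 := by
        have := hsmall 0 55 (by norm_num)
        rw [pow_zero] at this
        linarith
      have h4 : |j' - j| < 1 := by exact_mod_cast h3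
      rw [Int.abs_lt_one_iff] at h4
      omega
    rw [hjj]
  · rw [h55]; exact hacan
  · rw [h55]; exact ht
  · rw [h825]; exact hμ
  · rw [← hηb]; exact hfn
  · refine (hBg r'' h0 h1).2.trans ?_
    rw [hl1]
    refine mul_le_mul_of_nonneg_right ?_ (Real.exp_pos _).le
    set R := γ ^ (-(1 / 2) : ℝ) * canonNorm A ^ (1 / 2 : ℝ) * l1 n ^ (τ / 2) with hR
    have hA0 : 0 ≤ canonNorm A := zero_le_one.trans hA1
    have hR0 : 0 ≤ R := by positivity
    have hR2 : R ^ 2 = γ⁻¹ * canonNorm A * l1 n ^ τ := by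
      rw [hR, mul_pow, mul_pow, ← Real.rpow_natCast, ← Real.rpow_natCast, ← Real.rpow_natCast,
        ← Real.rpow_mul hγ.le, ← Real.rpow_mul hA0, ← Real.rpow_mul hn.le]
      have e1 : (-(1 / 2) : ℝ) * ((2 : ℕ) : ℝ) = -1 := by norm_num
      have e2 : (1 / 2 : ℝ) * ((2 : ℕ) : ℝ) = 1 := by norm_num
      have e3 : τ / 2 * ((2 : ℕ) : ℝ) = τ := by push_cast; ring
      rw [e1, e2, e3, Real.rpow_one, Real.rpow_neg_one]
    have h1 : q ≤ 3 * R := by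
      rw [hq, Real.sqrt_le_iff]
      refine ⟨by positivity, ?_⟩
      rw [mul_pow, hR2, hGi]
      have : 0 ≤ γ⁻¹ * canonNorm A * l1 n ^ τ := by positivity
      linarith
    calc 10 * q ≤ 10 * (3 * R) := by linarith
      _ ≤ 32 * R := by linarith
      _ = _ := by rw [hR]; ring
  · have hxx : x1 = x := by rw [hx, hx1, Complex.ofReal_re]
    rw [hxx]
    constructor
    · intro h
      rcases he with rfl | rfl
      · rwa [one_smul] at hdeg ⊢
      · exact absurd ⟨h, by simpa using hconj⟩ hexcl
    · intro h
      rcases he with rfl | rfl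
      · exact absurd ⟨by simpa using hconj, h⟩ hexcl
      · rwa [neg_one_smul] at hdeg ⊢
  · rcases he with rfl | rfl
    · left; simpa using hconj
    · right; simpa using hconj

lemma eq_of_resDist_lt {d : ℕ} {γ τ p N : ℝ} {α : Fin d → ℝ} {ξ : ℂ} {n m : Fin d → ℤ}
    (hα : α ∈ DC d γ τ) (hγ : 0 < γ) (hτ : 0 < τ) (hp : 0 < p) (hp1 : p ≤ 1)
    (hγp : 2 ^ (τ + 1) / γ ≤ p⁻¹) (hN : 0 < N) (hNτ : N ^ τ = p⁻¹ ^ 50) (hn : l1 n ≤ N)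
    (hm : l1 m ≤ N) (hnr : resDist ξ α n < p ^ 55) (hmr : resDist ξ α m < p ^ 55) : n = m := by
  by_contra hne
  have h1 := DC.lower_bound hα hγ hτ hp hγp hN hNτ (sub_ne_zero.2 hne)
    ((l1_sub_le n m).trans (by linarith))
  have h2 := torusDist_add_le (2 * ξ - ((pairing m α : ℝ) : ℂ))
    (-(2 * ξ - ((pairing n α : ℝ) : ℂ)))
  have e : 2 * ξ - ((pairing m α : ℝ) : ℂ) + -(2 * ξ - ((pairing n α : ℝ) : ℂ)) =
      ((pairing (n - m) α : ℝ) : ℂ) := by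
    rw [pairing_sub]; push_cast; ring
  rw [torusDist_neg, e] at h2
  have h3 : p ^ 55 ≤ p ^ 51 := pow_le_pow_of_le_one hp.le hp1 (by norm_num)
  rw [resDist] at hnr hmr
  linarith

lemma exp_tail_le {d : ℕ} {ν r r' ε : ℝ} (hν : 0 < ν) (hrr : r' < r) (hε : 0 < ε)
    (hε1 : ε < 1) {k : Fin d → ℤ} (hk : truncN ν r r' ε < l1 k) :
    Real.exp (r' * (2 * Real.pi / 1 * l1 k) ^ ν) ≤
      ε ^ 2 * Real.exp (r * (2 * Real.pi / 1 * l1 k) ^ ν) := by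
  have hd0 : 0 < r - r' := sub_pos.2 hrr
  have hb0 : 0 ≤ 2 * |Real.log ε| / (r - r') := by positivity
  have h1 : (2 * |Real.log ε| / (r - r')) ^ (1 / ν) ≤ 2 * Real.pi * l1 k := by
    have := mul_le_mul_of_nonneg_left hk.le Real.two_pi_pos.le
    rw [truncN] at this
    refine le_trans (le_of_eq ?_) this
    field_simp
  have h2 : 2 * |Real.log ε| / (r - r') ≤ (2 * Real.pi * l1 k) ^ ν := by
    calc _ = ((2 * |Real.log ε| / (r - r')) ^ (1 / ν)) ^ ν := by
          rw [← Real.rpow_mul hb0, one_div_mul_cancel hν.ne', Real.rpow_one]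
      _ ≤ _ := Real.rpow_le_rpow (by positivity) h1 hν.le
  rw [div_le_iff₀ hd0, abs_of_neg (Real.log_neg hε hε1)] at h2
  rw [div_one, ← Real.exp_log (pow_pos hε 2), ← Real.exp_add, Real.log_pow]
  refine Real.exp_le_exp.2 ?_
  push_cast
  linarith

set_option maxHeartbeats 1000000 in
theorem kam_step {d : ℕ} {γ τ ν r r' ε p : ℝ} {α : Fin d → ℝ} {A : RMat}
    {f : (Fin d → ℝ) → RMat} {ξ : ℂ} (hγ : 0 < γ) (hτ : 0 < τ) (hν : 0 < ν)
    (hν1 : ν < 1) (hr' : 0 < r') (hrr : r' < r) (hα : α ∈ DC d γ τ) (hA : A.det = 1)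
    (hξ : HasEigenvaluesExp A ξ) (hf : MemGevreysl 1 ν r f) (hfε : gevreyNorm 1 ν r f < ε)
    (hp : 0 < p) (hp6 : p ≤ 1 / 1000000) (hε : ε = p ^ 1100) (hAp : canonNorm A ≤ p⁻¹)
    (hγp : 2 ^ (τ + 1) / γ ≤ p⁻¹) (hN : truncN ν r r' ε ^ τ ≤ p⁻¹ ^ 2)
    (hb : resBound ν τ r r' ε ≤ ε ^ 2) :
    ∃ (B : (Fin d → ℝ) → RMat) (A' : RMat) (f' : (Fin d → ℝ) → RMat),
      MemGevreySL 2 ν r' B ∧ A'.det = 1 ∧ MemGevreysl 1 ν r' f' ∧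
      (∀ θ, (B (θ + α))⁻¹ * (A * NormedSpace.exp (f θ)) * B θ = A' * NormedSpace.exp (f' θ)) ∧
      ((∀ n : Fin d → ℤ, 0 < l1 n → l1 n ≤ truncN ν r r' ε → p ^ 55 ≤ resDist ξ α n) →
        NonresEstimates ν r' ε A A' B f') ∧
      (∀ n : Fin d → ℤ, 0 < l1 n → l1 n ≤ truncN ν r r' ε → resDist ξ α n < p ^ 55 →
        ResEstimates γ τ ν r r' ε α ξ n A A' B f') := by
  have hp1 : p ≤ 1 := by linarith
  have hε0 : 0 < ε := by rw [hε]; positivity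
  have hε1 : ε < 1 := by rw [hε]; exact pow_lt_one₀ hp.le (by linarith) (by norm_num)
  have hP1 : 1 ≤ p⁻¹ := (one_le_inv₀ hp).2 hp1
  set N := (p⁻¹ ^ 50) ^ τ⁻¹ with hNdef
  have hN0 : 0 < N := by positivity
  have hNτ : N ^ τ = p⁻¹ ^ 50 := Real.rpow_inv_rpow (by positivity) hτ.ne'
  have hT0 : 0 ≤ truncN ν r r' ε := by
    have : 0 < r - r' := sub_pos.2 hrr
    rw [truncN]; positivity
  have hTN : truncN ν r r' ε ≤ N := by
    rw [← Real.rpow_le_rpow_iff hT0 hN0.le hτ, hNτ]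
    exact hN.trans (pow_le_pow_right₀ hP1 (by norm_num))
  by_cases hex : ∃ n : Fin d → ℤ, 0 < l1 n ∧ l1 n ≤ truncN ν r r' ε ∧ resDist ξ α n < p ^ 55
  · obtain ⟨n, hn, hnN, hres⟩ := hex
    obtain ⟨B, A', f', hB, hA', hf', hid, hest⟩ := resonant_step hγ hτ hν hν1 hr' hrr hα hA hξ hf
      hfε hp hp6 hε hAp hγp hN hb hn hnN hres
    refine ⟨B, A', f', hB, hA', hf', hid, fun h => ?_, fun m hm hmN hmres => ?_⟩
    · exact absurd (h n hn hnN) (not_le.2 hres)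
    · rwa [← eq_of_resDist_lt hα hγ hτ hp hp1 hγp hN0 hNτ (hnN.trans hTN) (hmN.trans hTN) hres
        hmres]
  · push Not at hex
    have hdiv : ∀ k : Fin d → ℤ, 0 < l1 k → l1 k ≤ truncN ν r r' ε →
        p ^ 55 ≤ torusDist ((pairing k α : ℝ) : ℂ) := fun k hk hkN => by
      have h1 := DC.lower_bound hα hγ hτ hp hγp hN0 hNτ (l1_pos_iff.1 hk) (by linarith)
      have h2 : p ^ 55 ≤ p ^ 51 := pow_le_pow_of_le_one hp.le hp1 (by norm_num)
      have h3 : 0 < p ^ 51 := pow_pos hp _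
      linarith
    obtain ⟨B, A', f', hB, hA', hf', hid, hest⟩ := nonresonant_step (N := truncN ν r r' ε) (α := α)
      hν hν1 hr' hrr hA hξ hf hfε hp hp6 hε hAp hdiv hex
      (fun k hk => exp_tail_le hν hrr hε0 hε1 hk)
    exact ⟨B, A', f', hB, hA', hf', hid, fun _ => hest,
      fun m hm hmN hmres => absurd (hex m hm hmN) (not_le.2 hmres)⟩

theorem proposition4p1 :
    ∃ D : ℝ, 0 < D ∧
    ∀ (d : ℕ) (γ τ ν : ℝ), 1 ≤ d → 0 < γ → γ < 1 → (d : ℝ) < τ → 0 < ν → ν < 1 →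
    ∃ c : ℝ, 0 < c ∧
      (∀ (α : Fin d → ℝ) (r r' ε : ℝ) (A : RMat) (f : (Fin d → ℝ) → RMat) (ξ : ℂ),
        α ∈ DC d γ τ → 0 < r' → r' < r →
        A.det = 1 → HasEigenvaluesExp A ξ →
        MemGevreysl 1 ν r f → gevreyNorm 1 ν r f < ε →
        ε ≤ c * canonNorm A ^ (-D) * (min 1 (1 / r) * (r - r')) ^ (D * τ / ν) →
        ∃ (B : (Fin d → ℝ) → RMat) (A' : RMat) (f' : (Fin d → ℝ) → RMat),
          MemGevreySL 2 ν r' B ∧ A'.det = 1 ∧ MemGevreysl 1 ν r' f' ∧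
          (∀ θ, (B (θ + α))⁻¹ * (A * NormedSpace.exp (f θ)) * B θ =
            A' * NormedSpace.exp (f' θ)) ∧
          ((∀ n : Fin d → ℤ, 0 < l1 n → l1 n ≤ truncN ν r r' ε →
              ε ^ (1 / 20 : ℝ) ≤ resDist ξ α n) →
            NonresEstimates ν r' ε A A' B f') ∧
          (∀ n : Fin d → ℤ, 0 < l1 n → l1 n ≤ truncN ν r r' ε →
              resDist ξ α n < ε ^ (1 / 20 : ℝ) →
            ResEstimates γ τ ν r r' ε α ξ n A A' B f')) ∧
      (∀ δ : ℝ, 0 < δ → ∃ ε₀ : ℝ, 0 < ε₀ ∧ ∀ r r' ε : ℝ, 0 < r' → r' < r →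
        0 < ε → ε ≤ ε₀ → ε ≤ c * (min 1 (1 / r) * (r - r')) ^ (D * τ / ν) →
        resBound ν τ r r' ε ≤ δ * ε ^ 2) := by
  refine ⟨1100, by norm_num, fun d γ τ ν hd hγ _ hdτ hν hν1 => ?_⟩
  have hτ : 0 < τ := (Nat.cast_nonneg d).trans_lt hdτ
  obtain ⟨c, hc, hc1, hsmall⟩ := eventually_small (max 1000000 (2 ^ (τ + 1) / γ)) 0
    (s := 1 / 1100) (τ / ν) (u := 48 * ν / (1100 * τ)) (by norm_num) (by positivity)
  refine ⟨c, hc, fun α r r' ε A f ξ hα hr' hrr hA hξ hf hfε hε => ?_, fun δ hδ => ?_⟩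
  · obtain ⟨w0, w1, -, -⟩ := width_pos_lt hr' hrr
    set W := min 1 (1 / r) * (r - r')
    have hε0 : 0 < ε := (tsum_nonneg (gevreyTerm_nonneg f)).trans_lt hfε
    have hA1 := one_le_canonNorm hA
    have hA0 : 0 < canonNorm A := by linarith
    have hX1 : canonNorm A ^ (-1100 : ℝ) ≤ 1 := Real.rpow_le_one_of_one_le_of_nonpos hA1 (by norm_num)
    have hX0 : 0 ≤ canonNorm A ^ (-1100 : ℝ) := by positivity
    have hY1 : W ^ (1100 * τ / ν) ≤ 1 := Real.rpow_le_one w0.le w1.le (by positivity)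
    have hY0 : 0 ≤ W ^ (1100 * τ / ν) := by positivity
    have hεc : ε ≤ c := hε.trans (mul_le_of_le_one_right (by positivity) hY1 |>.trans
      (mul_le_of_le_one_right hc.le hX1))
    have hεW : ε ≤ W ^ (1100 * τ / ν) := hε.trans
      (mul_le_of_le_one_left hY0 (mul_le_one₀ hc1.le hX0 hX1))
    have hεA : ε ≤ canonNorm A ^ (-1100 : ℝ) := hε.trans
      (mul_le_of_le_one_right (by positivity) hY1 |>.trans (mul_le_of_le_one_left hX0 hc1.le))
    have hε1 : ε < 1 := hεc.trans_lt hc1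
    obtain ⟨s1, s2, s3⟩ := hsmall ε hε0 hεc
    set p := ε ^ (1 / 1100 : ℝ) with hp
    have hp0 : 0 < p := Real.rpow_pos_of_pos hε0 _
    have hpi : ε ^ (-(1 / 1100) : ℝ) = p⁻¹ := Real.rpow_neg hε0.le _
    have hpε : ε = p ^ 1100 := by
      rw [hp, ← Real.rpow_natCast, ← Real.rpow_mul hε0.le]; norm_num
    have h55 : ε ^ (1 / 20 : ℝ) = p ^ 55 := by
      rw [hp, ← Real.rpow_natCast, ← Real.rpow_mul hε0.le]; norm_num
    have hT := truncN_rpow_le hν hτ hr' hrr hε0 hεW s2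
    have hb := resBound_le hν hτ hr' hrr hε0 hε1 hεW one_pos (by simpa using s3)
    rw [hpi] at s1 hT
    rw [one_mul] at hb
    have hp6 : p ≤ 1 / 1000000 := by
      rw [le_one_div hp0 (by norm_num), one_div]
      exact (le_max_left _ _).trans s1
    have hAp : canonNorm A ≤ p⁻¹ := by
      rw [le_inv_comm₀ hA0 hp0]
      have := Real.rpow_le_rpow hε0.le hεA (by norm_num : (0 : ℝ) ≤ 1 / 1100)
      rw [← Real.rpow_mul hA0.le] at this
      rw [← Real.rpow_neg_one]
      norm_num at this ⊢
      exact this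
    rw [h55]
    exact kam_step hγ hτ hν hν1 hr' hrr hα hA hξ hf hfε hp0 hp6 hpε hAp
      ((le_max_right _ _).trans s1) (by rwa [sq]) hb
  · obtain ⟨ε₀, h0, h1, h2⟩ := eventually_small 0 |Real.log δ|
      (s := 1) 1 (u := 48 * ν / (1100 * τ)) one_pos (by positivity)
    refine ⟨ε₀, h0, fun r r' ε hr' hrr hε hεε hεW => ?_⟩
    obtain ⟨w0, -, -, -⟩ := width_pos_lt hr' hrr
    exact resBound_le hν hτ hr' hrr hε (hεε.trans_lt h1)
      (hεW.trans (mul_le_of_le_one_left (by positivity) hc1.le)) hδ (h2 ε hε hεε).2.2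

end
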